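/- Let $n\in\mathbb N$ and let $\mathrm{Br}(\mathrm C_n)$ be the Brauer algebra of type $\mathrm C_n$: the unital associative $\mathbb Z[\delta^{\pm1}]$-algebra generated by $r_0,\dots,r_{n-1},e_0,\dots,e_{n-1}$ subject to the following relations, where $i\sim j$ means $|i-j|=1$. For all $i,j$: $r_i^2=1$; $r_ie_i=e_ir_i=e_i$; $e_i^2=\delta^2e_i$ if $i>0$; $e_0^2=\delta e_0$; $r_ir_j=r_jr_i$, $e_ir_j=r_je_i$, $e_ie_j=e_je_i$ if $i\not\sim j$; $r_ir_jr_i=r_jr_ir_j$, $r_jr_ie_j=e_ie_j$, $r_ie_jr_i=r_je_ir_j$ if $i\sim j$ and $i,j>0$; and, if $n\ge2$, $r_1r_0r_1r_0=r_0r_1r_0r_1$, $r_1r_0e_1=r_0e_1$, $r_1e_0r_1e_0=e_0e_1e_0$, $(r_1r_0r_1)e_0=e_0(r_1r_0r_1)$, $e_1r_0e_1=\delta e_1$, $e_1e_0e_1=\delta e_1$, $e_1r_0r_1=e_1r_0$, $e_1e_0r_1=e_1e_0$. Let $\mathrm{BrM}(\mathrm C_n)$ be the multiplicative submonoid of $\mathrm{Br}(\mathrm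 C_n)$ generated by $\delta,\delta^{-1}$ and all $r_i,e_i$; let $W(\mathrm C_n)$ be the group generated by $r_0,\dots,r_{n-1}$ inside it; and let $x\mapsto x^{\mathrm{op}}$ be the $\mathbb Z[\delta^{\pm1}]$-linear anti-involution of $\mathrm{Br}(\mathrm C_n)$ fixing all $r_i$ and $e_i$. For $1\le i\le n$ put $$y_i=r_{i-1}\cdots r_1r_0r_1\cdots r_{i-1},\qquad z_i=r_{i-1}\cdots r_1e_0r_1\cdots r_{i-1}.$$ For $0\le i\le n$ put $b_i=z_1z_2\cdots z_i$. For $0\le p,p'\le i\le n$ with $i-p$ and $i-p'$ even put $$e_{i,p}=e_{p+1}e_{p+3}\cdots e_{i-1},\qquad b_{p,i,p'}=e_{i,p}\,b_i\,e_{i,p'}.$$ With $i-p=2q$, let $A_{i,p}\le W(\mathrm C_n)$ be generated by $r_j$ $(0\le j\le p-1)$, $r_{p+2k-1}$ $(1\le k\le q)$, $t_{0,p}=y_{p+1}r_{p+1}y_{p+1}$ (only if $q\ge1$) and $t_{k,p}=r_{p+2k}r_{p+2k-1}r_{p+2k+1}r_{p+2k}$ $(1\le k\le q-1)$. Let $L_i\le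 W(\mathrm C_n)$ be generated by $y_{i+1},r_{i+1},\dots,r_{n-1}$ (so $L_n=1$), let $N_{i,p}=\langle A_{i,p},L_i\rangle$, and let $D_{i,p}$ be any fixed set of representatives for the left cosets of $N_{i,p}$ in $W(\mathrm C_n)$. **Theorem.** Each element of $\mathrm{BrM}(\mathrm C_n)$ can be written as $$\delta^k\,u\,b_{p,i,p'}\,v\,w^{\mathrm{op}}$$ with $k\in\mathbb Z$, $i\in\{0,\dots,n\}$, $p,p'\in\{0,\dots,i\}$ such that $i-p$ and $i-p'$ are even, $u\in D_{i,p}$, $v\in L_i$ and $w\in D_{i,p'}$. In particular, $\mathrm{Br}(\mathrm C_n)$ is a free $\mathbb Z[\delta^{\pm1}]$-module of rank at most $a_{2n}$, where $a_0=a_1=1$ and $a_m=a_{m-1}+2(m-1)a_{m-2}$ for $m\ge2$. -/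

import Mathlib

namespace BrauerC

/-- Names of the generators `r_0, …, r_{n-1}` and `e_0, …, e_{n-1}`, indexed by the nodes of the
Dynkin diagram `C_n`, the chain `0 - 1 - ⋯ - (n-1)` whose double bond joins `0` and `1`. -/
inductive Gen (n : ℕ) : Type
  | r (i : Fin n) : Gen n
  | e (i : Fin n) : Gen n

/-- Adjacency of nodes of the Dynkin diagram `C_n`. -/
def Adj {n : ℕ} (i j : Fin n) : Prop := (i : ℕ) + 1 = j ∨ (j : ℕ) + 1 = i

section General

variable (n : ℕ) (R : Type*) [CommRing R] (δ : Rˣ)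

/-- The free generator `r_i`. -/
abbrev fr {n : ℕ} (R : Type*) [CommRing R] (i : Fin n) : FreeAlgebra R (Gen n) :=
  FreeAlgebra.ι R (Gen.r i)

/-- The free generator `e_i`. -/
abbrev fe {n : ℕ} (R : Type*) [CommRing R] (i : Fin n) : FreeAlgebra R (Gen n) :=
  FreeAlgebra.ι R (Gen.e i)

/-- The defining relations of the Brauer algebra of type `C_n` with loop parameter `δ`. In the
last eight relations `o` and `l` are the nodes `0` and `1`. -/
inductive Rel : FreeAlgebra R (Gen n) → FreeAlgebra R (Gen n) → Prop
  | r_sq (i : Fin n) : Rel (fr R i * fr R i) 1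
  | r_e (i : Fin n) : Rel (fr R i * fe R i) (fe R i)
  | e_r (i : Fin n) : Rel (fe R i * fr R i) (fe R i)
  | e_sq (i : Fin n) (hi : 0 < (i : ℕ)) : Rel (fe R i * fe R i) (((δ : R) ^ 2) • fe R i)
  | e_sq_zero (i : Fin n) (hi : (i : ℕ) = 0) : Rel (fe R i * fe R i) ((δ : R) • fe R i)
  | rr_comm (i j : Fin n) (h : ¬ Adj i j) : Rel (fr R i * fr R j) (fr R j * fr R i)
  | er_comm (i j : Fin n) (h : ¬ Adj i j) : Rel (fe R i * fr R j) (fr R j * fe R i)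
  | ee_comm (i j : Fin n) (h : ¬ Adj i j) : Rel (fe R i * fe R j) (fe R j * fe R i)
  | rrr (i j : Fin n) (h : Adj i j) (hi : 0 < (i : ℕ)) (hj : 0 < (j : ℕ)) :
      Rel (fr R i * fr R j * fr R i) (fr R j * fr R i * fr R j)
  | rre (i j : Fin n) (h : Adj i j) (hi : 0 < (i : ℕ)) (hj : 0 < (j : ℕ)) :
      Rel (fr R j * fr R i * fe R j) (fe R i * fe R j)
  | rer (i j : Fin n) (h : Adj i j) (hi : 0 < (i : ℕ)) (hj : 0 < (j : ℕ)) :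
      Rel (fr R i * fe R j * fr R i) (fr R j * fe R i * fr R j)
  | lolo (l o : Fin n) (hl : (l : ℕ) = 1) (ho : (o : ℕ) = 0) :
      Rel (fr R l * fr R o * fr R l * fr R o) (fr R o * fr R l * fr R o * fr R l)
  | r_r_e (l o : Fin n) (hl : (l : ℕ) = 1) (ho : (o : ℕ) = 0) :
      Rel (fr R l * fr R o * fe R l) (fr R o * fe R l)
  | r_e_r_e (l o : Fin n) (hl : (l : ℕ) = 1) (ho : (o : ℕ) = 0) :
      Rel (fr R l * fe R o * fr R l * fe R o) (fe R o * fe R l * fe R o)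
  | rrr_e (l o : Fin n) (hl : (l : ℕ) = 1) (ho : (o : ℕ) = 0) :
      Rel ((fr R l * fr R o * fr R l) * fe R o) (fe R o * (fr R l * fr R o * fr R l))
  | e_r_e (l o : Fin n) (hl : (l : ℕ) = 1) (ho : (o : ℕ) = 0) :
      Rel (fe R l * fr R o * fe R l) ((δ : R) • fe R l)
  | e_e_e (l o : Fin n) (hl : (l : ℕ) = 1) (ho : (o : ℕ) = 0) :
      Rel (fe R l * fe R o * fe R l) ((δ : R) • fe R l)
  | e_r_r (l o : Fin n) (hl : (l : ℕ) = 1) (ho : (o : ℕ) = 0) :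
      Rel (fe R l * fr R o * fr R l) (fe R l * fr R o)
  | e_e_r (l o : Fin n) (hl : (l : ℕ) = 1) (ho : (o : ℕ) = 0) :
      Rel (fe R l * fe R o * fr R l) (fe R l * fe R o)

/-- The Brauer algebra `Br(C_n, R, δ)`. -/
abbrev BrauerAlgebra : Type _ := RingQuot (Rel n R δ)

variable {n R}

/-- The image of a generator in `Br(C_n, R, δ)`. -/
noncomputable def gen (g : Gen n) : BrauerAlgebra n R δ :=
  RingQuot.mkAlgHom R (Rel n R δ) (FreeAlgebra.ι R g)

variable {δ}

theorem mk_eq {x y : FreeAlgebra R (Gen n)} (h : Rel n R δ x y) :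
    RingQuot.mkAlgHom R (Rel n R δ) x = RingQuot.mkAlgHom R (Rel n R δ) y :=
  RingQuot.mkAlgHom_rel R h

theorem gen_r_sq (i : Fin n) : gen δ (Gen.r i) * gen δ (Gen.r i) = 1 := by
  simpa [gen] using mk_eq (Rel.r_sq (R := R) (δ := δ) i)

theorem dual_rre (i j : Fin n) (h : Adj i j) (hi : 0 < (i : ℕ)) (hj : 0 < (j : ℕ)) :
    gen δ (Gen.e j) * gen δ (Gen.r i) * gen δ (Gen.r j) = gen δ (Gen.e j) * gen δ (Gen.e i) := by
  have h1 : gen δ (Gen.r i) * gen δ (Gen.e j) * gen δ (Gen.r i)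
      = gen δ (Gen.r j) * gen δ (Gen.e i) * gen δ (Gen.r j) := by
    simpa [gen] using mk_eq (Rel.rer (R := R) (δ := δ) i j h hi hj)
  have h2 : gen δ (Gen.r i) * gen δ (Gen.r j) * gen δ (Gen.e i)
      = gen δ (Gen.e j) * gen δ (Gen.e i) := by
    simpa [gen] using mk_eq (Rel.rre (R := R) (δ := δ) j i h.symm hj hi)
  rw [← h2]
  calc gen δ (Gen.e j) * gen δ (Gen.r i) * gen δ (Gen.r j)
      = (gen δ (Gen.r i) * gen δ (Gen.r i)) * gen δ (Gen.e j) * gen δ (Gen.r i)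
          * gen δ (Gen.r j) := by rw [gen_r_sq, one_mul]
    _ = gen δ (Gen.r i) * (gen δ (Gen.r i) * gen δ (Gen.e j) * gen δ (Gen.r i))
          * gen δ (Gen.r j) := by simp only [mul_assoc]
    _ = gen δ (Gen.r i) * gen δ (Gen.r j) * gen δ (Gen.e i)
          * (gen δ (Gen.r j) * gen δ (Gen.r j)) := by rw [h1]; simp only [mul_assoc]
    _ = _ := by rw [gen_r_sq, mul_one]

theorem dual_e_e_r (l o : Fin n) (hl : (l : ℕ) = 1) (ho : (o : ℕ) = 0) :
    gen δ (Gen.r l) * gen δ (Gen.e o) * gen δ (Gen.e l) = gen δ (Gen.e o) * gen δ (Gen.e l) := by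
  have h1 : gen δ (Gen.e l) * gen δ (Gen.e o) * gen δ (Gen.e l) = (δ : R) • gen δ (Gen.e l) := by
    simpa [gen] using mk_eq (Rel.e_e_e (R := R) (δ := δ) l o hl ho)
  have h2 : gen δ (Gen.r l) * gen δ (Gen.e o) * gen δ (Gen.r l) * gen δ (Gen.e o)
      = gen δ (Gen.e o) * gen δ (Gen.e l) * gen δ (Gen.e o) := by
    simpa [gen] using mk_eq (Rel.r_e_r_e (R := R) (δ := δ) l o hl ho)
  have h0 : gen δ (Gen.r l) * gen δ (Gen.e l) = gen δ (Gen.e l) := by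
    simpa [gen] using mk_eq (Rel.r_e (R := R) (δ := δ) l)
  have h0' : gen δ (Gen.e l) * gen δ (Gen.r l) = gen δ (Gen.e l) := by
    simpa [gen] using mk_eq (Rel.e_r (R := R) (δ := δ) l)
  have h3 : gen δ (Gen.e o) * gen δ (Gen.e o) = (δ : R) • gen δ (Gen.e o) := by
    simpa [gen] using mk_eq (Rel.e_sq_zero (R := R) (δ := δ) o ho)
  have hr := gen_r_sq (δ := δ) l
  generalize gen δ (Gen.r l) = x at *
  generalize gen δ (Gen.e o) = y at *
  generalize gen δ (Gen.e l) = w at *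
  have h4 : y * (x * y * w) = (δ : R) • (x * y * w) := by
    calc y * (x * y * w) = (x * x) * y * x * y * w := by rw [hr, one_mul]; simp only [mul_assoc]
      _ = x * (x * y * x * y) * w := by simp only [mul_assoc]
      _ = x * y * (w * y * w) := by rw [h2]; simp only [mul_assoc]
      _ = _ := by rw [h1, mul_smul_comm]
  have h5 : w * (x * y * w) = (δ : R) • w := by
    rw [← mul_assoc, ← mul_assoc, h0', h1]
  have h6 : y * w * y * (x * y * w) = (δ : R) • (δ : R) • (y * w) := by
    rw [mul_assoc, h4, mul_smul_comm, mul_assoc, h5, mul_smul_comm]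
  have h7 : x * y * x * y * (x * y * w) = (δ : R) • (δ : R) • (x * y * w) := by
    rw [mul_assoc, h4, mul_smul_comm]
    congr 1
    calc x * y * x * (x * y * w) = x * y * (x * x) * y * w := by simp only [mul_assoc]
      _ = x * (y * y) * w := by rw [hr, mul_one]; simp only [mul_assoc]
      _ = _ := by rw [h3, mul_smul_comm, smul_mul_assoc]
  rw [h2, h6] at h7
  have h9 := congrArg (fun v => ((δ⁻¹ : Rˣ) : R) • ((δ⁻¹ : Rˣ) : R) • v) h7
  simpa [smul_smul, mul_assoc] using h9.symm

theorem dual_r_e_r_e (l o : Fin n) (hl : (l : ℕ) = 1) (ho : (o : ℕ) = 0) :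
    gen δ (Gen.e o) * gen δ (Gen.r l) * gen δ (Gen.e o) * gen δ (Gen.r l)
      = gen δ (Gen.e o) * gen δ (Gen.e l) * gen δ (Gen.e o) := by
  have h2 : gen δ (Gen.r l) * gen δ (Gen.e o) * gen δ (Gen.r l) * gen δ (Gen.e o)
      = gen δ (Gen.e o) * gen δ (Gen.e l) * gen δ (Gen.e o) := by
    simpa [gen] using mk_eq (Rel.r_e_r_e (R := R) (δ := δ) l o hl ho)
  have h3 : gen δ (Gen.e l) * gen δ (Gen.e o) * gen δ (Gen.r l)
      = gen δ (Gen.e l) * gen δ (Gen.e o) := by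
    simpa [gen] using mk_eq (Rel.e_e_r (R := R) (δ := δ) l o hl ho)
  have h4 : gen δ (Gen.e o) * gen δ (Gen.r l) * gen δ (Gen.e o)
      = gen δ (Gen.e o) * gen δ (Gen.e l) * gen δ (Gen.e o) := by
    calc gen δ (Gen.e o) * gen δ (Gen.r l) * gen δ (Gen.e o)
        = (gen δ (Gen.r l) * gen δ (Gen.r l)) * gen δ (Gen.e o) * gen δ (Gen.r l)
            * gen δ (Gen.e o) := by rw [gen_r_sq, one_mul]
      _ = gen δ (Gen.r l) * (gen δ (Gen.r l) * gen δ (Gen.e o) * gen δ (Gen.r l)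
            * gen δ (Gen.e o)) := by simp only [mul_assoc]
      _ = (gen δ (Gen.r l) * gen δ (Gen.e o) * gen δ (Gen.e l)) * gen δ (Gen.e o) := by
            rw [h2]; simp only [mul_assoc]
      _ = _ := by rw [dual_e_e_r l o hl ho]
  rw [h4, mul_assoc, mul_assoc, ← mul_assoc (gen δ (Gen.e l)), h3, mul_assoc]

variable (δ)

/-- The assignment of generators that underlies `op`. -/
noncomputable def opFree : FreeAlgebra R (Gen n) →ₐ[R] (BrauerAlgebra n R δ)ᵐᵒᵖ :=
  FreeAlgebra.lift R (fun g => MulOpposite.op (gen δ g))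

theorem opFree_rel ⦃x y : FreeAlgebra R (Gen n)⦄ (h : Rel n R δ x y) :
    opFree δ x = opFree δ y := by
  apply MulOpposite.unop_injective
  have key := mk_eq (R := R) (δ := δ) h
  cases h with
  | rre i j h hi hj => simpa [opFree, mul_assoc] using dual_rre (R := R) (δ := δ) i j h hi hj
  | r_r_e l o hl ho =>
    simpa [opFree, gen, mul_assoc] using mk_eq (Rel.e_r_r (R := R) (δ := δ) l o hl ho)
  | e_r_r l o hl ho =>
    simpa [opFree, gen, mul_assoc] using mk_eq (Rel.r_r_e (R := R) (δ := δ) l o hl ho)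
  | r_e_r_e l o hl ho =>
    simpa [opFree, mul_assoc] using dual_r_e_r_e (R := R) (δ := δ) l o hl ho
  | e_e_r l o hl ho =>
    simpa [opFree, mul_assoc] using dual_e_e_r (R := R) (δ := δ) l o hl ho
  | r_e i => simpa [opFree, gen, mul_assoc] using mk_eq (Rel.e_r (R := R) (δ := δ) i)
  | e_r i => simpa [opFree, gen, mul_assoc] using mk_eq (Rel.r_e (R := R) (δ := δ) i)
  | rr_comm => simpa [opFree, gen, mul_assoc] using key.symm
  | er_comm => simpa [opFree, gen, mul_assoc] using key.symm
  | ee_comm => simpa [opFree, gen, mul_assoc] using key.symm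
  | lolo => simpa [opFree, gen, mul_assoc] using key.symm
  | rrr_e => simpa [opFree, gen, mul_assoc] using key.symm
  | _ => simpa [opFree, gen, mul_assoc] using key

/-- The anti-involution `op` of `Br(C_n, R, δ)`, as a homomorphism to the opposite algebra. -/
noncomputable def opHom : BrauerAlgebra n R δ →ₐ[R] (BrauerAlgebra n R δ)ᵐᵒᵖ :=
  RingQuot.liftAlgHom R ⟨opFree δ, opFree_rel δ⟩

variable {δ}

/-- The `R`-linear anti-involution `x ↦ x^op` of `Br(C_n, R, δ)` that fixes all `r_i` and `e_i`. -/
noncomputable def opp (x : BrauerAlgebra n R δ) : BrauerAlgebra n R δ :=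
  (opHom δ x).unop

theorem opp_gen (g : Gen n) : opp (gen δ g) = gen δ g := by
  simp [opp, opHom, opFree, gen]

theorem opp_mul (x y : BrauerAlgebra n R δ) : opp (x * y) = opp y * opp x := by
  simp [opp]

end General

open scoped LaurentPolynomial

/-- The indeterminate `δ`, as a unit of the ring `ℤ[δ, δ⁻¹]` of Laurent polynomials. -/
noncomputable def delta : (ℤ[T;T⁻¹])ˣ where
  val := LaurentPolynomial.T 1
  inv := LaurentPolynomial.T (-1)
  val_inv := by rw [← LaurentPolynomial.T_add]; simp
  inv_val := by rw [← LaurentPolynomial.T_add]; simp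

/-- The Brauer algebra `Br(C_n)` over `ℤ[δ, δ⁻¹]`. -/
abbrev Br (n : ℕ) : Type := BrauerAlgebra n ℤ[T;T⁻¹] delta

variable (n : ℕ)

/-- The Brauer monoid `BrM(C_n)`. -/
noncomputable def BrM : Submonoid (Br n) :=
  Submonoid.closure
    ({algebraMap ℤ[T;T⁻¹] (Br n) (delta : ℤ[T;T⁻¹]),
      algebraMap ℤ[T;T⁻¹] (Br n) ((delta⁻¹ : (ℤ[T;T⁻¹])ˣ) : ℤ[T;T⁻¹])} ∪
      Set.range (gen delta))

/-- The involution `r_i`, as a unit of `Br(C_n)`. -/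
noncomputable def rUnit (i : Fin n) : (Br n)ˣ :=
  ⟨gen delta (Gen.r i), gen delta (Gen.r i), gen_r_sq i, gen_r_sq i⟩

/-- `W(C_n)`: what the involutions `r_0, …, r_{n-1}` generate in `BrM(C_n)`. -/
abbrev W : Type := Subgroup.closure (Set.range (rUnit n))

variable {n}

/-- The inclusion of `W(C_n)` in `Br(C_n)`. -/
noncomputable def W.toBr (w : W n) : Br n := ((w : (Br n)ˣ) : Br n)

variable (n)

/-- `r_j ∈ W(C_n)` for a natural number `j < n` (with the value `1`, never used, for `j ≥ n`). -/
noncomputable def r (j : ℕ) : W n :=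
  if h : j < n then ⟨rUnit n ⟨j, h⟩, Subgroup.subset_closure ⟨_, rfl⟩⟩ else 1

/-- `e_j ∈ Br(C_n)` for a natural number `j < n` (with the value `1`, never used, for `j ≥ n`). -/
noncomputable def e (j : ℕ) : Br n :=
  if h : j < n then gen delta (Gen.e ⟨j, h⟩) else 1

/-- `y_i = r_{i-1} ⋯ r_1 r_0 r_1 ⋯ r_{i-1}` for `1 ≤ i ≤ n`. -/
noncomputable def y : ℕ → W n
  | 0 => 1
  | 1 => r n 0
  | i + 2 => r n (i + 1) * y (i + 1) * r n (i + 1)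

/-- `z_i = r_{i-1} ⋯ r_1 e_0 r_1 ⋯ r_{i-1}` for `1 ≤ i ≤ n`. -/
noncomputable def z : ℕ → Br n
  | 0 => 1
  | 1 => e n 0
  | i + 2 => (r n (i + 1)).toBr * z (i + 1) * (r n (i + 1)).toBr

/-- `b_i = z_1 z_2 ⋯ z_i`. -/
noncomputable def b (i : ℕ) : Br n :=
  ((List.range i).map fun k => z n (k + 1)).prod

/-- `e_{i,p} = e_{p+1} e_{p+3} ⋯ e_{i-1}`, for `i - p` even. -/
noncomputable def eProd (i p : ℕ) : Br n :=
  ((List.range ((i - p) / 2)).map fun k => e n (p + 2 * k + 1)).prod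

/-- `b_{p,i,p'} = e_{i,p} b_i e_{i,p'}`. -/
noncomputable def bTriple (p i p' : ℕ) : Br n :=
  eProd n i p * b n i * eProd n i p'

/-- `t_{0,p} = y_{p+1} r_{p+1} y_{p+1}` and
`t_{k,p} = r_{p+2k} r_{p+2k-1} r_{p+2k+1} r_{p+2k}` for `k ≥ 1`. -/
noncomputable def t (k p : ℕ) : W n :=
  if k = 0 then y n (p + 1) * r n (p + 1) * y n (p + 1)
  else r n (p + 2 * k) * r n (p + 2 * k - 1) * r n (p + 2 * k + 1) * r n (p + 2 * k)

/-- The subgroup `A_{i,p}` of `W(C_n)`, where `i - p = 2q`, generated by `r_j` (`0 ≤ j ≤ p - 1`),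
`r_{p+2k-1}` (`1 ≤ k ≤ q`) and `t_{k,p}` (`0 ≤ k ≤ q - 1`). -/
noncomputable def A (i p : ℕ) : Subgroup (W n) :=
  Subgroup.closure
    ({x | ∃ j < p, x = r n j} ∪
      {x | ∃ k, 1 ≤ k ∧ k ≤ (i - p) / 2 ∧ x = r n (p + 2 * k - 1)} ∪
      {x | ∃ k < (i - p) / 2, x = t n k p})

/-- The subgroup `L_i` of `W(C_n)` generated by `y_{i+1}, r_{i+1}, …, r_{n-1}`; it is trivial
for `i = n`. -/
noncomputable def L (i : ℕ) : Subgroup (W n) :=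
  Subgroup.closure ({x | i < n ∧ x = y n (i + 1)} ∪ {x | ∃ j, i + 1 ≤ j ∧ j < n ∧ x = r n j})

/-- `N_{i,p}`, the subgroup of `W(C_n)` generated by `A_{i,p}` and `L_i`. -/
noncomputable def N (i p : ℕ) : Subgroup (W n) := A n i p ⊔ L n i

/-- The sequence `a_0 = a_1 = 1`, `a_m = a_{m-1} + 2 (m-1) a_{m-2}`. -/
def a : ℕ → ℕ
  | 0 => 1
  | 1 => 1
  | m + 2 => a (m + 1) + 2 * (m + 1) * a m

end BrauerC

/-!
The generators are read as Brauer diagrams on the `2n` points `±1, …, ±n` that are symmetric under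
`x ↦ -x`: `r_0` changes the sign of `1`, `r_j` exchanges `j` with `j + 1` (and `-j` with
`-(j + 1)`), `e_0` joins `1` to `-1` and `e_j` joins `j` to `j + 1` and `-j` to `-(j + 1)`. The
proof never uses diagrams themselves; it shows that the relations suffice for the computations that
the pictures suggest.

*Normal forms.* The relations between the `r_j` are the Coxeter relations of type `B_n`, and these
determine an element of `W(C_n)` from its signed permutation (`graph_injective`). Hence each signed
permutation `π` acts on `Br(C_n)` by conjugation, and since `e_0` and `e_1` commute with the
pointwise stabilizers of `1` and of `1, 2`, their conjugates are elements `zPt x` and `ePt x y` that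
depend only on the images `x = π 1` and `y = π 2`. Every defining relation thereby becomes a family
of relations between cups at arbitrary points. Let a half diagram with `i` cups be a product
`δ^k w e_{i,p} b_i` with `w ∈ W(C_n)`. Multiplication of a half diagram by a generator yields
either a half diagram with `i` cups or a monomial that contains `b_{i+1}` (`gen_mul_mem`, by cases
according to the positions of the cups). By induction on `n - i`, every monomial is the product of a
half diagram and the opposite of another one (`exists_halves`). The group `A_{i,p}` is absorbed by
`e_{i,p} b_i`, while `L_i` commutes with it, so `w` may be chosen among the representatives of the
cosets of `N_{i,p}` (`exists_normalForm`).

*Rank.* Sorting half diagrams by the set of points that their cups occupy shows that, up to powers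
of `δ` and signed permutations of the other points, there are at most `C(n, i) a_i` of them. Hence
`∑ i, C(n, i)² a_i² 2^(n-i) (n-i)!` monomials span, and this sum is `a_{2n}` (`sum_card_eq`): it
sorts the objects counted by `a_{2n}` by the number of strands between two halves of size `n`.

*Freeness.* All defining relations equate monomials. Hence `Br(C_n)` maps to the monoid ring
`ℤ[BrM(C_n)]`, where distinct elements of `BrM(C_n)` are independent over `ℤ`. Representatives of
`BrM(C_n)` modulo powers of `δ` are therefore independent over `ℤ[δ, δ⁻¹]`, provided that no
monomial equals a proper `δ`-multiple of itself. The latter follows from a representation on tensors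
in which `δ` acts as `2` and monomials act by nonzero operators
(`eq_zero_of_delta_zpow_smul_eq`).
-/

namespace BrauerC

open scoped LaurentPolynomial
open Equiv

variable {n : ℕ}

/-! ### Relations between the generators -/

theorem W.toBr_mul (u v : W n) : (u * v).toBr = u.toBr * v.toBr := rfl

theorem W.toBr_one : (1 : W n).toBr = 1 := rfl

theorem W.toBr_inv_mul (u : W n) : (u⁻¹).toBr * u.toBr = 1 := by
  rw [← W.toBr_mul, inv_mul_cancel, W.toBr_one]

theorem W.toBr_mul_inv (u : W n) : u.toBr * (u⁻¹).toBr = 1 := by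
  rw [← W.toBr_mul, mul_inv_cancel, W.toBr_one]

theorem W.toBr_injective : Function.Injective (W.toBr (n := n)) := fun _ _ h =>
  Subtype.ext (Units.ext h)

theorem r_toBr {j : ℕ} (h : j < n) : (r n j).toBr = gen delta (Gen.r ⟨j, h⟩) := by
  simp [r, h, W.toBr, rUnit]

theorem e_eq {j : ℕ} (h : j < n) : e n j = gen delta (Gen.e ⟨j, h⟩) := by
  simp [e, h]

/-- The defining relations, transported to the quotient. -/
theorem rel_eq {x y : FreeAlgebra ℤ[T;T⁻¹] (Gen n)} (h : Rel n ℤ[T;T⁻¹] delta x y) :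
    RingQuot.mkAlgHom ℤ[T;T⁻¹] (Rel n ℤ[T;T⁻¹] delta) x =
      RingQuot.mkAlgHom ℤ[T;T⁻¹] (Rel n ℤ[T;T⁻¹] delta) y := mk_eq h

/-- The image of `δ` in the ground ring. -/
noncomputable abbrev dl : ℤ[T;T⁻¹] := ((delta : (ℤ[T;T⁻¹])ˣ) : ℤ[T;T⁻¹])

theorem r_mul_self (j : ℕ) : r n j * r n j = 1 := by
  by_cases h : j < n
  · apply W.toBr_injective
    rw [W.toBr_mul, r_toBr h, W.toBr_one]
    exact gen_r_sq _
  · simp [r, h]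

theorem r_inv (j : ℕ) : (r n j)⁻¹ = r n j := inv_eq_of_mul_eq_one_right (r_mul_self j)

theorem rB_sq (j : ℕ) : (r n j).toBr * (r n j).toBr = 1 := by
  rw [← W.toBr_mul, r_mul_self, W.toBr_one]

section

variable {i j : ℕ}

theorem re (hj : j < n) : (r n j).toBr * e n j = e n j := by
  simpa [r_toBr hj, e_eq hj, gen] using rel_eq (Rel.r_e (⟨j, hj⟩ : Fin n))

theorem er (hj : j < n) : e n j * (r n j).toBr = e n j := by
  simpa [r_toBr hj, e_eq hj, gen] using rel_eq (Rel.e_r (⟨j, hj⟩ : Fin n))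

theorem ee (hj : j < n) (h0 : 0 < j) : e n j * e n j = (dl ^ 2) • e n j := by
  simpa [e_eq hj, gen] using rel_eq (Rel.e_sq (⟨j, hj⟩ : Fin n) h0)

theorem ee_zero (hj : 0 < n) : e n 0 * e n 0 = dl • e n 0 := by
  simpa [e_eq hj, gen] using rel_eq (Rel.e_sq_zero (⟨0, hj⟩ : Fin n) rfl)

theorem rr_comm (hi : i < n) (hj : j < n) (h : ¬ (i + 1 = j ∨ j + 1 = i)) :
    r n i * r n j = r n j * r n i := by
  apply W.toBr_injective
  simpa [W.toBr_mul, r_toBr hj, r_toBr hi, gen] using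
    rel_eq (Rel.rr_comm (⟨i, hi⟩ : Fin n) ⟨j, hj⟩ h)

theorem er_comm (hi : i < n) (hj : j < n) (h : ¬ (i + 1 = j ∨ j + 1 = i)) :
    e n i * (r n j).toBr = (r n j).toBr * e n i := by
  simpa [r_toBr hj, e_eq hi, gen] using
    rel_eq (Rel.er_comm (⟨i, hi⟩ : Fin n) ⟨j, hj⟩ h)

theorem ee_comm (hi : i < n) (hj : j < n) (h : ¬ (i + 1 = j ∨ j + 1 = i)) :
    e n i * e n j = e n j * e n i := by
  simpa [e_eq hj, e_eq hi, gen] using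
    rel_eq (Rel.ee_comm (⟨i, hi⟩ : Fin n) ⟨j, hj⟩ h)

theorem rrr (hi : 0 < i) (h : i + 1 < n) :
    r n i * r n (i + 1) * r n i = r n (i + 1) * r n i * r n (i + 1) := by
  apply W.toBr_injective
  simpa [W.toBr_mul, r_toBr h, r_toBr (show i < n by omega), gen] using
    rel_eq (Rel.rrr (⟨i, by omega⟩ : Fin n) ⟨i + 1, h⟩ (Or.inl rfl) hi (by simp))

/-- `r_j r_i e_j = e_i e_j` for adjacent `i, j > 0`. -/
theorem rre (hi : 0 < i) (hin : i < n) (hj : 0 < j) (hjn : j < n) (h : i + 1 = j ∨ j + 1 = i) :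
    (r n j).toBr * (r n i).toBr * e n j = e n i * e n j := by
  simpa [r_toBr hin, r_toBr hjn, e_eq hin, e_eq hjn, gen] using
    rel_eq (Rel.rre (⟨i, hin⟩ : Fin n) ⟨j, hjn⟩ h hi hj)

theorem err (hi : 0 < i) (hin : i < n) (hj : 0 < j) (hjn : j < n) (h : i + 1 = j ∨ j + 1 = i) :
    e n j * (r n i).toBr * (r n j).toBr = e n j * e n i := by
  rw [r_toBr hin, r_toBr hjn, e_eq hin, e_eq hjn]
  exact dual_rre (⟨i, hin⟩ : Fin n) ⟨j, hjn⟩ h hi hj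

theorem rer (hi : 0 < i) (hin : i < n) (hj : 0 < j) (hjn : j < n) (h : i + 1 = j ∨ j + 1 = i) :
    (r n i).toBr * e n j * (r n i).toBr = (r n j).toBr * e n i * (r n j).toBr := by
  simpa [r_toBr hin, r_toBr hjn, e_eq hin, e_eq hjn, gen] using
    rel_eq (Rel.rer (⟨i, hin⟩ : Fin n) ⟨j, hjn⟩ h hi hj)

end

section Ends

variable (hn : 1 < n)
include hn

theorem rrrr : r n 1 * r n 0 * r n 1 * r n 0 = r n 0 * r n 1 * r n 0 * r n 1 := by
  apply W.toBr_injective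
  simpa [W.toBr_mul, r_toBr hn, r_toBr (show 0 < n by omega), gen] using
    rel_eq (Rel.lolo (⟨1, hn⟩ : Fin n) ⟨0, by omega⟩ rfl rfl)

theorem rr_e : (r n 1).toBr * (r n 0).toBr * e n 1 = (r n 0).toBr * e n 1 := by
  simpa [r_toBr hn, r_toBr (show 0 < n by omega), e_eq hn, gen] using
    rel_eq (Rel.r_r_e (⟨1, hn⟩ : Fin n) ⟨0, by omega⟩ rfl rfl)

theorem r_e_r_e : (r n 1).toBr * e n 0 * (r n 1).toBr * e n 0 = e n 0 * e n 1 * e n 0 := by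
  simpa [r_toBr hn, e_eq (show 0 < n by omega), e_eq hn, gen] using
    rel_eq (Rel.r_e_r_e (⟨1, hn⟩ : Fin n) ⟨0, by omega⟩ rfl rfl)

theorem e_r_e_r : e n 0 * (r n 1).toBr * e n 0 * (r n 1).toBr = e n 0 * e n 1 * e n 0 := by
  rw [r_toBr hn, e_eq (show 0 < n by omega), e_eq hn]
  exact dual_r_e_r_e (⟨1, hn⟩ : Fin n) ⟨0, by omega⟩ rfl rfl

theorem rrr_e : (r n 1).toBr * (r n 0).toBr * (r n 1).toBr * e n 0 =
    e n 0 * ((r n 1).toBr * (r n 0).toBr * (r n 1).toBr) := by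
  simpa [r_toBr hn, r_toBr (show 0 < n by omega), e_eq (show 0 < n by omega), gen] using
    rel_eq (Rel.rrr_e (⟨1, hn⟩ : Fin n) ⟨0, by omega⟩ rfl rfl)

theorem e_r_e : e n 1 * (r n 0).toBr * e n 1 = dl • e n 1 := by
  simpa [r_toBr (show 0 < n by omega), e_eq hn, gen] using
    rel_eq (Rel.e_r_e (⟨1, hn⟩ : Fin n) ⟨0, by omega⟩ rfl rfl)

theorem e_e_e : e n 1 * e n 0 * e n 1 = dl • e n 1 := by
  simpa [e_eq (show 0 < n by omega), e_eq hn, gen] using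
    rel_eq (Rel.e_e_e (⟨1, hn⟩ : Fin n) ⟨0, by omega⟩ rfl rfl)

theorem e_r_r : e n 1 * (r n 0).toBr * (r n 1).toBr = e n 1 * (r n 0).toBr := by
  simpa [r_toBr hn, r_toBr (show 0 < n by omega), e_eq hn, gen] using
    rel_eq (Rel.e_r_r (⟨1, hn⟩ : Fin n) ⟨0, by omega⟩ rfl rfl)

theorem e_e_r : e n 1 * e n 0 * (r n 1).toBr = e n 1 * e n 0 := by
  simpa [r_toBr hn, e_eq (show 0 < n by omega), e_eq hn, gen] using
    rel_eq (Rel.e_e_r (⟨1, hn⟩ : Fin n) ⟨0, by omega⟩ rfl rfl)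

end Ends

/-! ### Signed permutations -/

/-- The group of signed permutations that move only points `x` with `lo < |x| ≤ hi`. A signed
permutation is a permutation of `ℤ` that commutes with `x ↦ -x`; the hyperoctahedral group of
rank `n` is `signedPerm 0 n`. -/
def signedPerm (lo hi : ℕ) : Subgroup (Perm ℤ) where
  carrier := {π | (∀ x, π (-x) = -π x) ∧ ∀ x, (x.natAbs ≤ lo ∨ hi < x.natAbs) → π x = x}
  mul_mem' := by
    rintro a b ⟨ha, ha'⟩ ⟨hb, hb'⟩
    refine ⟨fun x => by simp [ha, hb], fun x hx => by simp [hb' x hx, ha' x hx]⟩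
  one_mem' := by simp
  inv_mem' := by
    rintro a ⟨ha, ha'⟩
    refine ⟨fun x => ?_, fun x hx => ?_⟩
    · rw [Perm.inv_eq_iff_eq, ha]; simp
    · rw [Perm.inv_eq_iff_eq, ha' x hx]

/-- The exchange of the points `x` and `-x`. -/
def flip (x : ℤ) : Perm ℤ := swap x (-x)

/-- The reflection that exchanges `x` with `y` and `-x` with `-y`. -/
def refl (x y : ℤ) : Perm ℤ := swap x y * swap (-x) (-y)

/-- The simple reflections of the hyperoctahedral group. -/
def simpleRefl (j : ℕ) : Perm ℤ := if j = 0 then flip 1 else refl j (j + 1)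

theorem flip_apply (x z : ℤ) : flip x z = if z = x ∨ z = -x then -z else z := by
  simp only [flip, swap_apply_def]
  split_ifs <;> omega

theorem refl_apply {x y : ℤ} (hx : x ≠ 0) (hy : y ≠ 0) (h : x.natAbs ≠ y.natAbs) (z : ℤ) :
    refl x y z = if z = x then y else if z = y then x else if z = -x then -y
      else if z = -y then -x else z := by
  simp only [refl, Perm.mul_apply, swap_apply_def]
  split_ifs <;> omega

theorem flip_mem {lo hi : ℕ} {x : ℤ} (hx : lo < x.natAbs) (hx' : x.natAbs ≤ hi) :
    flip x ∈ signedPerm lo hi := by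
  refine ⟨fun z => ?_, fun z hz => ?_⟩
  · simp only [flip_apply]; split_ifs <;> omega
  · simp only [flip_apply]; split_ifs <;> omega

theorem refl_mem {lo hi : ℕ} {x y : ℤ} (hx : lo < x.natAbs) (hx' : x.natAbs ≤ hi)
    (hy : lo < y.natAbs) (hy' : y.natAbs ≤ hi) (h : x.natAbs ≠ y.natAbs) :
    refl x y ∈ signedPerm lo hi := by
  refine ⟨fun z => ?_, fun z hz => ?_⟩
  · simp only [refl_apply (show x ≠ 0 by omega) (show y ≠ 0 by omega) h]
    split_ifs <;> omega
  · simp only [refl_apply (show x ≠ 0 by omega) (show y ≠ 0 by omega) h]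
    split_ifs <;> omega

theorem signedPerm_mono {lo hi lo' hi' : ℕ} (h : lo' ≤ lo) (h' : hi ≤ hi') :
    signedPerm lo hi ≤ signedPerm lo' hi' := fun _ hπ =>
  ⟨hπ.1, fun x hx => hπ.2 x (by omega)⟩

theorem simpleRefl_mem {j m : ℕ} (h : j < m) : simpleRefl j ∈ signedPerm 0 m := by
  unfold simpleRefl
  split_ifs
  · exact flip_mem (by simp) (by simp; omega)
  · exact refl_mem (by omega) (by omega) (by omega) (by omega) (by omega)

theorem signedPerm_natAbs {lo hi : ℕ} {π : Perm ℤ} (hπ : π ∈ signedPerm lo hi) {x : ℤ}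
    (h1 : lo < x.natAbs) (h2 : x.natAbs ≤ hi) : lo < (π x).natAbs ∧ (π x).natAbs ≤ hi := by
  by_contra h
  have h3 := hπ.2 (π x) (by omega)
  have h4 := π.injective h3
  rw [h4] at h
  omega

theorem signedPerm_natAbs_eq {lo hi : ℕ} {π : Perm ℤ} (hπ : π ∈ signedPerm lo hi) {x y : ℤ} :
    (π x).natAbs = (π y).natAbs ↔ x.natAbs = y.natAbs := by
  constructor <;> intro h
  · rcases Int.natAbs_eq_natAbs_iff.1 h with h | h
    · rw [π.injective h]
    · rw [← hπ.1] at h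
      rw [π.injective h, Int.natAbs_neg]
  · rcases Int.natAbs_eq_natAbs_iff.1 h with h | h
    · rw [h]
    · rw [h, hπ.1, Int.natAbs_neg]

theorem signedPerm_zero {lo hi : ℕ} {π : Perm ℤ} (hπ : π ∈ signedPerm lo hi) : π 0 = 0 := by
  have := hπ.1 0
  simp only [neg_zero] at this
  omega

section Induction

variable {lo : ℕ} {p : Perm ℤ → Prop}

/-- Products of simple reflections move `hi` to any other point of the same range. -/
theorem exists_apply_eq {hi : ℕ} (one : p 1) (mul : ∀ π σ, p π → p σ → p (π * σ))
    (hf : lo < hi → p (flip (lo + 1)))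
    (hs : ∀ j : ℕ, lo < j → j < hi → p (refl j (j + 1))) (x : ℤ) (h1 : lo < x.natAbs)
    (h2 : x.natAbs ≤ hi) : ∃ g ∈ signedPerm lo hi, p g ∧ g hi = x := by
  have pos : ∀ d k : ℕ, k + d = hi → lo < k → ∃ g ∈ signedPerm lo hi, p g ∧ g hi = k := by
    intro d
    induction d with
    | zero => intro k hk _; exact ⟨1, one_mem _, one, by simp; omega⟩
    | succ d ih =>
      intro k hk hlo
      obtain ⟨g, hg, hpg, hgx⟩ := ih (k + 1) (by omega) (by omega)
      refine ⟨refl k (k + 1) * g, mul_mem (refl_mem ?_ ?_ ?_ ?_ ?_) hg,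
        mul _ _ (hs k hlo (by omega)) hpg, ?_⟩
      iterate 5 omega
      rw [Perm.mul_apply, hgx, refl_apply (by omega) (by omega) (by omega)]
      split_ifs <;> omega
  have neg : ∀ d : ℕ, lo + 1 + d ≤ hi → ∃ g ∈ signedPerm lo hi, p g ∧ g hi = -(lo + 1 + d : ℕ) := by
    intro d
    induction d with
    | zero =>
      intro hd
      obtain ⟨g, hg, hpg, hgx⟩ := pos (hi - (lo + 1)) (lo + 1) (by omega) (by omega)
      refine ⟨flip (lo + 1) * g, mul_mem (flip_mem (by omega) (by omega)) hg,
        mul _ _ (hf (by omega)) hpg, ?_⟩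
      rw [Perm.mul_apply, hgx, flip_apply]
      split_ifs <;> omega
    | succ d ih =>
      intro hd
      obtain ⟨g, hg, hpg, hgx⟩ := ih (by omega)
      refine ⟨refl (lo + 1 + d : ℕ) ((lo + 1 + d : ℕ) + 1) * g,
        mul_mem (refl_mem ?_ ?_ ?_ ?_ ?_) hg,
        mul _ _ (hs (lo + 1 + d) (by omega) (by omega)) hpg, ?_⟩
      iterate 5 omega
      rw [Perm.mul_apply, hgx, refl_apply (by omega) (by omega) (by omega)]
      split_ifs <;> omega
  rcases Int.natAbs_eq x with hx | hx
  · obtain ⟨g, hg⟩ := pos (hi - x.natAbs) x.natAbs (by omega) h1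
    exact ⟨g, by rwa [← hx] at hg⟩
  · obtain ⟨g, hg⟩ := neg (x.natAbs - (lo + 1)) (by omega)
    refine ⟨g, ?_⟩
    rw [show lo + 1 + (x.natAbs - (lo + 1)) = x.natAbs by omega] at hg
    rwa [← hx] at hg

/-- The signed permutations of the points `x` with `lo < |x| ≤ hi` are the products of the sign
change of `lo + 1` and the transpositions of neighbours. -/
theorem signedPerm_induction {hi : ℕ} (one : p 1) (mul : ∀ π σ, p π → p σ → p (π * σ))
    (hf : lo < hi → p (flip (lo + 1)))
    (hs : ∀ j : ℕ, lo < j → j < hi → p (refl j (j + 1))) :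
    ∀ π ∈ signedPerm lo hi, p π := by
  induction hi with
  | zero =>
    intro π hπ
    have : π = 1 := by ext x; exact hπ.2 x (by omega)
    rwa [this]
  | succ hi ih =>
    intro π hπ
    by_cases hlo : lo < hi + 1
    · obtain ⟨h1, h2⟩ := signedPerm_natAbs hπ (x := (hi + 1 : ℕ)) (by omega) (by omega)
      obtain ⟨g, hg, hpg, hgx⟩ := exists_apply_eq one mul hf hs _ h1 h2
      have h3 : g⁻¹ * π ∈ signedPerm lo (hi + 1) := mul_mem (inv_mem hg) hπ
      have h5 : (g⁻¹ * π) (hi + 1 : ℕ) = (hi + 1 : ℕ) := by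
        rw [Perm.mul_apply, Perm.inv_eq_iff_eq, hgx]
      have h4 : g⁻¹ * π ∈ signedPerm lo hi := by
        refine ⟨h3.1, fun x hx => ?_⟩
        by_cases hx' : x.natAbs = hi + 1
        · rcases Int.natAbs_eq x with h | h
          · rw [h, hx', h5]
          · rw [h, hx', h3.1, h5]
        · exact h3.2 x (by omega)
      have := mul _ _ hpg (ih (fun h => hf (by omega)) (fun j h h' => hs j h (by omega)) _ h4)
      rwa [mul_inv_cancel_left] at this
    · have : π = 1 := by ext x; exact hπ.2 x (by omega)
      rwa [this]

end Induction

theorem exists_signedPerm_apply {lo hi : ℕ} (x y : ℤ) (h1 : lo < x.natAbs)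
    (h2 : x.natAbs ≤ hi) (h3 : lo < y.natAbs) (h4 : y.natAbs ≤ hi) :
    ∃ g ∈ signedPerm lo hi, g x = y := by
  obtain ⟨g, hg, -, hgx⟩ := exists_apply_eq (lo := lo) (p := fun _ => True) (hi := hi) trivial
    (fun _ _ _ _ => trivial) (fun _ => trivial) (fun _ _ _ => trivial) x h1 h2
  obtain ⟨g', hg', -, hgx'⟩ := exists_apply_eq (lo := lo) (p := fun _ => True) (hi := hi) trivial
    (fun _ _ _ _ => trivial) (fun _ => trivial) (fun _ _ _ => trivial) y h3 h4
  refine ⟨g' * g⁻¹, mul_mem hg' (inv_mem hg), ?_⟩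
  simp [Perm.mul_apply, ← hgx, hgx']

/-! ### The Coxeter presentation of the hyperoctahedral group -/

section Coxeter

variable {G : Type*} [Group G] (ρ : ℕ → G) {N : ℕ}

/-- The word `ρ_a ρ_{a+1} ⋯ ρ_{a+k-1}`. -/
def asc : ℕ → ℕ → G
  | _, 0 => 1
  | a, k + 1 => ρ a * asc (a + 1) k

/-- The word `ρ_{d-1} ⋯ ρ_1 ρ_0`. -/
def desc : ℕ → G
  | 0 => 1
  | d + 1 => ρ d * desc d

variable (N) in
/-- The Coxeter relations of type `B_N` for a sequence of group elements, all of which, also those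
beyond the first `N`, are involutions. -/
structure IsCoxeterB : Prop where
  sq : ∀ i, ρ i * ρ i = 1
  comm : ∀ i j, i + 1 < j → j < N → ρ i * ρ j = ρ j * ρ i
  braid : ∀ i, 0 < i → i + 1 < N → ρ i * ρ (i + 1) * ρ i = ρ (i + 1) * ρ i * ρ (i + 1)
  four : 1 < N → ρ 1 * ρ 0 * ρ 1 * ρ 0 = ρ 0 * ρ 1 * ρ 0 * ρ 1

variable {ρ} (H : IsCoxeterB ρ N)
include H

theorem asc_comm {j : ℕ} (k : ℕ) : ∀ a, j + 1 < a → a + k ≤ N →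
    ρ j * asc ρ a k = asc ρ a k * ρ j := by
  induction k with
  | zero => intro a _ _; simp [asc]
  | succ k ih =>
    intro a h1 h2
    rw [asc, ← mul_assoc, H.comm j a h1 (by omega), mul_assoc, ih _ (by omega) (by omega),
      mul_assoc]

theorem asc_shift {j : ℕ} (k : ℕ) : ∀ a, 0 < a → a < j → j < a + k → a + k ≤ N →
    ρ j * asc ρ a k = asc ρ a k * ρ (j - 1) := by
  induction k with
  | zero => intro a _ _ _ _; omega
  | succ k ih =>
    intro a h0 h1 h2 h3
    obtain rfl | h := eq_or_ne j (a + 1)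
    · obtain ⟨k, rfl⟩ : ∃ l, k = l + 1 := ⟨k - 1, by omega⟩
      have h4 := H.braid a h0 (by omega)
      have h5 := asc_comm H (j := a) k (a + 1 + 1) (by omega) (by omega)
      simp only [asc, Nat.add_sub_cancel]
      calc ρ (a + 1) * (ρ a * (ρ (a + 1) * asc ρ (a + 1 + 1) k))
          = (ρ (a + 1) * ρ a * ρ (a + 1)) * asc ρ (a + 1 + 1) k := by simp only [mul_assoc]
        _ = ρ a * ρ (a + 1) * (ρ a * asc ρ (a + 1 + 1) k) := by rw [← h4, mul_assoc]
        _ = _ := by rw [h5]; simp only [mul_assoc]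
    · rw [asc, ← mul_assoc, ← H.comm a j (by omega) (by omega), mul_assoc,
        ih _ (by omega) (by omega) (by omega) (by omega), mul_assoc]

theorem desc_comm {j : ℕ} (hj : j < N) (d : ℕ) (h : d < j) :
    ρ j * desc ρ d = desc ρ d * ρ j := by
  induction d with
  | zero => simp [desc]
  | succ d ih =>
    rw [desc, ← mul_assoc, ← H.comm d j (by omega) hj, mul_assoc, ih (by omega), mul_assoc]

theorem desc_shift {j : ℕ} (hj : 0 < j) (d : ℕ) (h : j + 1 < d) (hd : d ≤ N) :
    ρ j * desc ρ d = desc ρ d * ρ (j + 1) := by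
  induction d with
  | zero => omega
  | succ d ih =>
    obtain rfl | h' := eq_or_ne d (j + 1)
    · have h4 := H.braid j hj (by omega)
      have h5 := desc_comm H (j := j + 1) (by omega) j (by omega)
      simp only [desc]
      calc ρ j * (ρ (j + 1) * (ρ j * desc ρ j))
          = (ρ j * ρ (j + 1) * ρ j) * desc ρ j := by simp only [mul_assoc]
        _ = ρ (j + 1) * ρ j * (ρ (j + 1) * desc ρ j) := by rw [h4, mul_assoc]
        _ = _ := by rw [h5]; simp only [mul_assoc]
    · rw [desc, ← mul_assoc, H.comm j d (by omega) (by omega), mul_assoc,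
        ih (by omega) (by omega), mul_assoc]

/-- The only place where the relation between `ρ_0` and `ρ_1` enters. -/
theorem desc_asc_zero {m : ℕ} (hm : m + 1 ≤ N) (d : ℕ) (h : 1 < d) (hd : d ≤ m + 1) :
    ρ 0 * (desc ρ d * asc ρ 1 m) = desc ρ d * asc ρ 1 m * ρ 0 := by
  induction d with
  | zero => omega
  | succ d ih =>
    obtain rfl | h' := eq_or_ne d 1
    · obtain ⟨k, rfl⟩ : ∃ l, m = l + 1 := ⟨m - 1, by omega⟩
      have h4 := H.four (by omega)
      have h5 := asc_comm H (j := 0) k 2 (by omega) (by omega)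
      simp only [desc, asc, mul_one]
      calc ρ 0 * (ρ 1 * ρ 0 * (ρ 1 * asc ρ (1 + 1) k))
          = (ρ 0 * ρ 1 * ρ 0 * ρ 1) * asc ρ 2 k := by simp only [mul_assoc]
        _ = ρ 1 * ρ 0 * ρ 1 * (ρ 0 * asc ρ 2 k) := by rw [← h4]; simp only [mul_assoc]
        _ = _ := by rw [h5]; simp only [mul_assoc]
    · rw [desc, mul_assoc, ← mul_assoc, H.comm 0 d (by omega) (by omega), mul_assoc,
        ih (by omega) (by omega)]
      simp only [mul_assoc]

/-- The words `ρ_a ⋯ ρ_m` and `ρ_{a-1} ⋯ ρ_1 ρ_0 ρ_1 ⋯ ρ_m` represent the cosets of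
`⟨ρ_0, …, ρ_{m-1}⟩` in `⟨ρ_0, …, ρ_m⟩`. -/
theorem mem_closure_succ {m : ℕ} (hm : m + 1 ≤ N) {g : G}
    (hg : g ∈ Subgroup.closure (ρ '' {j | j < m + 1})) :
    ∃ a, 1 ≤ a ∧ a ≤ m + 1 ∧ ∃ h ∈ Subgroup.closure (ρ '' {j | j < m}),
      g = asc ρ a (m + 1 - a) * h ∨ g = desc ρ a * asc ρ 1 m * h := by
  have hmem : ∀ {j}, j < m → ρ j ∈ Subgroup.closure (ρ '' {j | j < m}) := fun {j} hj =>
    Subgroup.subset_closure ⟨j, hj, rfl⟩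
  have inv : ∀ i, (ρ i)⁻¹ = ρ i := fun i => inv_eq_of_mul_eq_one_right (H.sq i)
  have key : ∀ j < m + 1, ∀ g : G, (∃ a, 1 ≤ a ∧ a ≤ m + 1 ∧
      ∃ h ∈ Subgroup.closure (ρ '' {j | j < m}),
      g = asc ρ a (m + 1 - a) * h ∨ g = desc ρ a * asc ρ 1 m * h) →
      (∃ a, 1 ≤ a ∧ a ≤ m + 1 ∧ ∃ h ∈ Subgroup.closure (ρ '' {j | j < m}),
      ρ j * g = asc ρ a (m + 1 - a) * h ∨ ρ j * g = desc ρ a * asc ρ 1 m * h) := by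
    rintro j hj g ⟨a, h1, h2, h, hh, rfl | rfl⟩
    · rcases lt_trichotomy j a with hja | rfl | hja
      · obtain rfl | hja' := eq_or_ne a (j + 1)
        · obtain rfl | hj0 := eq_or_ne j 0
          · refine ⟨1, le_rfl, by omega, h, hh, Or.inr ?_⟩
            simp [desc, mul_assoc]
          · refine ⟨j, by omega, by omega, h, hh, Or.inl ?_⟩
            rw [show m + 1 - j = (m + 1 - (j + 1)) + 1 by omega, asc, mul_assoc]
        · refine ⟨a, h1, h2, ρ j * h, mul_mem (hmem (by omega)) hh, Or.inl ?_⟩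
          rw [← mul_assoc, asc_comm H _ _ (by omega) (by omega), mul_assoc]
      · refine ⟨j + 1, by omega, by omega, h, hh, Or.inl ?_⟩
        rw [show m + 1 - j = (m + 1 - (j + 1)) + 1 by omega, asc, ← mul_assoc, ← mul_assoc, H.sq,
          one_mul]
      · refine ⟨a, h1, h2, ρ (j - 1) * h, mul_mem (hmem (by omega)) hh, Or.inl ?_⟩
        rw [← mul_assoc, asc_shift H _ _ (by omega) (by omega) (by omega) (by omega), mul_assoc]
    · rcases lt_trichotomy j a with hja | rfl | hja
      · obtain rfl | hja' := eq_or_ne a (j + 1)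
        · obtain rfl | hj0 := eq_or_ne j 0
          · refine ⟨1, le_rfl, by omega, h, hh, Or.inl ?_⟩
            simp only [desc, mul_one, Nat.add_sub_cancel]
            rw [← mul_assoc, ← mul_assoc, H.sq, one_mul]
          · refine ⟨j, by omega, by omega, h, hh, Or.inr ?_⟩
            rw [desc, ← mul_assoc, ← mul_assoc, ← mul_assoc, H.sq, one_mul]
        · obtain rfl | hj0 := eq_or_ne j 0
          · refine ⟨a, h1, h2, ρ 0 * h, mul_mem (hmem (by omega)) hh, Or.inr ?_⟩
            rw [← mul_assoc, desc_asc_zero H hm a (by omega) h2, mul_assoc]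
          · refine ⟨a, h1, h2, ρ j * h, mul_mem (hmem (by omega)) hh, Or.inr ?_⟩
            rw [← mul_assoc, ← mul_assoc, desc_shift H (by omega) a (by omega) (by omega),
              mul_assoc (desc ρ a), asc_shift H m 1 (by omega) (by omega) (by omega) (by omega)]
            simp only [mul_assoc, Nat.add_sub_cancel]
      · refine ⟨j + 1, by omega, by omega, h, hh, Or.inr ?_⟩
        rw [desc]
        simp only [mul_assoc]
      · refine ⟨a, h1, h2, ρ (j - 1) * h, mul_mem (hmem (by omega)) hh, Or.inr ?_⟩
        rw [← mul_assoc, ← mul_assoc, desc_comm H (by omega) a (by omega),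
          mul_assoc (desc ρ a), asc_shift H m 1 (by omega) (by omega) (by omega) (by omega)]
        simp only [mul_assoc]
  induction hg using Subgroup.closure_induction_left with
  | one => exact ⟨m + 1, by omega, le_rfl, 1, one_mem _, Or.inl (by simp [asc])⟩
  | mul_left x hx y hy ih =>
    obtain ⟨j, hj, rfl⟩ := hx
    exact key j hj y ih
  | inv_mul_cancel x hx y hy ih =>
    obtain ⟨j, hj, rfl⟩ := hx
    rw [inv]
    exact key j hj y ih

end Coxeter

theorem flip_mul_self (x : ℤ) : flip x * flip x = 1 := by
  ext z; simp only [Perm.mul_apply, flip_apply, Perm.one_apply]; split_ifs <;> omega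

theorem simpleRefl_succ_apply (j : ℕ) (z : ℤ) : simpleRefl (j + 1) z =
    if z = j + 1 then (j + 2 : ℤ) else if z = j + 2 then (j + 1 : ℤ) else
      if z = -(j + 1) then -(j + 2 : ℤ) else if z = -(j + 2) then -(j + 1 : ℤ) else z := by
  rw [simpleRefl, if_neg (by omega), refl_apply (by omega) (by omega) (by omega)]
  push_cast
  split_ifs <;> omega

theorem simpleRefl_zero_apply (z : ℤ) : simpleRefl 0 z = if z = 1 ∨ z = -1 then -z else z := by
  rw [simpleRefl, if_pos rfl, flip_apply]

theorem mul_flip {lo hi : ℕ} {π : Perm ℤ} (hπ : π ∈ signedPerm lo hi) (x : ℤ) :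
    π * flip x = flip (π x) * π := by
  rw [flip, flip, mul_swap_eq_swap_mul, hπ.1]

theorem mul_refl {lo hi : ℕ} {π : Perm ℤ} (hπ : π ∈ signedPerm lo hi) (x y : ℤ) :
    π * refl x y = refl (π x) (π y) * π := by
  rw [refl, refl, ← hπ.1, ← hπ.1, swap_apply_apply, swap_apply_apply]
  simp only [mul_assoc, inv_mul_cancel, inv_mul_cancel_left, mul_one]

theorem simpleRefl_succ (j : ℕ) : simpleRefl (j + 1) = refl (j + 1) (j + 2) := by
  rw [simpleRefl, if_neg (by omega)]
  push_cast
  rw [add_assoc, one_add_one_eq_two]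

theorem simpleRefl_isCoxeterB (N : ℕ) : IsCoxeterB simpleRefl N where
  sq i := by
    ext z
    rcases i with _ | i
    · simp only [Perm.mul_apply, simpleRefl_zero_apply, Perm.one_apply]; split_ifs <;> omega
    · simp only [Perm.mul_apply, simpleRefl_succ_apply, Perm.one_apply]; split_ifs <;> omega
  comm i j h _ := by
    obtain ⟨j, rfl⟩ : ∃ k, j = k + 1 := ⟨j - 1, by omega⟩
    have h1 : simpleRefl i (j + 1) = j + 1 ∧ simpleRefl i (j + 2) = j + 2 := by
      rcases i with _ | i
      · simp only [simpleRefl_zero_apply]; constructor <;> split_ifs <;> omega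
      · simp only [simpleRefl_succ_apply]; constructor <;> split_ifs <;> omega
    rw [simpleRefl_succ j, mul_refl (simpleRefl_mem (Nat.lt_succ_self i)), h1.1, h1.2]
  braid i h _ := by
    obtain ⟨i, rfl⟩ : ∃ k, i = k + 1 := ⟨i - 1, by omega⟩
    have h1 : simpleRefl (i + 1) (i + 1) = i + 2 := by
      rw [simpleRefl_succ_apply]; split_ifs <;> omega
    have h2 : simpleRefl (i + 1) (i + 3) = i + 3 := by
      rw [simpleRefl_succ_apply]; split_ifs <;> omega
    have h3 : simpleRefl (i + 1 + 1) (i + 1) = i + 1 := by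
      rw [simpleRefl_succ_apply]; split_ifs <;> omega
    have h4 : simpleRefl (i + 1 + 1) (i + 2) = i + 3 := by
      rw [simpleRefl_succ_apply]; split_ifs <;> omega
    conv_lhs => rw [mul_assoc]; enter [2, 2]; rw [simpleRefl_succ i]
    rw [mul_refl (simpleRefl_mem (Nat.lt_succ_self (i + 1 + 1))), h3, h4, ← mul_assoc,
      mul_refl (simpleRefl_mem (Nat.lt_succ_self (i + 1))), h1, h2, simpleRefl_succ (i + 1)]
    push_cast
    simp only [add_assoc]
    norm_num
  four _ := by
    ext z
    by_cases h1 : z = 1 ∨ z = 2 ∨ z = -1 ∨ z = -2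
    · rcases h1 with rfl | rfl | rfl | rfl <;>
        simp [Perm.mul_apply, simpleRefl_succ_apply 0, simpleRefl_zero_apply]
    · have fix : ∀ j, j = 0 ∨ j = 1 → simpleRefl j z = z := by
        rintro j (rfl | rfl)
        · rw [simpleRefl_zero_apply]; split_ifs <;> omega
        · rw [simpleRefl_succ_apply 0]; split_ifs <;> omega
      simp [fix]

theorem asc_simpleRefl_apply (k : ℕ) : ∀ a, 0 < a → asc simpleRefl a k (a + k : ℕ) = a := by
  induction k with
  | zero => intro a _; simp [asc]
  | succ k ih =>
    intro a ha
    obtain ⟨a, rfl⟩ : ∃ k, a = k + 1 := ⟨a - 1, by omega⟩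
    rw [asc, Perm.mul_apply, show a + 1 + (k + 1) = a + 1 + 1 + k by omega, ih _ (by omega),
      simpleRefl_succ_apply]
    split_ifs <;> omega

theorem desc_simpleRefl_apply (d : ℕ) : desc simpleRefl (d + 1) 1 = -((d + 1 : ℕ) : ℤ) := by
  induction d with
  | zero => simp [desc, simpleRefl_zero_apply]
  | succ d ih =>
    rw [desc, Perm.mul_apply, ih, simpleRefl_succ_apply]
    split_ifs <;> omega


theorem r_isCoxeterB : IsCoxeterB (r n) n where
  sq := r_mul_self
  comm i j h hj := rr_comm (by omega) hj (by omega)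
  braid i h h' := rrr h h'
  four h := rrrr h

variable (n) in
/-- The involution `r_j` together with the signed permutation that it stands for. -/
noncomputable def rPair (j : ℕ) : W n × Perm ℤ := (r n j, simpleRefl j)

theorem rPair_isCoxeterB : IsCoxeterB (rPair n) n where
  sq i := Prod.ext (r_isCoxeterB.sq i) ((simpleRefl_isCoxeterB n).sq i)
  comm i j h hj := Prod.ext (r_isCoxeterB.comm i j h hj) ((simpleRefl_isCoxeterB n).comm i j h hj)
  braid i h hj := Prod.ext (r_isCoxeterB.braid i h hj) ((simpleRefl_isCoxeterB n).braid i h hj)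
  four h := Prod.ext (r_isCoxeterB.four h) ((simpleRefl_isCoxeterB n).four h)

variable (n) in
/-- The graph of the correspondence between signed permutations of rank `m` and words in
`r_0, …, r_{m-1}`. -/
noncomputable def graph (m : ℕ) : Subgroup (W n × Perm ℤ) :=
  Subgroup.closure (rPair n '' {j | j < m})

theorem snd_asc (k : ℕ) : ∀ a, (asc (rPair n) a k).2 = asc simpleRefl a k := by
  induction k with
  | zero => intro a; rfl
  | succ k ih => intro a; simp [asc, ih, rPair]

theorem snd_desc (d : ℕ) : (desc (rPair n) d).2 = desc simpleRefl d := by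
  induction d with
  | zero => rfl
  | succ k ih => simp [desc, ih, rPair]

theorem graph_snd_mem {m : ℕ} {g : W n × Perm ℤ} (hg : g ∈ graph n m) :
    g.2 ∈ signedPerm 0 m := by
  have : graph n m ≤ (signedPerm 0 m).comap (MonoidHom.snd (W n) (Perm ℤ)) := by
    rw [graph, Subgroup.closure_le]
    rintro _ ⟨j, hj, rfl⟩
    exact simpleRefl_mem hj
  exact this hg

/-- The Coxeter relations determine an element of `W` from its signed permutation: the coset
representatives of `mem_closure_succ` move `m + 1` to different points. -/
theorem graph_injective {m : ℕ} (hm : m ≤ n) {g : W n × Perm ℤ} (hg : g ∈ graph n m)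
    (h : g.2 = 1) : g = 1 := by
  induction m with
  | zero =>
    simpa [graph] using hg
  | succ m ih =>
    obtain ⟨a, h1, h2, g', hg', h3 | h3⟩ := mem_closure_succ rPair_isCoxeterB hm hg
    · have h4 := congrArg (fun g => g.2 (m + 1 : ℕ)) h3
      have h5 := (graph_snd_mem hg').2 (m + 1 : ℕ) (by omega)
      simp only [h, Prod.snd_mul, Perm.mul_apply, h5, snd_asc] at h4
      have h6 := asc_simpleRefl_apply (m + 1 - a) a (by omega)
      rw [show a + (m + 1 - a) = m + 1 by omega] at h6
      rw [h6, Perm.one_apply] at h4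
      obtain rfl : m + 1 = a := by exact_mod_cast h4
      have h7 : g = g' := by rw [h3]; simp [asc]
      subst h7
      exact ih (by omega) hg'
    · have h4 := congrArg (fun g => g.2 (m + 1 : ℕ)) h3
      have h5 := (graph_snd_mem hg').2 (m + 1 : ℕ) (by omega)
      simp only [h, Prod.snd_mul, Perm.mul_apply, h5, snd_asc, snd_desc] at h4
      have h6 := asc_simpleRefl_apply m 1 (by omega)
      obtain ⟨a, rfl⟩ : ∃ k, a = k + 1 := ⟨a - 1, by omega⟩
      have h8 := desc_simpleRefl_apply a
      rw [show 1 + m = m + 1 by omega] at h6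
      rw [h6, Nat.cast_one, h8, Perm.one_apply] at h4
      omega

theorem exists_graph {π : Perm ℤ} (hπ : π ∈ signedPerm 0 n) : ∃ u, (u, π) ∈ graph n n := by
  refine signedPerm_induction (p := fun π => ∃ u, (u, π) ∈ graph n n) ⟨1, one_mem _⟩ ?_ ?_ ?_ π hπ
  · rintro π σ ⟨u, hu⟩ ⟨v, hv⟩
    exact ⟨u * v, mul_mem hu hv⟩
  · intro h
    refine ⟨r n 0, Subgroup.subset_closure ⟨0, h, ?_⟩⟩
    simp [rPair, simpleRefl]
  · intro j h h'
    refine ⟨r n j, Subgroup.subset_closure ⟨j, h', ?_⟩⟩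
    simp only [rPair, simpleRefl]
    rw [if_neg (by omega)]

theorem graph_unique {u v : W n} {π : Perm ℤ} (hu : (u, π) ∈ graph n n)
    (hv : (v, π) ∈ graph n n) : u = v := by
  have h := graph_injective le_rfl (mul_mem (inv_mem hu) hv) (by simp)
  have := congrArg Prod.fst h
  simpa [inv_mul_eq_one] using this

open Classical in
/-- The element of `W` that a signed permutation stands for (and `1` for any other permutation). -/
noncomputable def toW (n : ℕ) (π : Perm ℤ) : W n :=
  if h : π ∈ signedPerm 0 n then (exists_graph h).choose else 1

theorem toW_graph {π : Perm ℤ} (h : π ∈ signedPerm 0 n) : (toW n π, π) ∈ graph n n := by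
  rw [toW, dif_pos h]
  exact (exists_graph h).choose_spec

theorem toW_eq {π : Perm ℤ} {u : W n} (h : (u, π) ∈ graph n n) : toW n π = u :=
  graph_unique (toW_graph (graph_snd_mem h)) h

theorem toW_mul {π σ : Perm ℤ} (hπ : π ∈ signedPerm 0 n) (hσ : σ ∈ signedPerm 0 n) :
    toW n (π * σ) = toW n π * toW n σ :=
  toW_eq (mul_mem (toW_graph hπ) (toW_graph hσ))

theorem toW_one : toW n 1 = 1 := toW_eq (one_mem _)

theorem toW_inv {π : Perm ℤ} (hπ : π ∈ signedPerm 0 n) : toW n π⁻¹ = (toW n π)⁻¹ :=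
  toW_eq (inv_mem (toW_graph hπ))

theorem toW_simpleRefl {j : ℕ} (h : j < n) : toW n (simpleRefl j) = r n j :=
  toW_eq (Subgroup.subset_closure ⟨j, h, rfl⟩)

/-! ### Cups at signed points -/

variable (n) in
/-- The element of `Br(C_n)` that a signed permutation stands for. -/
noncomputable def ofPerm (π : Perm ℤ) : Br n := (toW n π).toBr

theorem ofPerm_mul {π σ : Perm ℤ} (hπ : π ∈ signedPerm 0 n) (hσ : σ ∈ signedPerm 0 n) :
    ofPerm n (π * σ) = ofPerm n π * ofPerm n σ := by
  rw [ofPerm, toW_mul hπ hσ, W.toBr_mul]; rfl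

theorem ofPerm_one : ofPerm n 1 = 1 := by rw [ofPerm, toW_one, W.toBr_one]

theorem ofPerm_inv_mul {π : Perm ℤ} (hπ : π ∈ signedPerm 0 n) :
    ofPerm n π⁻¹ * ofPerm n π = 1 := by
  rw [← ofPerm_mul (inv_mem hπ) hπ, inv_mul_cancel, ofPerm_one]

theorem ofPerm_mul_inv {π : Perm ℤ} (hπ : π ∈ signedPerm 0 n) :
    ofPerm n π * ofPerm n π⁻¹ = 1 := by
  rw [← ofPerm_mul hπ (inv_mem hπ), mul_inv_cancel, ofPerm_one]

theorem ofPerm_simpleRefl {j : ℕ} (h : j < n) : ofPerm n (simpleRefl j) = (r n j).toBr := by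
  rw [ofPerm, toW_simpleRefl h]

theorem ofPerm_refl {j : ℕ} (h0 : 0 < j) (h : j < n) :
    ofPerm n (refl j (j + 1)) = (r n j).toBr := by
  rw [← ofPerm_simpleRefl h, simpleRefl, if_neg (by omega)]

theorem toW_flip {i : ℕ} (h0 : 0 < i) (h : i ≤ n) : toW n (flip i) = y n i := by
  induction i with
  | zero => omega
  | succ i ih =>
    obtain rfl | hi := Nat.eq_zero_or_pos i
    · rw [y, ← toW_simpleRefl (by omega : 0 < n)]
      rfl
    · obtain ⟨i, rfl⟩ : ∃ k, i = k + 1 := ⟨i - 1, by omega⟩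
      have h1 := simpleRefl_mem (show i + 1 < n by omega)
      have h2 : (flip (i + 1 : ℕ)) ∈ signedPerm 0 n := flip_mem (by omega) (by omega)
      rw [y, ← ih (by omega) (by omega), ← toW_simpleRefl (by omega : i + 1 < n),
        ← toW_mul h1 h2, ← toW_mul (mul_mem h1 h2) h1, mul_flip h1, mul_assoc,
        (simpleRefl_isCoxeterB n).sq, mul_one, simpleRefl_succ_apply]
      congr 2
      push_cast
      split_ifs <;> omega

variable (n) in
/-- `x` is one of the points `±1, …, ±n`. -/
def IsPoint (x : ℤ) : Prop := 0 < x.natAbs ∧ x.natAbs ≤ n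

theorem IsPoint.apply {x : ℤ} (hx : IsPoint n x) {π : Perm ℤ} (hπ : π ∈ signedPerm 0 n) :
    IsPoint n (π x) := signedPerm_natAbs hπ hx.1 hx.2

theorem IsPoint.neg {x : ℤ} (hx : IsPoint n x) : IsPoint n (-x) := by
  unfold IsPoint at *; omega

theorem IsPoint.flip {x : ℤ} (hx : IsPoint n x) : flip x ∈ signedPerm 0 n := flip_mem hx.1 hx.2

theorem IsPoint.refl {x y : ℤ} (hx : IsPoint n x) (hy : IsPoint n y)
    (h : x.natAbs ≠ y.natAbs) : refl x y ∈ signedPerm 0 n :=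
  refl_mem hx.1 hx.2 hy.1 hy.2 h

/-- A signed permutation may be changed so as to take `k + 1` to `y`, without changing the images of
`1, …, k`. -/
theorem extend_perm {k : ℕ} {π : Perm ℤ} (hπ : π ∈ signedPerm 0 n) {y : ℤ} (hy : IsPoint n y)
    (hk : k < n) (h : ∀ x : ℤ, 0 < x.natAbs → x.natAbs ≤ k → (π x).natAbs ≠ y.natAbs) :
    ∃ σ ∈ signedPerm 0 n, (∀ x : ℤ, x.natAbs ≤ k → σ x = π x) ∧ σ (k + 1) = y := by
  have h1 := hy.apply (inv_mem hπ)
  have h2 : π (π⁻¹ y) = y := by simp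
  have h3 : k < (π⁻¹ y).natAbs := by
    by_contra h3
    exact h _ h1.1 (by omega) (by rw [h2])
  obtain ⟨g, hg, hgx⟩ := exists_signedPerm_apply (lo := k) (hi := n) (k + 1) (π⁻¹ y) (by omega)
    (by omega) h3 h1.2
  refine ⟨π * g, mul_mem hπ (signedPerm_mono (Nat.zero_le _) le_rfl hg), fun x hx => ?_, ?_⟩
  · rw [Perm.mul_apply, hg.2 x (Or.inl hx)]
  · rw [Perm.mul_apply, hgx, h2]

theorem exists_perm₁ {x : ℤ} (hx : IsPoint n x) : ∃ σ ∈ signedPerm 0 n, σ 1 = x := by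
  have h := hx
  unfold IsPoint at h
  obtain ⟨σ, hσ, -, h1⟩ := extend_perm (one_mem _) hx (k := 0) (by omega) (by omega)
  exact ⟨σ, hσ, by simpa using h1⟩

theorem exists_perm₂ {x y : ℤ} (hx : IsPoint n x) (hy : IsPoint n y)
    (hxy : x.natAbs ≠ y.natAbs) : ∃ σ ∈ signedPerm 0 n, σ 1 = x ∧ σ 2 = y := by
  have h := hx
  have h' := hy
  unfold IsPoint at h h'
  obtain ⟨σ, hσ, h1⟩ := exists_perm₁ hx
  obtain ⟨τ, hτ, h2, h3⟩ := extend_perm hσ hy (k := 1) (by omega) (by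
    intro z hz hz'
    rwa [(signedPerm_natAbs_eq hσ).2 (show z.natAbs = (1 : ℤ).natAbs by simp; omega), h1])
  exact ⟨τ, hτ, by rw [h2 _ (by simp), h1], by simpa using h3⟩

theorem exists_perm₃ {x y z : ℤ} (hx : IsPoint n x) (hy : IsPoint n y) (hz : IsPoint n z)
    (hxy : x.natAbs ≠ y.natAbs) (hxz : x.natAbs ≠ z.natAbs) (hyz : y.natAbs ≠ z.natAbs) :
    ∃ σ ∈ signedPerm 0 n, σ 1 = x ∧ σ 2 = y ∧ σ 3 = z := by
  have h := hx
  have h' := hy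
  have h'' := hz
  unfold IsPoint at h h' h''
  obtain ⟨σ, hσ, h1, h1'⟩ := exists_perm₂ hx hy hxy
  obtain ⟨τ, hτ, h2, h3⟩ := extend_perm hσ hz (k := 2) (by omega) (by
    intro w hw hw'
    obtain hw | hw : w.natAbs = (1 : ℤ).natAbs ∨ w.natAbs = (2 : ℤ).natAbs := by simp; omega
    · rwa [(signedPerm_natAbs_eq hσ).2 hw, h1]
    · rwa [(signedPerm_natAbs_eq hσ).2 hw, h1'])
  exact ⟨τ, hτ, by rw [h2 _ (by simp), h1], by rw [h2 _ (by simp), h1'], by simpa using h3⟩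

theorem exists_perm₄ {x y z w : ℤ} (hx : IsPoint n x) (hy : IsPoint n y) (hz : IsPoint n z)
    (hw : IsPoint n w) (hxy : x.natAbs ≠ y.natAbs) (hxz : x.natAbs ≠ z.natAbs)
    (hyz : y.natAbs ≠ z.natAbs) (hxw : x.natAbs ≠ w.natAbs) (hyw : y.natAbs ≠ w.natAbs)
    (hzw : z.natAbs ≠ w.natAbs) :
    ∃ σ ∈ signedPerm 0 n, σ 1 = x ∧ σ 2 = y ∧ σ 3 = z ∧ σ 4 = w := by
  have h := hx
  have h' := hy
  have h'' := hz
  have h''' := hw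
  unfold IsPoint at h h' h'' h'''
  obtain ⟨σ, hσ, h1, h1', h1''⟩ := exists_perm₃ hx hy hz hxy hxz hyz
  obtain ⟨τ, hτ, h2, h3⟩ := extend_perm hσ hw (k := 3) (by omega) (by
    intro v hv hv'
    obtain hv | hv | hv : v.natAbs = (1 : ℤ).natAbs ∨ v.natAbs = (2 : ℤ).natAbs ∨
      v.natAbs = (3 : ℤ).natAbs := by simp; omega
    · rwa [(signedPerm_natAbs_eq hσ).2 hv, h1]
    · rwa [(signedPerm_natAbs_eq hσ).2 hv, h1']
    · rwa [(signedPerm_natAbs_eq hσ).2 hv, h1''])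
  exact ⟨τ, hτ, by rw [h2 _ (by simp), h1], by rw [h2 _ (by simp), h1'],
    by rw [h2 _ (by simp), h1''], by simpa using h3⟩

variable (n) in
/-- Conjugation by the element that a signed permutation stands for. -/
noncomputable def conj (π : Perm ℤ) (x : Br n) : Br n := ofPerm n π * x * ofPerm n π⁻¹

section Conj

variable {π σ : Perm ℤ} (hπ : π ∈ signedPerm 0 n)
include hπ

theorem conj_mul (x x' : Br n) : conj n π (x * x') = conj n π x * conj n π x' := by
  have h := ofPerm_inv_mul hπ
  calc _ = ofPerm n π * x * 1 * x' * ofPerm n π⁻¹ := by simp only [conj, mul_assoc, one_mul]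
    _ = _ := by rw [← h]; simp only [conj, mul_assoc]

omit hπ in
theorem conj_smul (c : ℤ[T;T⁻¹]) (x : Br n) : conj n π (c • x) = c • conj n π x := by
  simp [conj]

theorem conj_one : conj n π 1 = 1 := by rw [conj, mul_one, ofPerm_mul_inv hπ]

theorem conj_conj (hσ : σ ∈ signedPerm 0 n) (x : Br n) :
    conj n π (conj n σ x) = conj n (π * σ) x := by
  rw [conj, conj, conj, ofPerm_mul hπ hσ, mul_inv_rev, ofPerm_mul (inv_mem hσ) (inv_mem hπ)]
  simp only [mul_assoc]

theorem ofPerm_mul_eq (x : Br n) : ofPerm n π * x = conj n π x * ofPerm n π := by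
  rw [conj, mul_assoc, ofPerm_inv_mul hπ, mul_one]

theorem conj_ofPerm (hσ : σ ∈ signedPerm 0 n) :
    conj n π (ofPerm n σ) = ofPerm n (π * σ * π⁻¹) := by
  rw [conj, ofPerm_mul (mul_mem hπ hσ) (inv_mem hπ), ofPerm_mul hπ hσ]

theorem conj_ofPerm_refl {x y : ℤ} (h : BrauerC.refl x y ∈ signedPerm 0 n) :
    conj n π (ofPerm n (BrauerC.refl x y)) = ofPerm n (BrauerC.refl (π x) (π y)) := by
  rw [conj_ofPerm hπ h, mul_refl hπ, mul_assoc, mul_inv_cancel, mul_one]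

theorem conj_ofPerm_flip {x : ℤ} (h : BrauerC.flip x ∈ signedPerm 0 n) :
    conj n π (ofPerm n (BrauerC.flip x)) = ofPerm n (BrauerC.flip (π x)) := by
  rw [conj_ofPerm hπ h, mul_flip hπ, mul_assoc, mul_inv_cancel, mul_one]

/-- Elements that commute with the pointwise stabilizer of `1, …, k` have conjugates that depend
only on the images of these points. -/
theorem conj_eq_conj {k : ℕ} {x : Br n}
    (hx : ∀ τ ∈ signedPerm k n, ofPerm n τ * x = x * ofPerm n τ)
    (hσ : σ ∈ signedPerm 0 n) (h : ∀ j : ℕ, 0 < j → j ≤ k → π j = σ j) :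
    conj n π x = conj n σ x := by
  have hτ : σ⁻¹ * π ∈ signedPerm 0 n := mul_mem (inv_mem hσ) hπ
  have hτ' : σ⁻¹ * π ∈ signedPerm k n := by
    have key : ∀ j : ℕ, j ≤ k → (σ⁻¹ * π) j = j := by
      intro j hj
      obtain rfl | h0 := Nat.eq_zero_or_pos j
      · exact signedPerm_zero hτ
      · rw [Perm.mul_apply, Perm.inv_eq_iff_eq, h j h0 hj]
    refine ⟨hτ.1, fun z hz => ?_⟩
    rcases hz with hz | hz
    · rcases Int.natAbs_eq z with h' | h' <;> rw [h']
      · exact key _ hz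
      · rw [hτ.1, key _ hz]
    · exact hτ.2 z (Or.inr hz)
  have h1 : conj n (σ⁻¹ * π) x = x := by
    rw [conj, hx _ hτ', mul_assoc, ofPerm_mul_inv hτ, mul_one]
  rw [← h1, conj_conj hσ hτ, mul_inv_cancel_left, h1]

end Conj

/-- The sign change of `2` is `r_1 r_0 r_1`, which commutes with `e_0` by a defining relation. -/
theorem commute_e_zero (h0 : 0 < n) (τ : Perm ℤ) (hτ : τ ∈ signedPerm 1 n) :
    ofPerm n τ * e n 0 = e n 0 * ofPerm n τ := by
  refine (signedPerm_induction (p := fun τ => τ ∈ signedPerm 0 n ∧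
    ofPerm n τ * e n 0 = e n 0 * ofPerm n τ) ⟨one_mem _, ?_⟩ ?_ ?_ ?_ τ hτ).2
  · rw [ofPerm_one, one_mul, mul_one]
  · rintro π σ ⟨h1, h2⟩ ⟨h3, h4⟩
    refine ⟨mul_mem h1 h3, ?_⟩
    rw [ofPerm_mul h1 h3, mul_assoc, h4, ← mul_assoc, h2, mul_assoc]
  · intro h
    refine ⟨flip_mem (by omega) (by omega), ?_⟩
    rw [show ((1 : ℕ) : ℤ) + 1 = (2 : ℕ) by simp, ofPerm, toW_flip (by omega) (by omega)]
    exact rrr_e h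
  · intro j h h'
    refine ⟨refl_mem (by omega) (by omega) (by omega) (by omega) (by omega), ?_⟩
    rw [ofPerm_refl (by omega) h']
    exact (er_comm h0 h' (by omega)).symm

/-- The nontrivial case is the sign change `y_3` of the point `3`. -/
theorem commute_e_one (h0 : 1 < n) (τ : Perm ℤ) (hτ : τ ∈ signedPerm 2 n) :
    ofPerm n τ * e n 1 = e n 1 * ofPerm n τ := by
  refine (signedPerm_induction (p := fun τ => τ ∈ signedPerm 0 n ∧
    ofPerm n τ * e n 1 = e n 1 * ofPerm n τ) ⟨one_mem _, ?_⟩ ?_ ?_ ?_ τ hτ).2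
  · rw [ofPerm_one, one_mul, mul_one]
  · rintro π σ ⟨h1, h2⟩ ⟨h3, h4⟩
    refine ⟨mul_mem h1 h3, ?_⟩
    rw [ofPerm_mul h1 h3, mul_assoc, h4, ← mul_assoc, h2, mul_assoc]
  · intro h
    refine ⟨flip_mem (by omega) (by omega), ?_⟩
    rw [show ((2 : ℕ) : ℤ) + 1 = (3 : ℕ) by simp, ofPerm, toW_flip (by omega) (by omega)]
    have h1 := rre (n := n) (i := 2) (j := 1) (by omega) h (by omega) (by omega) (by omega)
    have h2 := rre (n := n) (i := 1) (j := 2) (by omega) h0 (by omega) (by omega) (by omega)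
    have h3 := err (n := n) (i := 2) (j := 1) (by omega) h (by omega) (by omega) (by omega)
    have h4 := err (n := n) (i := 1) (j := 2) (by omega) h0 (by omega) (by omega) (by omega)
    have h5 := er_comm (n := n) (i := 2) (j := 0) h (by omega) (by omega)
    simp only [y, W.toBr_mul]
    -- both sides are equal to `e₁ e₂ r₀ e₁`
    calc _ = (r n 2).toBr * (r n 1).toBr * (r n 0).toBr *
          ((r n 1).toBr * (r n 2).toBr * e n 1) := by simp only [Nat.zero_add, mul_assoc, Nat.reduceAdd]
      _ = (r n 2).toBr * (r n 1).toBr * ((r n 0).toBr * e n 2) * e n 1 := by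
          rw [h1]; simp only [mul_assoc]
      _ = (r n 2).toBr * (r n 1).toBr * e n 2 * (r n 0).toBr * e n 1 := by
          rw [← h5]; simp only [mul_assoc]
      _ = e n 1 * (e n 2 * (r n 0).toBr) * e n 1 := by rw [h2]; simp only [mul_assoc]
      _ = e n 1 * (r n 0).toBr * (e n 2 * e n 1) := by rw [h5]; simp only [mul_assoc]
      _ = e n 1 * ((r n 0).toBr * e n 2) * (r n 1).toBr * (r n 2).toBr := by
          rw [← h4]; simp only [mul_assoc]
      _ = e n 1 * (r n 2).toBr * (r n 1).toBr * (r n 0).toBr * (r n 1).toBr * (r n 2).toBr := by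
          rw [← h5, h3]; simp only [mul_assoc]
      _ = _ := by simp only [Nat.zero_add, mul_assoc, Nat.reduceAdd]
  · intro j h h'
    refine ⟨refl_mem (by omega) (by omega) (by omega) (by omega) (by omega), ?_⟩
    rw [ofPerm_refl (by omega) h']
    exact (er_comm h0 h' (by omega)).symm

open Classical in
variable (n) in
/-- The symmetric cup and cap that join `x` to `-x`: the conjugate of `e_0` by any signed
permutation that takes `1` to `x` (and `0` if there is none). -/
noncomputable def zPt (x : ℤ) : Br n :=
  if h : ∃ π ∈ signedPerm 0 n, π 1 = x then conj n h.choose (e n 0) else 0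

open Classical in
variable (n) in
/-- The pair of cups and caps that join `x` to `y` and `-x` to `-y`: the conjugate of `e_1` by any
signed permutation that takes `1` to `x` and `2` to `y` (and `0` if there is none). -/
noncomputable def ePt (x y : ℤ) : Br n :=
  if h : ∃ π ∈ signedPerm 0 n, π 1 = x ∧ π 2 = y then conj n h.choose (e n 1) else 0

theorem zPt_eq (h0 : 0 < n) {π : Perm ℤ} (hπ : π ∈ signedPerm 0 n) :
    zPt n (π 1) = conj n π (e n 0) := by
  have h : ∃ σ ∈ signedPerm 0 n, σ 1 = π 1 := ⟨π, hπ, rfl⟩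
  rw [zPt, dif_pos h]
  refine conj_eq_conj h.choose_spec.1 (k := 1) (commute_e_zero h0) hπ fun j h1 h2 => ?_
  obtain rfl : j = 1 := by omega
  exact h.choose_spec.2

theorem ePt_eq (h0 : 1 < n) {π : Perm ℤ} (hπ : π ∈ signedPerm 0 n) :
    ePt n (π 1) (π 2) = conj n π (e n 1) := by
  have h : ∃ σ ∈ signedPerm 0 n, σ 1 = π 1 ∧ σ 2 = π 2 := ⟨π, hπ, rfl, rfl⟩
  rw [ePt, dif_pos h]
  refine conj_eq_conj h.choose_spec.1 (k := 2) (commute_e_one h0) hπ fun j h1 h2 => ?_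
  obtain rfl | rfl : j = 1 ∨ j = 2 := by omega
  · exact h.choose_spec.2.1
  · exact h.choose_spec.2.2

theorem conj_zPt {π : Perm ℤ} (hπ : π ∈ signedPerm 0 n) {x : ℤ} (hx : IsPoint n x) :
    conj n π (zPt n x) = zPt n (π x) := by
  have h0 : 0 < n := by unfold IsPoint at hx; omega
  obtain ⟨σ, hσ, rfl⟩ := exists_perm₁ hx
  rw [zPt_eq h0 hσ, conj_conj hπ hσ, ← zPt_eq h0 (mul_mem hπ hσ), Perm.mul_apply]

theorem conj_ePt {π : Perm ℤ} (hπ : π ∈ signedPerm 0 n) {x y : ℤ} (hx : IsPoint n x)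
    (hy : IsPoint n y) (h : x.natAbs ≠ y.natAbs) :
    conj n π (ePt n x y) = ePt n (π x) (π y) := by
  have h0 : 1 < n := by unfold IsPoint at hx hy; omega
  obtain ⟨σ, hσ, rfl, rfl⟩ := exists_perm₂ hx hy h
  rw [ePt_eq h0 hσ, conj_conj hπ hσ, ← ePt_eq h0 (mul_mem hπ hσ), Perm.mul_apply, Perm.mul_apply]

theorem e_zero_eq (h : 0 < n) : e n 0 = zPt n 1 := by
  have := zPt_eq h (one_mem _)
  rw [Perm.one_apply] at this
  rw [this, conj, inv_one, ofPerm_one, one_mul, mul_one]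

theorem e_one_eq (h : 1 < n) : e n 1 = ePt n 1 2 := by
  have := ePt_eq h (one_mem _)
  rw [Perm.one_apply, Perm.one_apply] at this
  rw [this, conj, inv_one, ofPerm_one, one_mul, mul_one]

theorem simpleRefl_inv (j : ℕ) : (simpleRefl j)⁻¹ = simpleRefl j :=
  inv_eq_of_mul_eq_one_right ((simpleRefl_isCoxeterB 0).sq j)

theorem conj_simpleRefl {j : ℕ} (h : j < n) (x : Br n) :
    conj n (simpleRefl j) x = (r n j).toBr * x * (r n j).toBr := by
  rw [conj, simpleRefl_inv, ofPerm_simpleRefl h]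

theorem z_eq {i : ℕ} (h0 : 0 < i) (h : i ≤ n) : z n i = zPt n i := by
  induction i with
  | zero => omega
  | succ i ih =>
    obtain rfl | hi := Nat.eq_zero_or_pos i
    · rw [z, e_zero_eq (by omega)]; simp
    · obtain ⟨i, rfl⟩ : ∃ k, i = k + 1 := ⟨i - 1, by omega⟩
      have h1 : IsPoint n (i + 1 : ℕ) := by unfold IsPoint; omega
      rw [z, ← conj_simpleRefl (by omega), ih (by omega) (by omega),
        conj_zPt (simpleRefl_mem (by omega)) h1, simpleRefl_succ_apply]
      congr 1
      push_cast
      split_ifs <;> omega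

theorem e_eq_ePt {j : ℕ} (h0 : 0 < j) (h : j < n) : e n j = ePt n j (j + 1) := by
  induction j with
  | zero => omega
  | succ j ih =>
    obtain rfl | hj := Nat.eq_zero_or_pos j
    · rw [e_one_eq (by omega)]; simp
    · have h1 : IsPoint n j := by unfold IsPoint; omega
      have h2 : IsPoint n (j + 1) := by unfold IsPoint; omega
      have h3 := rer (n := n) (i := j + 1) (j := j) (by omega) h hj (by omega) (by omega)
      have h4 := rB_sq (n := n) j
      have h5 : e n (j + 1) = conj n (simpleRefl j) (conj n (simpleRefl (j + 1)) (e n j)) := by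
        rw [conj_simpleRefl h, conj_simpleRefl (by omega), h3]
        calc _ = 1 * e n (j + 1) * 1 := by rw [one_mul, mul_one]
          _ = _ := by rw [← h4]; simp only [mul_assoc]
      rw [h5, ih hj (by omega), conj_ePt (simpleRefl_mem h) h1 h2 (by omega),
        conj_ePt (simpleRefl_mem (by omega)) (h1.apply (simpleRefl_mem h))
          (h2.apply (simpleRefl_mem h)) (by
            rw [Ne, signedPerm_natAbs_eq (simpleRefl_mem h)]; omega)]
      obtain ⟨j, rfl⟩ : ∃ k, j = k + 1 := ⟨j - 1, by omega⟩
      congr 1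
      · rw [simpleRefl_succ_apply (j + 1), simpleRefl_succ_apply]
        push_cast
        split_ifs <;> omega
      · rw [simpleRefl_succ_apply (j + 1), simpleRefl_succ_apply]
        push_cast
        split_ifs <;> omega

/-! ### Relations between cups -/

/-- Cancellation of the unit `δ`. -/
theorem dl_smul_injective {x y : Br n} (h : dl • x = dl • y) : x = y := by
  have := congrArg (fun z => ((delta⁻¹ : (ℤ[T;T⁻¹])ˣ) : ℤ[T;T⁻¹]) • z) h
  simpa [smul_smul, dl] using this

theorem ePt_two_three (h : 2 < n) : ePt n 2 3 = e n 2 := by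
  rw [e_eq_ePt (by omega) h]; norm_num

theorem ePt_three_four (h : 3 < n) : ePt n 3 4 = e n 3 := by
  rw [e_eq_ePt (by omega) h]; norm_num

theorem zPt_two (h : 1 < n) : zPt n 2 = (r n 1).toBr * e n 0 * (r n 1).toBr := by
  have := z_eq (n := n) (i := 2) (by omega) h
  rw [Nat.cast_two] at this
  rw [← this]; rfl

theorem zPt_three (h : 2 < n) : zPt n 3 =
    (r n 2).toBr * ((r n 1).toBr * e n 0 * (r n 1).toBr) * (r n 2).toBr := by
  have := z_eq (n := n) (i := 3) (by omega) h
  rw [Nat.cast_ofNat] at this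
  rw [← this]; rfl

section Flip

variable {x : ℤ} (hx : IsPoint n x)
include hx

theorem flip_mul_zPt : ofPerm n (flip x) * zPt n x = zPt n x := by
  obtain ⟨σ, hσ, rfl⟩ := exists_perm₁ hx
  have h0 : 0 < n := by unfold IsPoint at hx; omega
  have h1 : IsPoint n 1 := ⟨by simp, by simp; omega⟩
  have := congrArg (conj n σ) (re (n := n) h0)
  rw [← ofPerm_simpleRefl h0, simpleRefl, if_pos rfl, conj_mul hσ, conj_ofPerm_flip hσ h1.flip,
    e_zero_eq h0, conj_zPt hσ h1] at this
  exact this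

theorem zPt_neg : zPt n (-x) = zPt n x := by
  have h1 := conj_zPt hx.flip hx
  have h2 : (flip x)⁻¹ = flip x := inv_eq_of_mul_eq_one_right (flip_mul_self x)
  have h0 : 0 < n := by unfold IsPoint at hx; omega
  have h4 : zPt n x * ofPerm n (flip x) = zPt n x := by
    obtain ⟨σ, hσ, rfl⟩ := exists_perm₁ hx
    have h1 : IsPoint n 1 := ⟨by simp, by simp; omega⟩
    have := congrArg (conj n σ) (er (n := n) h0)
    rwa [← ofPerm_simpleRefl h0, simpleRefl, if_pos rfl, conj_mul hσ, conj_ofPerm_flip hσ h1.flip,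
      e_zero_eq h0, conj_zPt hσ h1] at this
  rw [conj, flip_mul_zPt hx, h2, h4, flip_apply, if_pos (Or.inl rfl)] at h1
  exact h1.symm

theorem zPt_sq : zPt n x * zPt n x = dl • zPt n x := by
  obtain ⟨σ, hσ, rfl⟩ := exists_perm₁ hx
  have h0 : 0 < n := by unfold IsPoint at hx; omega
  rw [zPt_eq h0 hσ, ← conj_mul hσ, ee_zero h0, conj_smul]

end Flip

section Pair

variable {x y : ℤ} (hx : IsPoint n x) (hy : IsPoint n y) (h : x.natAbs ≠ y.natAbs)
include hx hy h

/-- A relation between the cups at the points `1` and `2` transports to any two points. -/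
theorem pair_transport : 1 < n ∧ IsPoint n 1 ∧ IsPoint n 2 ∧ ∃ σ ∈ signedPerm 0 n,
    (σ 1 = x ∧ σ 2 = y) ∧ conj n σ (e n 0) = zPt n x ∧
    conj n σ ((r n 1).toBr * e n 0 * (r n 1).toBr) = zPt n y ∧ conj n σ (e n 1) = ePt n x y ∧
    conj n σ (r n 0).toBr = ofPerm n (flip x) ∧ conj n σ (r n 1).toBr = ofPerm n (refl x y) := by
  have h0 : 1 < n := by unfold IsPoint at hx hy; omega
  have h1 : IsPoint n 1 := ⟨by simp, by simp; omega⟩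
  have h2 : IsPoint n 2 := ⟨by simp, by simp; omega⟩
  obtain ⟨σ, hσ, rfl, rfl⟩ := exists_perm₂ hx hy h
  refine ⟨h0, h1, h2, σ, hσ, ⟨rfl, rfl⟩, ?_, ?_, ?_, ?_, ?_⟩
  · rw [e_zero_eq (by omega), conj_zPt hσ h1]
  · rw [← zPt_two h0, conj_zPt hσ h2]
  · rw [e_one_eq h0, conj_ePt hσ h1 h2 (by simp)]
  · rw [← ofPerm_simpleRefl (by omega), simpleRefl, if_pos rfl, conj_ofPerm_flip hσ h1.flip]
  · rw [← ofPerm_simpleRefl (by omega), simpleRefl_succ 0]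
    norm_num
    rw [conj_ofPerm_refl hσ (h1.refl h2 (by simp))]

theorem refl_mul_ePt : ofPerm n (refl x y) * ePt n x y = ePt n x y := by
  obtain ⟨h0, h1, h2, σ, hσ, -, h3, h4, h5, h6, h7⟩ := pair_transport hx hy h
  rw [← h5, ← h7, ← conj_mul hσ, re h0]

theorem ePt_mul_refl : ePt n x y * ofPerm n (refl x y) = ePt n x y := by
  obtain ⟨h0, h1, h2, σ, hσ, -, h3, h4, h5, h6, h7⟩ := pair_transport hx hy h
  rw [← h5, ← h7, ← conj_mul hσ, er h0]

theorem refl_inv : (refl x y)⁻¹ = refl x y := by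
  apply inv_eq_of_mul_eq_one_right
  ext z
  have := hx.1
  have := hy.1
  simp only [Perm.mul_apply, refl_apply (show x ≠ 0 by omega) (show y ≠ 0 by omega) h,
    Perm.one_apply]
  split_ifs <;> omega

theorem ePt_symm : ePt n y x = ePt n x y := by
  have h1 := conj_ePt (hx.refl hy h) hx hy h
  rw [conj, refl_inv hx hy h, refl_mul_ePt hx hy h, ePt_mul_refl hx hy h] at h1
  have := hx.1
  have := hy.1
  rw [h1, refl_apply (show x ≠ 0 by omega) (show y ≠ 0 by omega) h,
    refl_apply (show x ≠ 0 by omega) (show y ≠ 0 by omega) h, if_pos rfl, if_pos rfl]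
  split_ifs <;> first | rfl | omega

theorem flip_ePt_flip : ofPerm n (flip x) * ePt n x y * ofPerm n (flip x) = ePt n (-x) y := by
  have h1 := conj_ePt hx.flip hx hy h
  have h2 : (flip x)⁻¹ = flip x := inv_eq_of_mul_eq_one_right (flip_mul_self x)
  rw [conj, h2, flip_apply, flip_apply, if_pos (Or.inl rfl), if_neg (by omega)] at h1
  exact h1

theorem ePt_neg : ePt n (-x) (-y) = ePt n x y := by
  obtain ⟨h0, h1, h2, σ, hσ, ⟨hσ1, hσ2⟩, h3, h4, h5, h6, h7⟩ := pair_transport hx hy h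
  -- `w` is the sign change of both `1` and `2`
  set w := simpleRefl 0 * simpleRefl 1 * simpleRefl 0 * simpleRefl 1 with hw
  have m0 : simpleRefl 0 ∈ signedPerm 0 n := simpleRefl_mem (by omega)
  have m1 : simpleRefl 1 ∈ signedPerm 0 n := simpleRefl_mem (by omega)
  have mw : w ∈ signedPerm 0 n := mul_mem (mul_mem (mul_mem m0 m1) m0) m1
  have hO : ofPerm n w = (r n 0).toBr * (r n 1).toBr * (r n 0).toBr * (r n 1).toBr := by
    rw [hw, ofPerm_mul (mul_mem (mul_mem m0 m1) m0) m1, ofPerm_mul (mul_mem m0 m1) m0,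
      ofPerm_mul m0 m1, ofPerm_simpleRefl (by omega), ofPerm_simpleRefl (by omega)]
  have hE : ofPerm n w * e n 1 = e n 1 := by
    rw [hO, mul_assoc, re h0, mul_assoc, mul_assoc, ← mul_assoc (r n 1).toBr, rr_e h0,
      ← mul_assoc, rB_sq, one_mul]
  have hE' : e n 1 * ofPerm n w = e n 1 := by
    have hO' : (r n 0).toBr * (r n 1).toBr * (r n 0).toBr * (r n 1).toBr =
        (r n 1).toBr * (r n 0).toBr * (r n 1).toBr * (r n 0).toBr := by
      have := congrArg W.toBr (rrrr h0)
      simpa only [W.toBr_mul] using this.symm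
    rw [hO, hO', ← mul_assoc, ← mul_assoc, ← mul_assoc, er h0, e_r_r h0, mul_assoc, rB_sq, mul_one]
  have hc : conj n w (e n 1) = e n 1 := by
    calc _ = e n 1 * (ofPerm n w * ofPerm n w⁻¹) := by rw [conj, hE, ← mul_assoc, hE']
      _ = _ := by rw [ofPerm_mul_inv mw, mul_one]
  rw [e_one_eq h0, conj_ePt mw h1 h2 (by simp)] at hc
  have w1 : w 1 = -1 := by
    simp [hw, Perm.mul_apply, simpleRefl_succ_apply 0, simpleRefl_zero_apply]
  have w2 : w 2 = -2 := by
    simp [hw, Perm.mul_apply, simpleRefl_succ_apply 0, simpleRefl_zero_apply]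
  have := congrArg (conj n σ) hc
  rwa [w1, w2, conj_ePt hσ h1.neg h2.neg (by simp), conj_ePt hσ h1 h2 (by simp), hσ.1, hσ.1, hσ1,
    hσ2] at this

theorem ePt_sq : ePt n x y * ePt n x y = (dl ^ 2) • ePt n x y := by
  obtain ⟨h0, h1, h2, σ, hσ, -, h3, h4, h5, h6, h7⟩ := pair_transport hx hy h
  rw [← h5, ← conj_mul hσ, ee h0 one_pos, conj_smul]

/-- Two cups on the same four points that cross each other close to a single loop. -/
theorem ePt_neg_mul_ePt :
    ePt n (-x) y * ePt n x y = dl • (ofPerm n (flip x) * ePt n x y) := by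
  obtain ⟨h0, h1, h2, σ, hσ, -, h3, h4, h5, h6, h7⟩ := pair_transport hx hy h
  rw [← flip_ePt_flip hx hy h, ← h5, ← h6, ← conj_mul hσ, ← conj_mul hσ, ← conj_mul hσ, mul_assoc,
    mul_assoc, ← mul_assoc (e n 1), e_r_e h0, mul_smul_comm, conj_smul]

theorem ePt_mul_zPt : ePt n x y * zPt n y = ePt n x y * zPt n x := by
  obtain ⟨h0, h1, h2, σ, hσ, -, h3, h4, h5, h6, h7⟩ := pair_transport hx hy h
  rw [← h5, ← h3, ← h4, ← conj_mul hσ, ← conj_mul hσ, ← mul_assoc, ← mul_assoc, er h0, e_e_r h0]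

theorem ePt_zPt_ePt : ePt n x y * zPt n x * ePt n x y = dl • ePt n x y := by
  obtain ⟨h0, h1, h2, σ, hσ, -, h3, h4, h5, h6, h7⟩ := pair_transport hx hy h
  rw [← h5, ← h3, ← conj_mul hσ, ← conj_mul hσ, e_e_e h0, conj_smul]

theorem zPt_ePt_zPt : zPt n x * ePt n x y * zPt n x = zPt n x * zPt n y := by
  obtain ⟨h0, h1, h2, σ, hσ, -, h3, h4, h5, h6, h7⟩ := pair_transport hx hy h
  rw [← h5, ← h3, ← h4, ← conj_mul hσ, ← conj_mul hσ, ← conj_mul hσ, ← e_r_e_r h0]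
  simp only [mul_assoc]

theorem zPt_commute_of_ne : zPt n x * zPt n y = zPt n y * zPt n x := by
  obtain ⟨h0, h1, h2, σ, hσ, -, h3, h4, h5, h6, h7⟩ := pair_transport hx hy h
  rw [← h3, ← h4, ← conj_mul hσ, ← conj_mul hσ, r_e_r_e h0, ← e_r_e_r h0]
  simp only [mul_assoc]

theorem refl_mul_zPt_zPt : ofPerm n (refl x y) * (zPt n x * zPt n y) = zPt n x * zPt n y := by
  obtain ⟨h0, h1, h2, σ, hσ, -, h3, h4, h5, h6, h7⟩ := pair_transport hx hy h
  rw [← h3, ← h4, ← h7, ← conj_mul hσ, ← conj_mul hσ]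
  congr 1
  calc _ = ((r n 1).toBr * e n 0 * (r n 1).toBr * e n 0) * (r n 1).toBr := by
        simp only [mul_assoc]
    _ = e n 0 * (e n 1 * e n 0 * (r n 1).toBr) := by rw [r_e_r_e h0]; simp only [mul_assoc]
    _ = e n 0 * e n 1 * e n 0 := by rw [e_e_r h0, mul_assoc]
    _ = _ := by rw [← e_r_e_r h0]; simp only [mul_assoc]

end Pair

theorem zPt_natAbs {x y : ℤ} (hx : IsPoint n x) (h : x.natAbs = y.natAbs) :
    zPt n y = zPt n x := by
  rcases Int.natAbs_eq_natAbs_iff.1 h.symm with rfl | rfl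
  · rfl
  · exact zPt_neg hx

theorem zPt_commute {x y : ℤ} (hx : IsPoint n x) (hy : IsPoint n y) :
    Commute (zPt n x) (zPt n y) := by
  by_cases h : x.natAbs = y.natAbs
  · rw [zPt_natAbs hx h]
  · exact zPt_commute_of_ne hx hy h

section Triple

variable {x y z : ℤ} (hx : IsPoint n x) (hy : IsPoint n y) (hz : IsPoint n z)
  (hxy : x.natAbs ≠ y.natAbs) (hxz : x.natAbs ≠ z.natAbs) (hyz : y.natAbs ≠ z.natAbs)
include hx hy hz hxy hxz hyz

/-- A cup pair that meets another one in a single point acts on it as a permutation. -/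
theorem ePt_mul_ePt : ePt n x y * ePt n y z = ofPerm n (refl x z) * ePt n y z := by
  have h0 : 2 < n := by unfold IsPoint at hx hy hz; omega
  have h1 : IsPoint n 1 := ⟨by simp, by simp; omega⟩
  have h2 : IsPoint n 2 := ⟨by simp, by simp; omega⟩
  have h3 : IsPoint n 3 := ⟨by simp, by simp; omega⟩
  obtain ⟨σ, hσ, rfl, rfl, rfl⟩ := exists_perm₃ hx hy hz hxy hxz hyz
  have m13 : refl 1 3 ∈ signedPerm 0 n := h1.refl h3 (by simp)
  have m2 : simpleRefl 2 ∈ signedPerm 0 n := simpleRefl_mem h0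
  have m1 : refl 1 2 ∈ signedPerm 0 n := h1.refl h2 (by simp)
  have key : refl 1 3 * simpleRefl 2 = simpleRefl 2 * refl 1 2 := by
    rw [mul_refl m2]
    rw [simpleRefl_succ_apply 1, simpleRefl_succ_apply 1]
    norm_num
  have hr : ofPerm n (refl 1 2) = (r n 1).toBr := by
    have := ofPerm_refl (n := n) (j := 1) one_pos (by omega)
    rw [← this]; norm_num
  have base : ePt n 1 2 * ePt n 2 3 = ofPerm n (refl 1 3) * ePt n 2 3 := by
    rw [ePt_two_three h0, ← e_one_eq (by omega), ← re h0, ← mul_assoc (ofPerm n (refl 1 3)),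
      ← ofPerm_simpleRefl h0, ← ofPerm_mul m13 m2, key, ofPerm_mul m2 m1, ofPerm_simpleRefl h0, hr,
      re h0]
    exact (rre one_pos (by omega) (by omega) h0 (by omega)).symm
  have := congrArg (conj n σ) base
  rwa [conj_mul hσ, conj_mul hσ, conj_ePt hσ h1 h2 (by simp), conj_ePt hσ h2 h3 (by simp),
    conj_ofPerm_refl hσ m13] at this

theorem ePt_commute_zPt : Commute (ePt n x y) (zPt n z) := by
  have h0 : 2 < n := by unfold IsPoint at hx hy hz; omega
  have a1 : IsPoint n 1 := ⟨by simp, by simp; omega⟩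
  have a2 : IsPoint n 2 := ⟨by simp, by simp; omega⟩
  have a3 : IsPoint n 3 := ⟨by simp, by simp; omega⟩
  obtain ⟨σ, hσ, rfl, rfl, rfl⟩ := exists_perm₃ hx hy hz hxy hxz hyz
  have h1 := rre (n := n) (i := 2) (j := 1) (by omega) h0 (by omega) (by omega) (by omega)
  have h2 := rre (n := n) (i := 1) (j := 2) (by omega) (by omega) (by omega) h0 (by omega)
  have h3 := err (n := n) (i := 2) (j := 1) (by omega) h0 (by omega) (by omega) (by omega)
  have h4 := err (n := n) (i := 1) (j := 2) (by omega) (by omega) (by omega) h0 (by omega)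
  have h5 := ee_comm (n := n) (i := 2) (j := 0) h0 (by omega) (by omega)
  have base : ePt n 1 2 * zPt n 3 = zPt n 3 * ePt n 1 2 := by
    rw [← e_one_eq (by omega), zPt_three h0]
    -- both sides are equal to `e₁ e₂ e₀ e₁`
    calc _ = (e n 1 * (r n 2).toBr * (r n 1).toBr) * e n 0 * (r n 1).toBr * (r n 2).toBr := by
          simp only [mul_assoc]
      _ = e n 1 * e n 0 * (e n 2 * (r n 1).toBr * (r n 2).toBr) := by
          rw [h3, mul_assoc (e n 1), h5]; simp only [mul_assoc]
      _ = e n 1 * (e n 0 * e n 2) * e n 1 := by rw [h4]; simp only [mul_assoc]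
      _ = (e n 1 * e n 2) * e n 0 * e n 1 := by rw [← h5]; simp only [mul_assoc]
      _ = (r n 2).toBr * (r n 1).toBr * (e n 2 * e n 0) * e n 1 := by
          rw [← h2]; simp only [mul_assoc]
      _ = (r n 2).toBr * (r n 1).toBr * e n 0 * (e n 2 * e n 1) := by
          rw [h5]; simp only [mul_assoc]
      _ = _ := by rw [← h1]; simp only [mul_assoc]
  have := congrArg (conj n σ) base
  rwa [conj_mul hσ, conj_mul hσ, conj_ePt hσ a1 a2 (by simp), conj_zPt hσ a3] at this

end Triple

theorem ePt_commute {x y z w : ℤ} (hx : IsPoint n x) (hy : IsPoint n y) (hz : IsPoint n z)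
    (hw : IsPoint n w) (hxy : x.natAbs ≠ y.natAbs) (hxz : x.natAbs ≠ z.natAbs)
    (hyz : y.natAbs ≠ z.natAbs) (hxw : x.natAbs ≠ w.natAbs) (hyw : y.natAbs ≠ w.natAbs)
    (hzw : z.natAbs ≠ w.natAbs) : Commute (ePt n x y) (ePt n z w) := by
  have h0 : 3 < n := by unfold IsPoint at hx hy hz hw; omega
  have a1 : IsPoint n 1 := ⟨by simp, by simp; omega⟩
  have a2 : IsPoint n 2 := ⟨by simp, by simp; omega⟩
  have a3 : IsPoint n 3 := ⟨by simp, by simp; omega⟩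
  have a4 : IsPoint n 4 := ⟨by simp, by simp; omega⟩
  obtain ⟨σ, hσ, rfl, rfl, rfl, rfl⟩ := exists_perm₄ hx hy hz hw hxy hxz hyz hxw hyw hzw
  have base := ee_comm (n := n) (i := 1) (j := 3) (by omega) h0 (by omega)
  rw [e_one_eq (by omega), ← ePt_three_four h0] at base
  have := congrArg (conj n σ) base
  rwa [conj_mul hσ, conj_mul hσ, conj_ePt hσ a1 a2 (by simp), conj_ePt hσ a3 a4 (by simp)] at this

/-! ### The anti-involution -/

theorem opp_one : opp (1 : Br n) = 1 := by simp [opp]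

theorem opp_smul (c : ℤ[T;T⁻¹]) (x : Br n) : opp (c • x) = c • opp x := by simp [opp]

theorem opp_units_smul (c : (ℤ[T;T⁻¹])ˣ) (x : Br n) : opp (c • x) = c • opp x :=
  opp_smul (c : ℤ[T;T⁻¹]) x

theorem opp_toBr (u : W n) : opp u.toBr = (u⁻¹).toBr := by
  obtain ⟨u, hu⟩ := u
  induction hu using Subgroup.closure_induction with
  | mem x hx =>
    obtain ⟨j, rfl⟩ := hx
    exact opp_gen _
  | one => exact opp_one
  | mul x y hx hy ihx ihy =>
    have h : W.toBr (⟨x * y, mul_mem hx hy⟩ : W n) =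
      W.toBr (⟨x, hx⟩ : W n) * W.toBr (⟨y, hy⟩ : W n) := rfl
    rw [h, opp_mul, ihx, ihy, ← W.toBr_mul, ← mul_inv_rev]
    rfl
  | inv x hx ih =>
    have h1 := W.toBr_mul_inv (⟨x, hx⟩ : W n)
    have h2 := congrArg opp h1
    rw [opp_mul, ih, opp_one] at h2
    calc _ = opp (W.toBr (⟨x, hx⟩ : W n)⁻¹) *
          (W.toBr (⟨x, hx⟩ : W n)⁻¹ * W.toBr (⟨x, hx⟩ : W n)) := by
          rw [W.toBr_inv_mul, mul_one]; rfl
      _ = W.toBr (⟨x, hx⟩ : W n) := by rw [← mul_assoc, h2, one_mul]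
      _ = _ := (congrArg W.toBr (inv_inv (⟨x, hx⟩ : W n))).symm

theorem opp_ofPerm {π : Perm ℤ} (hπ : π ∈ signedPerm 0 n) :
    opp (ofPerm n π) = ofPerm n π⁻¹ := by
  rw [ofPerm, opp_toBr, ofPerm, toW_inv hπ]

theorem opp_e (j : ℕ) : opp (e n j) = e n j := by
  unfold e
  split_ifs
  · exact opp_gen _
  · exact opp_one

theorem opp_z : ∀ i : ℕ, opp (z n i) = z n i
  | 0 => opp_one
  | 1 => opp_e 0
  | i + 2 => by
    rw [z, opp_mul, opp_mul, opp_z, opp_toBr, r_inv, mul_assoc]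

theorem gen_mem (g : Gen n) : gen delta g ∈ BrM n := Submonoid.subset_closure (Or.inr ⟨g, rfl⟩)

theorem e_mem (j : ℕ) : e n j ∈ BrM n := by
  unfold e
  split_ifs
  · exact gen_mem _
  · exact one_mem _

theorem toBr_mem (u : W n) : u.toBr ∈ BrM n := by
  have key : ∀ u : W n, u.toBr ∈ BrM n ∧ (u⁻¹).toBr ∈ BrM n := by
    rintro ⟨u, hu⟩
    induction hu using Subgroup.closure_induction with
    | mem x hx =>
      obtain ⟨j, rfl⟩ := hx
      exact ⟨gen_mem _, gen_mem _⟩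
    | one => exact ⟨one_mem _, one_mem _⟩
    | mul x y hx hy ihx ihy =>
      refine ⟨mul_mem ihx.1 ihy.1, ?_⟩
      have h : W.toBr (⟨x * y, mul_mem hx hy⟩ : W n)⁻¹ =
        W.toBr (⟨y, hy⟩ : W n)⁻¹ * W.toBr (⟨x, hx⟩ : W n)⁻¹ := by
        rw [← W.toBr_mul, ← mul_inv_rev]; rfl
      rw [h]
      exact mul_mem ihy.2 ihx.2
    | inv x hx ih =>
      refine ⟨ih.2, ?_⟩
      rw [show (⟨x⁻¹, inv_mem hx⟩ : W n)⁻¹ = ⟨x, hx⟩ from inv_inv (⟨x, hx⟩ : W n)]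
      exact ih.1
  exact (key u).1

theorem ofPerm_mem (π : Perm ℤ) : ofPerm n π ∈ BrM n := toBr_mem _

theorem dl_smul_mem {x : Br n} (hx : x ∈ BrM n) : dl • x ∈ BrM n := by
  rw [Algebra.smul_def]
  exact mul_mem (Submonoid.subset_closure (Or.inl (Or.inl rfl))) hx

theorem delta_inv_smul_mem {x : Br n} (hx : x ∈ BrM n) :
    (delta⁻¹ : (ℤ[T;T⁻¹])ˣ) • x ∈ BrM n := by
  rw [Units.smul_def, Algebra.smul_def]
  exact mul_mem (Submonoid.subset_closure (Or.inl (Or.inr rfl))) hx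

theorem delta_zpow_smul_mem {x : Br n} (hx : x ∈ BrM n) (k : ℤ) :
    (delta ^ k : (ℤ[T;T⁻¹])ˣ) • x ∈ BrM n := by
  induction k with
  | zero => simpa using hx
  | succ k ih =>
    rw [zpow_add, zpow_one, mul_comm, mul_smul]
    exact dl_smul_mem ih
  | pred k ih =>
    rw [zpow_sub, zpow_one, mul_comm, mul_smul]
    exact delta_inv_smul_mem ih

theorem opp_mem_and_opp_opp {x : Br n} (hx : x ∈ BrM n) : opp x ∈ BrM n ∧ opp (opp x) = x := by
  induction hx using Submonoid.closure_induction with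
  | mem x hx =>
    have key : ∀ c : ℤ[T;T⁻¹], opp (algebraMap ℤ[T;T⁻¹] (Br n) c) = algebraMap _ _ c := by
      intro c; rw [Algebra.algebraMap_eq_smul_one, opp_smul, opp_one]
    rcases hx with (rfl | rfl) | ⟨g, rfl⟩
    · rw [key, key]; exact ⟨Submonoid.subset_closure (Or.inl (Or.inl rfl)), rfl⟩
    · rw [key, key]; exact ⟨Submonoid.subset_closure (Or.inl (Or.inr rfl)), rfl⟩
    · rw [opp_gen, opp_gen]; exact ⟨gen_mem g, rfl⟩
  | one => rw [opp_one, opp_one]; exact ⟨one_mem _, rfl⟩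
  | mul x y hx hy ihx ihy =>
    rw [opp_mul, opp_mul, ihx.2, ihy.2]
    exact ⟨mul_mem ihy.1 ihx.1, rfl⟩

/-! ### The elements `b_i` -/

theorem b_succ (i : ℕ) : b n (i + 1) = b n i * z n (i + 1) := by
  simp [b, List.range_succ]

theorem b_zero : b n 0 = 1 := by simp [b]

theorem isPoint_natCast {i : ℕ} (h0 : 0 < i) (h : i ≤ n) : IsPoint n i := by
  unfold IsPoint; omega

theorem ePt_mem {x y : ℤ} (hx : IsPoint n x) (hy : IsPoint n y) (h : x.natAbs ≠ y.natAbs) :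
    ePt n x y ∈ BrM n := by
  obtain ⟨σ, hσ, rfl, rfl⟩ := exists_perm₂ hx hy h
  rw [ePt_eq (by unfold IsPoint at hx hy; omega) hσ]
  exact mul_mem (mul_mem (ofPerm_mem _) (e_mem _)) (ofPerm_mem _)

theorem commute_b {i : ℕ} (hi : i ≤ n) {x : Br n}
    (h : ∀ j : ℕ, 0 < j → j ≤ i → Commute x (zPt n j)) : Commute x (b n i) := by
  induction i with
  | zero => rw [b_zero]; exact Commute.one_right x
  | succ i ih =>
    rw [b_succ, z_eq (by omega) hi]
    exact (ih (by omega) fun j h0 h1 => h j h0 (by omega)).mul_right (h (i + 1) (by omega) le_rfl)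

theorem zPt_commute_b {i : ℕ} (hi : i ≤ n) {x : ℤ} (hx : IsPoint n x) :
    Commute (zPt n x) (b n i) :=
  commute_b hi fun _ h0 h1 => zPt_commute hx (isPoint_natCast h0 (by omega))

theorem zPt_mul_b {i : ℕ} (hi : i ≤ n) {x : ℤ} (hx : 0 < x.natAbs) (hxi : x.natAbs ≤ i) :
    zPt n x * b n i = dl • b n i := by
  have hxn : IsPoint n x := ⟨hx, by omega⟩
  induction i with
  | zero => omega
  | succ i ih =>
    rw [b_succ]
    by_cases h : x.natAbs = i + 1
    · rw [← mul_assoc, (zPt_commute_b (by omega) hxn).eq, mul_assoc, z_eq (by omega) hi,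
        zPt_natAbs (x := x) (y := (i + 1 : ℕ)) hxn (by omega), zPt_sq hxn, mul_smul_comm]
    · rw [← mul_assoc, ih (by omega) (by omega), smul_mul_assoc]

theorem b_sq {i : ℕ} (hi : i ≤ n) : b n i * b n i = (dl ^ i) • b n i := by
  induction i with
  | zero => simp [b_zero]
  | succ i ih =>
    have hp := isPoint_natCast (n := n) (i := i + 1) (by omega) hi
    rw [b_succ, z_eq (by omega) hi]
    calc _ = b n i * (zPt n (i + 1 : ℕ) * b n i) * zPt n (i + 1 : ℕ) := by simp only [mul_assoc]
      _ = (b n i * b n i) * (zPt n (i + 1 : ℕ) * zPt n (i + 1 : ℕ)) := by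
          rw [(zPt_commute_b (by omega) hp).eq]; simp only [mul_assoc]
      _ = _ := by
          rw [ih (by omega), zPt_sq hp, mul_smul_comm, smul_mul_assoc, smul_smul, pow_succ']

theorem opp_b {i : ℕ} (hi : i ≤ n) : opp (b n i) = b n i := by
  induction i with
  | zero => rw [b_zero, opp_one]
  | succ i ih =>
    rw [b_succ, opp_mul, ih (by omega), opp_z, z_eq (by omega) hi,
      (zPt_commute_b (by omega) (isPoint_natCast (by omega) hi)).eq]

/-- Signed permutations of `±1, …, ±i` are absorbed by `b_i`. -/
theorem ofPerm_mul_b {i : ℕ} (hi : i ≤ n) (π : Perm ℤ) (hπ : π ∈ signedPerm 0 i) :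
    ofPerm n π * b n i = b n i := by
  have hle : signedPerm 0 i ≤ signedPerm 0 n := signedPerm_mono le_rfl hi
  refine (signedPerm_induction (p := fun π => π ∈ signedPerm 0 n ∧ ofPerm n π * b n i = b n i)
    ⟨one_mem _, ?_⟩ ?_ ?_ ?_ π hπ).2
  · rw [ofPerm_one, one_mul]
  · rintro π σ ⟨h1, h2⟩ ⟨h3, h4⟩
    exact ⟨mul_mem h1 h3, by rw [ofPerm_mul h1 h3, mul_assoc, h4, h2]⟩
  · intro h
    have hp := isPoint_natCast (n := n) (i := 1) (by omega) (by omega)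
    refine ⟨flip_mem (by omega) (by omega), dl_smul_injective ?_⟩
    rw [← mul_smul_comm, ← zPt_mul_b hi (x := (1 : ℕ)) (by omega) (by omega), ← mul_assoc]
    congr 1
    exact flip_mul_zPt hp
  · intro j h0 h
    have hp := isPoint_natCast (n := n) (i := j) (by omega) (by omega)
    have hp' := isPoint_natCast (n := n) (i := j + 1) (by omega) (by omega)
    refine ⟨refl_mem (by omega) (by omega) (by omega) (by omega) (by omega),
      dl_smul_injective (dl_smul_injective ?_)⟩
    rw [← mul_smul_comm, ← mul_smul_comm, ← zPt_mul_b hi (x := (j + 1 : ℕ)) (by omega) (by omega),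
      ← mul_smul_comm, ← zPt_mul_b hi (x := (j : ℕ)) (by omega) (by omega),
      ← mul_assoc (zPt n (j + 1 : ℕ)), (zPt_commute hp' hp).eq, ← mul_assoc]
    congr 1
    have := refl_mul_zPt_zPt hp hp' (by omega)
    push_cast at this ⊢
    exact this

theorem commute_of_conj_eq {π : Perm ℤ} (hπ : π ∈ signedPerm 0 n) {x : Br n}
    (h : conj n π x = x) : ofPerm n π * x = x * ofPerm n π := by
  rw [ofPerm_mul_eq hπ, h]

theorem commute_b_of_fix {i : ℕ} (hi : i ≤ n) {π : Perm ℤ} (hπ : π ∈ signedPerm i n) :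
    Commute (ofPerm n π) (b n i) := by
  have hπ' := signedPerm_mono (Nat.zero_le i) le_rfl hπ
  refine commute_b hi fun j h0 h1 => commute_of_conj_eq hπ' ?_
  rw [conj_zPt hπ' (isPoint_natCast h0 (by omega)), hπ.2 _ (by omega)]

/-! ### Products of disjoint cup pairs -/

variable (n) in
/-- The product `e_{p+1} e_{p+3} ⋯ e_{p+2q-1}` of `q` neighbouring pairs of cups. -/
noncomputable def cups (p q : ℕ) : Br n :=
  ((List.range q).map fun k => e n (p + 2 * k + 1)).prod

theorem eProd_eq_cups (i p : ℕ) : eProd n i p = cups n p ((i - p) / 2) := rfl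

theorem cups_zero (p : ℕ) : cups n p 0 = 1 := by simp [cups]

theorem cups_succ (p q : ℕ) : cups n p (q + 1) = cups n p q * e n (p + 2 * q + 1) := by
  simp [cups, List.range_succ]

theorem cups_add (p q k : ℕ) : cups n p (q + k) = cups n p q * cups n (p + 2 * q) k := by
  induction k with
  | zero => rw [cups_zero, mul_one, add_zero]
  | succ k ih =>
    rw [← add_assoc, cups_succ, ih, cups_succ, mul_assoc]
    congr 4
    omega

theorem cups_one (p : ℕ) : cups n p 1 = e n (p + 1) := by rw [cups_succ, cups_zero, one_mul]

theorem cups_succ' (p q : ℕ) : cups n p (q + 1) = e n (p + 1) * cups n (p + 2) q := by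
  rw [add_comm, cups_add, cups_one]

theorem cups_mem (p q : ℕ) : cups n p q ∈ BrM n := by
  induction q with
  | zero => rw [cups_zero]; exact one_mem _
  | succ q ih => rw [cups_succ]; exact mul_mem ih (e_mem _)

theorem commute_cups {p q : ℕ} {x : Br n} (h : ∀ k < q, Commute x (e n (p + 2 * k + 1))) :
    Commute x (cups n p q) := by
  induction q with
  | zero => rw [cups_zero]; exact Commute.one_right x
  | succ q ih =>
    rw [cups_succ]
    exact (ih fun k hk => h k (by omega)).mul_right (h q (by omega))

theorem zPt_commute_cups {p q : ℕ} (hq : p + 2 * q ≤ n) {x : ℤ} (hx : IsPoint n x)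
    (h : x.natAbs ≤ p ∨ p + 2 * q < x.natAbs) : Commute (zPt n x) (cups n p q) := by
  refine commute_cups fun k hk => ?_
  rw [e_eq_ePt (by omega) (by omega)]
  refine (ePt_commute_zPt ?_ ?_ hx ?_ ?_ ?_).symm
  · unfold IsPoint; omega
  · unfold IsPoint; omega
  all_goals omega

theorem ePt_commute_cups {p q : ℕ} (hq : p + 2 * q ≤ n) {x y : ℤ} (hx : IsPoint n x)
    (hy : IsPoint n y) (hxy : x.natAbs ≠ y.natAbs)
    (h : x.natAbs ≤ p ∨ p + 2 * q < x.natAbs) (h' : y.natAbs ≤ p ∨ p + 2 * q < y.natAbs) :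
    Commute (ePt n x y) (cups n p q) := by
  refine commute_cups fun k hk => ?_
  rw [e_eq_ePt (by omega) (by omega)]
  refine ePt_commute hx hy ?_ ?_ hxy ?_ ?_ ?_ ?_ ?_
  · unfold IsPoint; omega
  · unfold IsPoint; omega
  all_goals omega

theorem opp_cups {p q : ℕ} (hq : p + 2 * q ≤ n) : opp (cups n p q) = cups n p q := by
  induction q with
  | zero => rw [cups_zero, opp_one]
  | succ q ih =>
    rw [cups_succ, opp_mul, ih (by omega), opp_e, e_eq_ePt (by omega) (by omega)]
    refine ePt_commute_cups (by omega) ?_ ?_ ?_ ?_ ?_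
    · unfold IsPoint; omega
    · unfold IsPoint; omega
    all_goals omega

theorem cups_commute_of_fix {p q : ℕ} (hq : p + 2 * q ≤ n) {π : Perm ℤ}
    (hπ : π ∈ signedPerm (p + 2 * q) n) : Commute (ofPerm n π) (cups n p q) := by
  have hπ' := signedPerm_mono (Nat.zero_le _) le_rfl hπ
  refine commute_cups fun k hk => commute_of_conj_eq hπ' ?_
  rw [e_eq_ePt (by omega) (by omega), conj_ePt hπ' (by unfold IsPoint; omega)
    (by unfold IsPoint; omega) (by omega), hπ.2 _ (by omega), hπ.2 _ (by omega)]

theorem cups_commute_of_mem {p q : ℕ} (hq : p + 2 * q ≤ n) {π : Perm ℤ}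
    (hπ : π ∈ signedPerm 0 p) : Commute (ofPerm n π) (cups n p q) := by
  have hπ' := signedPerm_mono le_rfl (show p ≤ n by omega) hπ
  refine commute_cups fun k hk => commute_of_conj_eq hπ' ?_
  rw [e_eq_ePt (by omega) (by omega), conj_ePt hπ' (by unfold IsPoint; omega)
    (by unfold IsPoint; omega) (by omega), hπ.2 _ (by omega), hπ.2 _ (by omega)]

variable (n) in
/-- The standard upper half diagram with `p` symmetric cups and `q` pairs of cups. -/
noncomputable def half (p q : ℕ) : Br n := cups n p q * b n (p + 2 * q)

/-- Signed permutations of the cups of a standard half diagram that commute with its pairs of cups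
are absorbed by the half diagram. -/
theorem ofPerm_mul_half {p q : ℕ} (hq : p + 2 * q ≤ n) {π : Perm ℤ}
    (hπ : π ∈ signedPerm 0 (p + 2 * q)) (h : Commute (ofPerm n π) (cups n p q)) :
    ofPerm n π * half n p q = half n p q := by
  rw [half, ← mul_assoc, h.eq, mul_assoc, ofPerm_mul_b hq π hπ]

theorem simpleRefl_apply_pos {j : ℕ} (hj : 0 < j) {z : ℤ} (hz : 0 < z) :
    simpleRefl j z = if z = j then (j + 1 : ℤ) else if z = j + 1 then (j : ℤ) else z := by
  obtain ⟨j, rfl⟩ : ∃ k, j = k + 1 := ⟨j - 1, by omega⟩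
  rw [simpleRefl_succ_apply]
  push_cast
  split_ifs <;> omega

/-- The signed permutation that exchanges the neighbouring pairs `{a, a+1}` and `{a+2, a+3}`. -/
def swapPairs (a : ℕ) : Perm ℤ :=
  simpleRefl (a + 1) * simpleRefl a * simpleRefl (a + 2) * simpleRefl (a + 1)

theorem swapPairs_mem {a m : ℕ} (h : a + 3 ≤ m) : swapPairs a ∈ signedPerm 0 m :=
  mul_mem (mul_mem (mul_mem (simpleRefl_mem (by omega)) (simpleRefl_mem (by omega)))
    (simpleRefl_mem (by omega))) (simpleRefl_mem (by omega))

theorem swapPairs_apply {a : ℕ} (ha : 0 < a) (k : ℕ) (hk : 0 < k) : swapPairs a k =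
    if k = a then (a + 2 : ℤ) else if k = a + 1 then (a + 3 : ℤ) else if k = a + 2 then (a : ℤ)
      else if k = a + 3 then (a + 1 : ℤ) else (k : ℤ) := by
  have s : ∀ j : ℕ, 0 < j → ∀ z : ℤ, 0 < z → z = j ∧ simpleRefl j z = j + 1 ∨
      z = j + 1 ∧ simpleRefl j z = j ∨ z ≠ j ∧ z ≠ j + 1 ∧ simpleRefl j z = z := by
    intro j hj z hz
    rw [simpleRefl_apply_pos hj hz]
    split_ifs <;> omega
  simp only [swapPairs, Perm.mul_apply]
  have h1 := s (a + 1) (by omega) k (by omega)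
  generalize simpleRefl (a + 1) k = v at h1 ⊢
  have h2 := s (a + 2) (by omega) v (by omega)
  generalize simpleRefl (a + 2) v = v' at h2 ⊢
  have h3 := s a ha v' (by omega)
  generalize simpleRefl a v' = v'' at h3 ⊢
  have h4 := s (a + 1) (by omega) v'' (by omega)
  generalize simpleRefl (a + 1) v'' = v''' at h4 ⊢
  split_ifs <;> omega

theorem swapPairs_commute_cups {p q k : ℕ} (hq : p + 2 * q ≤ n) (hk : k + 1 < q) :
    Commute (ofPerm n (swapPairs (p + 2 * k + 1))) (cups n p q) := by
  set a := p + 2 * k + 1 with ha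
  have hm : swapPairs a ∈ signedPerm 0 n := swapPairs_mem (by omega)
  have hc : ∀ j : ℕ, 0 < j → j < n → conj n (swapPairs a) (e n j) =
      ePt n (swapPairs a j) (swapPairs a (j + 1 : ℕ)) := by
    intro j h0 h
    rw [e_eq_ePt h0 h, ← Nat.cast_succ, conj_ePt hm (isPoint_natCast h0 h.le)
      (isPoint_natCast (i := j + 1) (by omega) h) (by omega)]
  have hfar : ∀ j : ℕ, 0 < j → j < n → (j + 1 < a ∨ a + 3 < j) →
      Commute (ofPerm n (swapPairs a)) (e n j) := by
    intro j h0 h h'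
    refine commute_of_conj_eq hm ?_
    rw [hc j h0 h, swapPairs_apply (by omega) _ h0, swapPairs_apply (by omega) _ (by omega),
      e_eq_ePt h0 h, if_neg (by omega), if_neg (by omega), if_neg (by omega), if_neg (by omega),
      if_neg (by omega), if_neg (by omega), if_neg (by omega), if_neg (by omega)]
    push_cast
    rfl
  have hsplit : cups n p q = cups n p k * (e n a * e n (a + 2)) *
      cups n (p + 2 * k + 4) (q - k - 2) := by
    conv_lhs => rw [show q = k + (2 + (q - k - 2)) by omega]
    rw [cups_add, cups_add _ 2, ← mul_assoc, cups_succ _ 1, cups_one]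
  rw [hsplit]
  refine ((commute_cups fun j hj => hfar _ (by omega) (by omega) (by omega)).mul_right
    (commute_of_conj_eq hm ?_)).mul_right
    (commute_cups fun j hj => hfar _ (by omega) (by omega) (by omega))
  rw [conj_mul hm, ee_comm (by omega) (by omega) (by omega), hc _ (by omega) (by omega),
    hc _ (by omega) (by omega), swapPairs_apply (by omega) _ (by omega),
    swapPairs_apply (by omega) _ (by omega), swapPairs_apply (by omega) _ (by omega),
    swapPairs_apply (by omega) _ (by omega), e_eq_ePt (by omega) (by omega),
    e_eq_ePt (j := a) (by omega) (by omega)]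
  congr 2 <;> split_ifs <;> push_cast <;> omega

/-- The pairs of cups of a standard half diagram are permuted transitively. -/
theorem exists_move_pair {p q : ℕ} (hq : p + 2 * q ≤ n) {k : ℕ} (hk : k < q) :
    ∃ τ ∈ signedPerm 0 (p + 2 * q), ofPerm n τ * half n p q = half n p q ∧
      ∀ x : ℤ, x.natAbs = p + 2 * k + 1 ∨ x.natAbs = p + 2 * k + 2 →
        (τ x).natAbs = p + 1 ∨ (τ x).natAbs = p + 2 := by
  induction k with
  | zero => exact ⟨1, one_mem _, by rw [ofPerm_one, one_mul], fun x hx => by simpa using hx⟩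
  | succ k ih =>
    obtain ⟨τ, hτ, h1, h2⟩ := ih (by omega)
    have hm : swapPairs (p + 2 * k + 1) ∈ signedPerm 0 (p + 2 * q) := swapPairs_mem (by omega)
    have hle : signedPerm 0 (p + 2 * q) ≤ signedPerm 0 n := signedPerm_mono le_rfl hq
    refine ⟨τ * swapPairs (p + 2 * k + 1), mul_mem hτ hm, ?_, fun x hx => ?_⟩
    · rw [ofPerm_mul (hle hτ) (hle hm), mul_assoc,
        ofPerm_mul_half hq hm (swapPairs_commute_cups hq hk), h1]
    · rw [Perm.mul_apply]
      apply h2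
      rw [(signedPerm_natAbs_eq hm (x := x) (y := (x.natAbs : ℤ))).2 (by omega),
        swapPairs_apply (by omega) _ (by omega)]
      split_ifs <;> omega

/-! ### Multiplication of half diagrams -/

variable (n) in
/-- The upper half diagrams with `i` cups: all `δ^k w P` with `w ∈ W(C_n)` and `P` a standard half
diagram. -/
def halves (i : ℕ) : Set (Br n) :=
  {x | ∃ (k : ℤ) (π : Perm ℤ) (p q : ℕ), π ∈ signedPerm 0 n ∧ p + 2 * q = i ∧
    x = (delta ^ k : (ℤ[T;T⁻¹])ˣ) • (ofPerm n π * half n p q)}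

variable (n) in
/-- The monomials that have `b_{i+1}` as a factor; there are none for `i ≥ n`. -/
def higher (i : ℕ) : Set (Br n) :=
  {x | i + 1 ≤ n ∧ ∃ m ∈ BrM n, ∃ m' ∈ BrM n, x = m * b n (i + 1) * m'}

theorem smul_mem_halves {i : ℕ} {x : Br n} (hx : x ∈ halves n i) (k : ℤ) :
    (delta ^ k : (ℤ[T;T⁻¹])ˣ) • x ∈ halves n i := by
  obtain ⟨l, π, p, q, h1, h2, rfl⟩ := hx
  exact ⟨k + l, π, p, q, h1, h2, by rw [zpow_add, mul_smul]⟩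

theorem ofPerm_mul_mem_halves {i : ℕ} {x : Br n} (hx : x ∈ halves n i) {σ : Perm ℤ}
    (hσ : σ ∈ signedPerm 0 n) : ofPerm n σ * x ∈ halves n i := by
  obtain ⟨l, π, p, q, h1, h2, rfl⟩ := hx
  exact ⟨l, σ * π, p, q, mul_mem hσ h1, h2, by rw [mul_smul_comm, ofPerm_mul hσ h1, mul_assoc]⟩

theorem half_mem_halves (p q : ℕ) : half n p q ∈ halves n (p + 2 * q) :=
  ⟨0, 1, p, q, one_mem _, rfl, by rw [zpow_zero, one_smul, ofPerm_one, one_mul]⟩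

theorem mul_mem_higher {i : ℕ} {x m m' : Br n} (hx : x ∈ higher n i) (hm : m ∈ BrM n)
    (hm' : m' ∈ BrM n) : m * x * m' ∈ higher n i := by
  obtain ⟨h, l, hl, l', hl', rfl⟩ := hx
  exact ⟨h, m * l, mul_mem hm hl, l' * m', mul_mem hl' hm', by simp only [mul_assoc]⟩

theorem smul_mem_higher {i : ℕ} {x : Br n} (hx : x ∈ higher n i) (k : ℤ) :
    (delta ^ k : (ℤ[T;T⁻¹])ˣ) • x ∈ higher n i := by
  obtain ⟨h, l, hl, l', hl', rfl⟩ := hx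
  exact ⟨h, _, delta_zpow_smul_mem hl k, l', hl', by simp only [smul_mul_assoc]⟩

theorem smul_mem_union {i : ℕ} {x : Br n} (hx : x ∈ halves n i ∪ higher n i) (k : ℤ) :
    (delta ^ k : (ℤ[T;T⁻¹])ˣ) • x ∈ halves n i ∪ higher n i :=
  hx.imp (fun h => smul_mem_halves h k) fun h => smul_mem_higher h k

theorem mem_union_of_dl_smul {i : ℕ} {x : Br n} (hx : dl • x ∈ halves n i ∪ higher n i) :
    x ∈ halves n i ∪ higher n i := by
  have h := smul_mem_union hx (-1)
  have h1 : (delta ^ (-1 : ℤ) : (ℤ[T;T⁻¹])ˣ) • (dl • x) = x := by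
    change (delta ^ (-1 : ℤ) : (ℤ[T;T⁻¹])ˣ) • ((delta : (ℤ[T;T⁻¹])ˣ) • x) = x
    rw [zpow_neg_one, inv_smul_smul]
  rwa [h1] at h

theorem dl_smul_mem_union {i : ℕ} {x : Br n} (hx : x ∈ halves n i ∪ higher n i) :
    dl • x ∈ halves n i ∪ higher n i := by
  have h := smul_mem_union hx 1
  rwa [zpow_one] at h

theorem ofPerm_mul_mem_union {i : ℕ} {x : Br n} (hx : x ∈ halves n i ∪ higher n i) {σ : Perm ℤ}
    (hσ : σ ∈ signedPerm 0 n) : ofPerm n σ * x ∈ halves n i ∪ higher n i :=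
  hx.imp (fun h => ofPerm_mul_mem_halves h hσ) fun h => by
    have := mul_mem_higher h (ofPerm_mem σ) (one_mem _)
    rwa [mul_one] at this

/-- A symmetric cup at a free point leads to a diagram with more cups. -/
theorem b_mul_zPt_mem {i : ℕ} {x : ℤ} (hx : IsPoint n x) (h : i < x.natAbs) :
    b n i * zPt n x ∈ higher n i := by
  have hxn := hx.2
  obtain ⟨g, hg, hgx⟩ := exists_signedPerm_apply (lo := i) (hi := n) (i + 1 : ℕ) x (by omega)
    (by omega) h hx.2
  have hg' := signedPerm_mono (Nat.zero_le i) le_rfl hg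
  refine ⟨by omega, ofPerm n g, ofPerm_mem _, ofPerm n g⁻¹, ofPerm_mem _, ?_⟩
  rw [b_succ, ← mul_assoc, (commute_b_of_fix (by omega) hg).eq, z_eq (by omega) (by omega),
    ← hgx, ← conj_zPt hg' (isPoint_natCast (by omega) (by omega)), conj]
  simp only [mul_assoc]

section Cases

variable {p q : ℕ} (hq : p + 2 * q ≤ n)
include hq

/-- To multiply a standard half diagram, a point in one of its pairs of cups may be moved into
the first pair. -/
theorem reduce_to_first_pair {x : ℤ} (h1 : p < x.natAbs) (h2 : x.natAbs ≤ p + 2 * q) :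
    ∃ τ ∈ signedPerm 0 (p + 2 * q), ofPerm n τ * half n p q = half n p q ∧
      ((τ x).natAbs = p + 1 ∨ (τ x).natAbs = p + 2) := by
  obtain ⟨τ, hτ, h3, h4⟩ := exists_move_pair hq (k := (x.natAbs - p - 1) / 2) (by omega)
  exact ⟨τ, hτ, h3, h4 x (by omega)⟩

/-- A symmetric cup either closes to a loop with another one, or splits a pair of cups into two
symmetric cups, or meets a free point. -/
theorem zPt_mul_half_mem {x : ℤ} (hx : IsPoint n x) :
    zPt n x * half n p q ∈ halves n (p + 2 * q) ∪ higher n (p + 2 * q) := by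
  rcases lt_or_ge (p + 2 * q) x.natAbs with h | h
  · right
    rw [half, ← mul_assoc, (zPt_commute_cups hq hx (Or.inr h)).eq, mul_assoc,
      (zPt_commute_b hq hx).eq]
    have := mul_mem_higher (b_mul_zPt_mem hx h) (cups_mem p q) (one_mem _)
    rwa [mul_one] at this
  rcases le_or_gt x.natAbs p with h' | h'
  · rw [half, ← mul_assoc, (zPt_commute_cups hq hx (Or.inl h')).eq, mul_assoc,
      zPt_mul_b hq hx.1 h, mul_smul_comm]
    exact dl_smul_mem_union (Or.inl (half_mem_halves p q))
  -- a symmetric cup splits the pair that it meets into two symmetric cups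
  have key : ∀ x : ℤ, (x.natAbs = p + 1 ∨ x.natAbs = p + 2) →
      zPt n x * half n p q ∈ halves n (p + 2 * q) ∪ higher n (p + 2 * q) := by
    intro x hx'
    obtain ⟨q, rfl⟩ : ∃ l, q = l + 1 := ⟨q - 1, by omega⟩
    have hp1 : IsPoint n (p + 1 : ℕ) := isPoint_natCast (by omega) (by omega)
    have hp2 : IsPoint n (p + 2 : ℕ) := isPoint_natCast (by omega) (by omega)
    have hE : e n (p + 1) = ePt n (p + 1 : ℕ) (p + 2 : ℕ) := e_eq_ePt (by omega) (by omega)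
    obtain ⟨a, c, ha, hc, hac, hxa, hE', ha', hc'⟩ : ∃ a c : ℤ, IsPoint n a ∧ IsPoint n c ∧
        a.natAbs ≠ c.natAbs ∧ zPt n x = zPt n a ∧ e n (p + 1) = ePt n a c ∧
        (a.natAbs = p + 1 ∨ a.natAbs = p + 2) ∧ (c.natAbs = p + 1 ∨ c.natAbs = p + 2) := by
      rcases hx' with hx' | hx'
      · exact ⟨_, _, hp1, hp2, by omega, zPt_natAbs hp1 (by omega), hE, by omega, by omega⟩
      · exact ⟨_, _, hp2, hp1, by omega, zPt_natAbs hp2 (by omega),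
          by rw [hE, ePt_symm hp1 hp2 (by omega)], by omega, by omega⟩
    have hG : Commute (zPt n a) (cups n (p + 2) q) := zPt_commute_cups (by omega) ha (by omega)
    have hG' : Commute (zPt n c) (cups n (p + 2) q) := zPt_commute_cups (by omega) hc (by omega)
    have main : dl • (zPt n a * half n p (q + 1)) = dl • dl • half n (p + 2) q := by
      have hb := zPt_mul_b hq ha.1 (by omega)
      have hb' := zPt_mul_b hq hc.1 (by omega)
      rw [half, half, show p + 2 + 2 * q = p + 2 * (q + 1) by omega]
      calc _ = zPt n a * (cups n p (q + 1) * (dl • b n (p + 2 * (q + 1)))) := by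
            simp only [mul_smul_comm]
        _ = zPt n a * ePt n a c * (cups n (p + 2) q * zPt n a) * b n (p + 2 * (q + 1)) := by
            rw [← hb, cups_succ', hE']; simp only [mul_assoc]
        _ = (zPt n a * ePt n a c * zPt n a) * cups n (p + 2) q * b n (p + 2 * (q + 1)) := by
            rw [← hG.eq]; simp only [mul_assoc]
        _ = zPt n a * cups n (p + 2) q * (zPt n c * b n (p + 2 * (q + 1))) := by
            rw [zPt_ePt_zPt ha hc hac, mul_assoc (zPt n a), hG'.eq]; simp only [mul_assoc]
        _ = dl • (cups n (p + 2) q * (zPt n a * b n (p + 2 * (q + 1)))) := by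
            rw [hb', mul_smul_comm, hG.eq]; simp only [mul_assoc]
        _ = _ := by rw [hb, mul_smul_comm]
    rw [hxa, dl_smul_injective main]
    refine dl_smul_mem_union (Or.inl ?_)
    have := half_mem_halves (n := n) (p + 2) q
    rwa [show p + 2 + 2 * q = p + 2 * (q + 1) by omega] at this
  obtain ⟨τ, hτ, h3, h4⟩ := reduce_to_first_pair hq h' h
  have hτ' := signedPerm_mono le_rfl hq hτ
  have h5 : zPt n x * half n p q = ofPerm n τ⁻¹ * (zPt n (τ x) * half n p q) := by
    rw [← mul_assoc, ofPerm_mul_eq (inv_mem hτ'), conj_zPt (inv_mem hτ') (hx.apply hτ'), mul_assoc]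
    have h6 : ofPerm n τ⁻¹ * half n p q = half n p q := by
      conv_lhs => rw [← h3, ← mul_assoc, ofPerm_inv_mul hτ', one_mul]
    rw [h6]
    simp
  rw [h5]
  exact ofPerm_mul_mem_union (key _ h4) (inv_mem hτ')

/-- A pair of cups that meets a pair of cups of the half diagram only permutes points. -/
theorem ePt_mul_half_mem_of_pair {x y : ℤ} (hx : IsPoint n x) (hy : IsPoint n y)
    (hxy : x.natAbs ≠ y.natAbs) (h1 : p < y.natAbs) (h2 : y.natAbs ≤ p + 2 * q) :
    ePt n x y * half n p q ∈ halves n (p + 2 * q) ∪ higher n (p + 2 * q) := by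
  have key : ∀ x y : ℤ, IsPoint n x → IsPoint n y → x.natAbs ≠ y.natAbs →
      (y.natAbs = p + 1 ∨ y.natAbs = p + 2) →
      ePt n x y * half n p q ∈ halves n (p + 2 * q) ∪ higher n (p + 2 * q) := by
    intro x y hx hy hxy h
    obtain ⟨q, rfl⟩ : ∃ l, q = l + 1 := ⟨q - 1, by omega⟩
    have hp1 : IsPoint n (p + 1 : ℕ) := isPoint_natCast (by omega) (by omega)
    have hp2 : IsPoint n (p + 2 : ℕ) := isPoint_natCast (by omega) (by omega)
    have hE : e n (p + 1) = ePt n (p + 1 : ℕ) (p + 2 : ℕ) := e_eq_ePt (by omega) (by omega)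
    -- `c` is the partner of `y`
    obtain ⟨c, hc, hyc, hE'⟩ : ∃ c : ℤ, IsPoint n c ∧ y.natAbs ≠ c.natAbs ∧
        e n (p + 1) = ePt n y c := by
      obtain h | h | h | h : y = (p + 1 : ℕ) ∨ y = (p + 2 : ℕ) ∨ y = -(p + 1 : ℕ) ∨
          y = -(p + 2 : ℕ) := by omega
      · exact ⟨(p + 2 : ℕ), hp2, by omega, by rw [h, hE]⟩
      · exact ⟨(p + 1 : ℕ), hp1, by omega, by rw [h, hE, ePt_symm hp1 hp2 (by omega)]⟩
      · exact ⟨-(p + 2 : ℕ), hp2.neg, by omega, by rw [h, hE, ePt_neg hp1 hp2 (by omega)]⟩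
      · exact ⟨-(p + 1 : ℕ), hp1.neg, by omega,
          by rw [h, hE, ePt_neg hp2 hp1 (by omega), ePt_symm hp1 hp2 (by omega)]⟩
    have hs : half n p (q + 1) = ePt n y c * (cups n (p + 2) q * b n (p + 2 * (q + 1))) := by
      rw [half, cups_succ', hE', mul_assoc]
    by_cases hxc : x.natAbs = c.natAbs
    · rcases Int.natAbs_eq_natAbs_iff.1 hxc with rfl | rfl
      · rw [hs, ← mul_assoc, ePt_symm hy hx (by omega), ePt_sq hy hx (by omega), smul_mul_assoc,
          ← hs, pow_two, mul_smul]
        exact dl_smul_mem_union (dl_smul_mem_union (Or.inl (half_mem_halves _ _)))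
      · rw [hs, ← mul_assoc, ← ePt_symm hy hc hyc, ePt_neg_mul_ePt hc hy (by omega),
          ePt_symm hy hc hyc, smul_mul_assoc, mul_assoc, ← hs]
        exact dl_smul_mem_union (ofPerm_mul_mem_union (Or.inl (half_mem_halves _ _)) hc.flip)
    · rw [hs, ← mul_assoc, ePt_mul_ePt hx hy hc hxy hxc hyc, mul_assoc, ← hs]
      exact ofPerm_mul_mem_union (Or.inl (half_mem_halves _ _)) (hx.refl hc hxc)
  obtain ⟨τ, hτ, h3, h4⟩ := reduce_to_first_pair hq h1 h2
  have hτ' := signedPerm_mono le_rfl hq hτ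
  have h5 : ePt n x y * half n p q = ofPerm n τ⁻¹ * (ePt n (τ x) (τ y) * half n p q) := by
    rw [← mul_assoc, ofPerm_mul_eq (inv_mem hτ'), conj_ePt (inv_mem hτ') (hx.apply hτ')
      (hy.apply hτ') (by rwa [Ne, signedPerm_natAbs_eq hτ']), mul_assoc]
    have h6 : ofPerm n τ⁻¹ * half n p q = half n p q := by
      conv_lhs => rw [← h3, ← mul_assoc, ofPerm_inv_mul hτ', one_mul]
    rw [h6]
    simp
  rw [h5]
  exact ofPerm_mul_mem_union (key _ _ (hx.apply hτ') (hy.apply hτ')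
    (by rwa [Ne, signedPerm_natAbs_eq hτ']) h4) (inv_mem hτ')

/-- The cases are the positions of `x` and `y`: in a pair of cups, at a symmetric cup, or free. -/
theorem ePt_mul_half_mem {x y : ℤ} (hx : IsPoint n x) (hy : IsPoint n y)
    (hxy : x.natAbs ≠ y.natAbs) :
    ePt n x y * half n p q ∈ halves n (p + 2 * q) ∪ higher n (p + 2 * q) := by
  by_cases h1 : p < y.natAbs ∧ y.natAbs ≤ p + 2 * q
  · exact ePt_mul_half_mem_of_pair hq hx hy hxy h1.1 h1.2
  by_cases h2 : p < x.natAbs ∧ x.natAbs ≤ p + 2 * q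
  · rw [← ePt_symm hx hy hxy]
    exact ePt_mul_half_mem_of_pair hq hy hx hxy.symm h2.1 h2.2
  -- a symmetric cup joined to a free point
  have mixed : ∀ x y : ℤ, IsPoint n x → IsPoint n y → x.natAbs ≤ p → p + 2 * q < y.natAbs →
      ePt n x y * half n p q ∈ halves n (p + 2 * q) ∪ higher n (p + 2 * q) := by
    intro x y hx hy h h'
    refine mem_union_of_dl_smul (Or.inr ?_)
    have hG := ePt_commute_cups hq hx hy (by omega) (Or.inl h) (Or.inr h')
    have : dl • (ePt n x y * half n p q) =
        (cups n p q * ePt n x y) * (b n (p + 2 * q) * zPt n y) * 1 := by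
      rw [half, mul_one]
      calc _ = (ePt n x y * cups n p q) * (dl • b n (p + 2 * q)) := by
            simp only [mul_smul_comm, mul_assoc]
        _ = cups n p q * (ePt n x y * zPt n x) * b n (p + 2 * q) := by
            rw [← zPt_mul_b hq hx.1 (by omega), hG.eq]; simp only [mul_assoc]
        _ = cups n p q * ePt n x y * (zPt n y * b n (p + 2 * q)) := by
            rw [← ePt_mul_zPt hx hy (by omega)]; simp only [mul_assoc]
        _ = _ := by rw [(zPt_commute_b hq hy).eq]
    rw [this]
    exact mul_mem_higher (b_mul_zPt_mem hy h')
      (mul_mem (cups_mem _ _) (ePt_mem hx hy (by omega))) (one_mem _)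
  rcases le_or_gt x.natAbs p with hxp | hxp
  · rcases le_or_gt y.natAbs p with hyp | hyp
    · -- two symmetric cups are turned into a pair
      obtain ⟨p, rfl⟩ : ∃ l, p = l + 2 := ⟨p - 2, by have := hx.1; have := hy.1; omega⟩
      have hp1 : IsPoint (p + 2) (p + 1 : ℕ) := isPoint_natCast (by omega) (by omega)
      have hp2 : IsPoint (p + 2) (p + 2 : ℕ) := isPoint_natCast (by omega) (by omega)
      obtain ⟨σ, hσ, hσ1, hσ2⟩ := exists_perm₂ (n := p + 2) ⟨hx.1, hxp⟩ ⟨hy.1, hyp⟩ hxy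
      obtain ⟨τ, hτ, hτ1, hτ2⟩ := exists_perm₂ hp1 hp2 (by omega)
      set g := τ * σ⁻¹ with hg
      have hgm : g ∈ signedPerm 0 (p + 2) := mul_mem hτ (inv_mem hσ)
      have hgx : g x = (p + 1 : ℕ) := by
        rw [← hτ1, ← hσ1]; simp [hg]
      have hgy : g y = (p + 2 : ℕ) := by
        rw [← hτ2, ← hσ2]; simp [hg]
      have hgn : g ∈ signedPerm 0 n := signedPerm_mono le_rfl (by omega) hgm
      have habs : ofPerm n g * half n (p + 2) q = half n (p + 2) q := by
        exact ofPerm_mul_half hq (signedPerm_mono le_rfl (by omega) hgm)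
          (cups_commute_of_mem hq hgm)
      have habs' : ofPerm n g⁻¹ * half n (p + 2) q = half n (p + 2) q := by
        conv_lhs => rw [← habs, ← mul_assoc, ofPerm_inv_mul hgn, one_mul]
      have h5 : ePt n x y * half n (p + 2) q = ofPerm n g⁻¹ * half n p (q + 1) := by
        have h6 : half n p (q + 1) = ePt n (g x) (g y) * half n (p + 2) q := by
          rw [hgx, hgy, half, half, cups_succ', e_eq_ePt (by omega) (by omega), mul_assoc,
            show p + 2 + 2 * q = p + 2 * (q + 1) by omega]
          push_cast
          rw [add_assoc, one_add_one_eq_two]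
        rw [h6, ← mul_assoc, ofPerm_mul_eq (inv_mem hgn), conj_ePt (inv_mem hgn) (hx.apply hgn)
          (hy.apply hgn) (by rwa [Ne, signedPerm_natAbs_eq hgn]), mul_assoc, habs']
        simp
      rw [h5]
      refine ofPerm_mul_mem_union (Or.inl ?_) (inv_mem hgn)
      have := half_mem_halves (n := n) p (q + 1)
      rwa [show p + 2 * (q + 1) = p + 2 + 2 * q by omega] at this
    · exact mixed x y hx hy hxp (by omega)
  · rcases le_or_gt y.natAbs p with hyp | hyp
    · rw [← ePt_symm hx hy hxy]
      exact mixed y x hy hx hyp (by omega)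
    · refine mem_union_of_dl_smul (Or.inr ?_)
      have hG := ePt_commute_cups hq hx hy hxy (Or.inr (by omega)) (Or.inr (by omega))
      have hG' := zPt_commute_cups hq hx (Or.inr (by omega))
      have hb : Commute (ePt n x y) (b n (p + 2 * q)) :=
        commute_b hq fun j h0 h => ePt_commute_zPt hx hy (isPoint_natCast h0 (by omega)) hxy
          (by omega) (by omega)
      have : dl • (ePt n x y * half n p q) =
          (ePt n x y * cups n p q) * (b n (p + 2 * q) * zPt n x) * ePt n x y := by
        rw [half, ← smul_mul_assoc, ← ePt_zPt_ePt hx hy hxy]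
        calc _ = ePt n x y * zPt n x * (ePt n x y * cups n p q) * b n (p + 2 * q) := by
              simp only [mul_assoc]
          _ = ePt n x y * (zPt n x * cups n p q) * (ePt n x y * b n (p + 2 * q)) := by
              rw [hG.eq]; simp only [mul_assoc]
          _ = ePt n x y * cups n p q * (zPt n x * b n (p + 2 * q)) * ePt n x y := by
              rw [hG'.eq, hb.eq]; simp only [mul_assoc]
          _ = _ := by rw [(zPt_commute_b hq hx).eq]
      rw [this]
      exact mul_mem_higher (b_mul_zPt_mem hx (by omega))
        (mul_mem (ePt_mem hx hy hxy) (cups_mem _ _)) (ePt_mem hx hy hxy)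

end Cases

theorem gen_mul_mem {i : ℕ} (hi : i ≤ n) (g : Gen n) {x : Br n} (hx : x ∈ halves n i) :
    gen delta g * x ∈ halves n i ∪ higher n i := by
  cases g with
  | r j =>
    refine Or.inl ?_
    rw [← r_toBr j.2, ← ofPerm_simpleRefl j.2]
    exact ofPerm_mul_mem_halves hx (simpleRefl_mem j.2)
  | e j =>
    rw [← e_eq j.2]
    obtain ⟨k, π, p, q, hπ, rfl, rfl⟩ := hx
    rw [mul_smul_comm]
    refine smul_mem_union ?_ k
    have hπ' := inv_mem hπ
    have move : e n j * (ofPerm n π * half n p q) =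
        ofPerm n π * (conj n π⁻¹ (e n j) * half n p q) := by
      rw [← mul_assoc, ← mul_assoc, conj, ← mul_assoc, ← mul_assoc, ofPerm_mul_inv hπ, one_mul,
        inv_inv]
    rw [move]
    refine ofPerm_mul_mem_union ?_ hπ
    obtain h0 | h0 := Nat.eq_zero_or_pos (j : ℕ)
    · have hp : IsPoint n (1 : ℕ) := isPoint_natCast (by omega) (by omega)
      rw [Nat.cast_one] at hp
      rw [h0, e_zero_eq (by omega), conj_zPt hπ' hp]
      exact zPt_mul_half_mem hi (hp.apply hπ')
    · have hp : IsPoint n (j : ℕ) := isPoint_natCast (by omega) (by omega)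
      have hp' : IsPoint n ((j : ℕ) + 1) := isPoint_natCast (i := (j : ℕ) + 1) (by omega) (by omega)
      rw [e_eq_ePt h0 j.2, conj_ePt hπ' hp hp' (by omega)]
      exact ePt_mul_half_mem hi (hp.apply hπ') (hp'.apply hπ')
        (by rw [Ne, signedPerm_natAbs_eq hπ']; omega)

theorem mul_b_mem {i : ℕ} (hi : i ≤ n) {m : Br n} (hm : m ∈ BrM n) :
    m * b n i ∈ halves n i ∪ higher n i := by
  induction hm using Submonoid.closure_induction_left with
  | one =>
    rw [one_mul]
    have := half_mem_halves (n := n) i 0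
    rw [half, cups_zero, one_mul] at this
    exact Or.inl this
  | mul_left x hx y hy ih =>
    rw [mul_assoc]
    rcases hx with (rfl | rfl) | ⟨g, rfl⟩
    · rw [← Algebra.smul_def]; exact dl_smul_mem_union ih
    · rw [← Algebra.smul_def]
      have := smul_mem_union ih (-1)
      rwa [zpow_neg_one] at this
    · rcases ih with ih | ih
      · exact gen_mul_mem hi g ih
      · right
        have := mul_mem_higher ih (gen_mem g) (one_mem _)
        rwa [mul_one] at this

theorem b_eq_smul {i : ℕ} (hi : i ≤ n) :
    b n i = (delta ^ (-(i : ℤ)) : (ℤ[T;T⁻¹])ˣ) • (b n i * b n i) := by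
  rw [b_sq hi]
  change _ = (delta ^ (-(i : ℤ)) : (ℤ[T;T⁻¹])ˣ) • (((delta ^ i : (ℤ[T;T⁻¹])ˣ) : ℤ[T;T⁻¹]) • b n i)
  rw [← Units.smul_def, smul_smul, zpow_neg, zpow_natCast, inv_mul_cancel, one_smul]

/-- Every monomial is an upper half diagram followed by a lower half diagram. -/
theorem exists_halves {x : Br n} (hx : x ∈ BrM n) : ∃ i ≤ n, ∃ k : ℤ, ∃ s ∈ halves n i,
    ∃ s' ∈ halves n i, x = (delta ^ k : (ℤ[T;T⁻¹])ˣ) • (s * opp s') := by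
  have main : ∀ d j : ℕ, j + d = n → ∀ m ∈ BrM n, ∀ m' ∈ BrM n, ∃ i ≤ n, ∃ k : ℤ,
      ∃ s ∈ halves n i, ∃ s' ∈ halves n i,
      m * b n j * m' = (delta ^ k : (ℤ[T;T⁻¹])ˣ) • (s * opp s') := by
    intro d
    induction d using Nat.strong_induction_on with
    | _ d ih =>
      intro j hj m hm m' hm'
      obtain ⟨ho, ho'⟩ := opp_mem_and_opp_opp hm'
      rcases mul_b_mem (i := j) (by omega) hm with h1 | ⟨hj', l, hl, l', hl', h1⟩
      · rcases mul_b_mem (i := j) (by omega) ho with h2 | ⟨hj', l, hl, l', hl', h2⟩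
        · refine ⟨j, by omega, -(j : ℤ), _, h1, _, h2, ?_⟩
          rw [opp_mul, ho', opp_b (by omega)]
          conv_lhs => rw [b_eq_smul (n := n) (i := j) (by omega)]
          simp only [mul_smul_comm, smul_mul_assoc, mul_assoc]
        · have h3 := congrArg opp h2
          rw [opp_mul, ho', opp_b (by omega), opp_mul, opp_mul, opp_b (by omega)] at h3
          have := ih (d - 1) (by omega) (j + 1) (by omega) _
            (mul_mem hm (opp_mem_and_opp_opp hl').1) _ (opp_mem_and_opp_opp hl).1
          rw [mul_assoc, h3]
          simpa only [mul_assoc] using this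
      · rw [h1]
        have := ih (d - 1) (by omega) (j + 1) (by omega) l hl (l' * m') (mul_mem hl' hm')
        simpa only [mul_assoc] using this
  have := main n 0 (by omega) x hx 1 (one_mem _)
  simpa only [b_zero, mul_one] using this

/-! ### Normal forms -/

theorem toBr_eq_ofPerm {u : W n} {π : Perm ℤ} (h : toW n π = u) : u.toBr = ofPerm n π := by
  rw [ofPerm, h]

theorem exists_perm_of_mem_L {i : ℕ} {u : W n} (hu : u ∈ L n i) :
    ∃ π ∈ signedPerm i n, toW n π = u := by
  have hle : signedPerm i n ≤ signedPerm 0 n := signedPerm_mono (Nat.zero_le _) le_rfl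
  induction hu using Subgroup.closure_induction with
  | mem x hx =>
    rcases hx with ⟨hi, rfl⟩ | ⟨j, h1, h2, rfl⟩
    · exact ⟨flip (i + 1 : ℕ), flip_mem (by omega) (by omega), toW_flip (by omega) hi⟩
    · refine ⟨simpleRefl j, ?_, toW_simpleRefl h2⟩
      rw [simpleRefl, if_neg (by omega)]
      exact refl_mem (by omega) (by omega) (by omega) (by omega) (by omega)
  | one => exact ⟨1, one_mem _, toW_one⟩
  | mul x y hx hy ihx ihy =>
    obtain ⟨π, hπ, h1⟩ := ihx
    obtain ⟨σ, hσ, h2⟩ := ihy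
    exact ⟨π * σ, mul_mem hπ hσ, by rw [toW_mul (hle hπ) (hle hσ), h1, h2]⟩
  | inv x hx ih =>
    obtain ⟨π, hπ, h1⟩ := ih
    exact ⟨π⁻¹, inv_mem hπ, by rw [toW_inv (hle hπ), h1]⟩

/-- The group `A_{i,p}` is absorbed by the standard half diagram. -/
theorem toBr_mul_half_of_mem_A {p q : ℕ} (hq : p + 2 * q ≤ n) {u : W n}
    (hu : u ∈ A n (p + 2 * q) p) : u.toBr * half n p q = half n p q := by
  rw [A, show (p + 2 * q - p) / 2 = q by omega] at hu
  induction hu using Subgroup.closure_induction with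
  | mem x hx =>
    rcases hx with (⟨j, hj, rfl⟩ | ⟨k, h1, h2, rfl⟩) | ⟨k, hk, rfl⟩
    · rw [toBr_eq_ofPerm (toW_simpleRefl (by omega))]
      have hm : simpleRefl j ∈ signedPerm 0 p := simpleRefl_mem hj
      exact ofPerm_mul_half hq (signedPerm_mono le_rfl (by omega) hm) (cups_commute_of_mem hq hm)
    · rw [toBr_eq_ofPerm (toW_simpleRefl (by omega))]
      refine ofPerm_mul_half hq (simpleRefl_mem (by omega)) (commute_cups fun l hl => ?_)
      rw [ofPerm_simpleRefl (by omega)]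
      by_cases h : p + 2 * k - 1 = p + 2 * l + 1
      · rw [h]
        exact (re (by omega)).trans (er (by omega)).symm
      · exact (er_comm (by omega) (by omega) (by omega)).symm
    · by_cases h0 : k = 0
      · have mf : flip (p + 1 : ℕ) ∈ signedPerm 0 (p + 2 * q) := flip_mem (by omega) (by omega)
        have ms : simpleRefl (p + 1) ∈ signedPerm 0 (p + 2 * q) := simpleRefl_mem (by omega)
        have hle : signedPerm 0 (p + 2 * q) ≤ signedPerm 0 n := signedPerm_mono le_rfl hq
        have hm := mul_mem (mul_mem mf ms) mf
        have ht : toW n (flip (p + 1 : ℕ) * simpleRefl (p + 1) * flip (p + 1 : ℕ)) = t n k p := by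
          rw [t, if_pos h0, toW_mul (hle (mul_mem mf ms)) (hle mf), toW_mul (hle mf) (hle ms),
            toW_flip (by omega) (by omega), toW_simpleRefl (by omega)]
        rw [toBr_eq_ofPerm ht]
        refine ofPerm_mul_half hq hm (commute_cups fun l hl => commute_of_conj_eq (hle hm) ?_)
        have hp1 : IsPoint n (p + 2 * l + 1 : ℕ) := isPoint_natCast (by omega) (by omega)
        have hp2 : IsPoint n (p + 2 * l + 2 : ℕ) := isPoint_natCast (by omega) (by omega)
        have hE : e n (p + 2 * l + 1) = ePt n (p + 2 * l + 1 : ℕ) (p + 2 * l + 2 : ℕ) :=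
          e_eq_ePt (by omega) (by omega)
        rw [hE, conj_ePt (hle hm) hp1 hp2 (by omega)]
        simp only [Perm.mul_apply, flip_apply, simpleRefl_succ_apply]
        obtain rfl | hl0 := Nat.eq_zero_or_pos l
        · rw [← ePt_symm hp1 hp2 (by omega), ← ePt_neg hp2 hp1 (by omega)]
          congr 1 <;> split_ifs <;> omega
        · congr 1 <;> split_ifs <;> omega
      · have ht : toW n (swapPairs (p + 2 * (k - 1) + 1)) = t n k p := by
          have m : ∀ j < n, simpleRefl j ∈ signedPerm 0 n := fun j => simpleRefl_mem
          rw [t, if_neg h0, swapPairs, toW_mul, toW_mul, toW_mul, toW_simpleRefl (by omega),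
            toW_simpleRefl (by omega), toW_simpleRefl (by omega),
            show p + 2 * (k - 1) + 1 + 1 = p + 2 * k by omega,
            show p + 2 * (k - 1) + 1 = p + 2 * k - 1 by omega,
            show p + 2 * k - 1 + 2 = p + 2 * k + 1 by omega]
          · exact m _ (by omega)
          · exact m _ (by omega)
          · exact mul_mem (m _ (by omega)) (m _ (by omega))
          · exact m _ (by omega)
          · exact mul_mem (mul_mem (m _ (by omega)) (m _ (by omega))) (m _ (by omega))
          · exact m _ (by omega)
        rw [toBr_eq_ofPerm ht]
        exact ofPerm_mul_half hq (swapPairs_mem (by omega)) (swapPairs_commute_cups hq (by omega))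
  | one => exact one_mul _
  | mul x y hx hy ihx ihy => rw [W.toBr_mul, mul_assoc, ihy, ihx]
  | inv x hx ih =>
    conv_lhs => rw [← ih, ← mul_assoc, W.toBr_inv_mul, one_mul]

theorem commute_half_of_mem_L {p q : ℕ} (hq : p + 2 * q ≤ n) {u : W n}
    (hu : u ∈ L n (p + 2 * q)) : Commute u.toBr (half n p q) := by
  obtain ⟨π, hπ, rfl⟩ := exists_perm_of_mem_L hu
  exact (cups_commute_of_fix hq hπ).mul_right (commute_b_of_fix hq hπ)

/-- Elements of `N_{i,p}` act on the standard half diagram through `L_i`, from the other side. -/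
theorem exists_mem_L {p q : ℕ} (hq : p + 2 * q ≤ n) {u : W n}
    (hu : u ∈ N n (p + 2 * q) p) :
    ∃ v ∈ L n (p + 2 * q), u.toBr * half n p q = half n p q * v.toBr := by
  rw [N, Subgroup.sup_eq_closure] at hu
  induction hu using Subgroup.closure_induction with
  | mem x hx =>
    rcases hx with hx | hx
    · exact ⟨1, one_mem _, by rw [toBr_mul_half_of_mem_A hq hx, W.toBr_one, mul_one]⟩
    · exact ⟨x, hx, commute_half_of_mem_L hq hx⟩
  | one => exact ⟨1, one_mem _, by rw [W.toBr_one, one_mul, mul_one]⟩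
  | mul x y hx hy ihx ihy =>
    obtain ⟨v, hv, h1⟩ := ihx
    obtain ⟨v', hv', h2⟩ := ihy
    exact ⟨v * v', mul_mem hv hv', by
      rw [W.toBr_mul, mul_assoc, h2, ← mul_assoc, h1, W.toBr_mul, mul_assoc]⟩
  | inv x hx ih =>
    obtain ⟨v, hv, h1⟩ := ih
    refine ⟨v⁻¹, inv_mem hv, ?_⟩
    calc _ = (x⁻¹).toBr * (half n p q * v.toBr) * (v⁻¹).toBr := by
          rw [mul_assoc, mul_assoc, W.toBr_mul_inv, mul_one]
      _ = _ := by rw [← h1, ← mul_assoc, W.toBr_inv_mul, one_mul]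

theorem exists_normalForm_half (D : ℕ → ℕ → Set (W n))
    (hD : ∀ i p : ℕ, i ≤ n → p ≤ i → Even (i - p) →
      Subgroup.IsComplement (D i p) (N n i p : Set (W n))) {i : ℕ} (hi : i ≤ n) {s : Br n}
    (hs : s ∈ halves n i) : ∃ (k : ℤ) (p q : ℕ), p + 2 * q = i ∧ ∃ u ∈ D i p, ∃ v ∈ L n i,
      s = (delta ^ k : (ℤ[T;T⁻¹])ˣ) • (u.toBr * half n p q * v.toBr) := by
  obtain ⟨k, π, p, q, hπ, rfl, rfl⟩ := hs
  obtain ⟨⟨⟨u, hu⟩, ⟨m, hm⟩⟩, h⟩ :=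
    (hD (p + 2 * q) p hi (by omega) ⟨q, by omega⟩).surjective (toW n π)
  obtain ⟨v, hv, hmv⟩ := exists_mem_L hi hm
  refine ⟨k, p, q, rfl, u, hu, v, hv, ?_⟩
  have h' : u * m = toW n π := h
  rw [ofPerm, ← h', W.toBr_mul, mul_assoc, hmv, ← mul_assoc]

theorem dl_pow_smul (i : ℕ) (x : Br n) :
    (dl ^ i) • x = (delta ^ (i : ℤ) : (ℤ[T;T⁻¹])ˣ) • x := by
  rw [zpow_natCast, Units.smul_def, Units.val_pow_eq_pow_val]

theorem exists_normalForm (D : ℕ → ℕ → Set (W n))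
    (hD : ∀ i p : ℕ, i ≤ n → p ≤ i → Even (i - p) →
      Subgroup.IsComplement (D i p) (N n i p : Set (W n))) {x : Br n} (hx : x ∈ BrM n) :
    ∃ (k : ℤ) (i p p' : ℕ), i ≤ n ∧ p ≤ i ∧ p' ≤ i ∧ Even (i - p) ∧ Even (i - p') ∧
      ∃ u ∈ D i p, ∃ v ∈ L n i, ∃ w ∈ D i p',
        x = ((delta ^ k : (ℤ[T;T⁻¹])ˣ) : ℤ[T;T⁻¹]) •
          (u.toBr * bTriple n p i p' * v.toBr * opp w.toBr) := by
  obtain ⟨i, hi, k, s, hs, s', hs', rfl⟩ := exists_halves hx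
  obtain ⟨k₁, p, q, hpq, u, hu, v, hv, rfl⟩ := exists_normalForm_half D hD hi hs
  obtain ⟨k₂, p', q', hpq', w, hw, v', hv', rfl⟩ := exists_normalForm_half D hD hi hs'
  have hmid : v * v'⁻¹ ∈ L n i := mul_mem hv (inv_mem hv')
  have hc : Commute (v * v'⁻¹).toBr (b n i * cups n p' q') := by
    obtain ⟨π, hπ, h⟩ := exists_perm_of_mem_L hmid
    rw [toBr_eq_ofPerm h]
    exact (commute_b_of_fix hi hπ).mul_right (cups_commute_of_fix (by omega) (by rwa [hpq']))
  have ho : opp (half n p' q') = b n i * cups n p' q' := by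
    rw [half, opp_mul, opp_b (by omega), opp_cups (by omega), hpq']
  refine ⟨k + k₁ + k₂ + i, i, p, p', hi, by omega, by omega, ⟨q, by omega⟩, ⟨q', by omega⟩,
    u, hu, v * v'⁻¹, hmid, w, hw, ?_⟩
  have main : u.toBr * half n p q * v.toBr * opp (w.toBr * half n p' q' * v'.toBr) =
      (dl ^ i) • (u.toBr * bTriple n p i p' * (v * v'⁻¹).toBr * opp w.toBr) := by
    calc _ = u.toBr * half n p q * ((v * v'⁻¹).toBr * (b n i * cups n p' q')) * opp w.toBr := by
          rw [opp_mul, opp_mul, opp_toBr v', ho, W.toBr_mul]; simp only [mul_assoc]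
      _ = u.toBr * cups n p q * (b n i * b n i) * cups n p' q' * (v * v'⁻¹).toBr * opp w.toBr := by
          rw [hc.eq, half, hpq]; simp only [mul_assoc]
      _ = _ := by
          rw [b_sq hi, bTriple, eProd_eq_cups, eProd_eq_cups, show (i - p) / 2 = q by omega,
            show (i - p') / 2 = q' by omega]
          simp only [mul_smul_comm, smul_mul_assoc, mul_assoc]
  rw [opp_units_smul, smul_mul_smul_comm, main, dl_pow_smul, smul_smul, smul_smul,
    ← Units.smul_def]
  congr 1
  simp only [zpow_add, mul_assoc]

/-! ### A convolution formula for the sequence `a` -/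

/-- The number `C(m, k) a_{m-k}` of half diagrams on `m` points with `k` free points; it is `0`
for `k > m` in spite of the truncated subtraction. -/
def halfCount (m k : ℕ) : ℕ := m.choose k * a (m - k)

theorem halfCount_of_lt {m k : ℕ} (h : m < k) : halfCount m k = 0 := by
  simp [halfCount, Nat.choose_eq_zero_of_lt h]

theorem halfCount_zero (m : ℕ) :
    halfCount (m + 2) 0 = halfCount (m + 1) 0 + 2 * (m + 1) * halfCount m 0 := by
  simp [halfCount, a]

theorem halfCount_succ (m k : ℕ) : halfCount (m + 2) (k + 1) =
    halfCount (m + 1) (k + 1) + 2 * (m + 1) * halfCount m (k + 1) + halfCount (m + 1) k := by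
  have h1 : (m + 1).choose (k + 1) * a (m + 2 - (k + 1)) =
      halfCount (m + 1) (k + 1) + 2 * (m + 1) * halfCount m (k + 1) := by
    rcases lt_trichotomy k m with h | rfl | h
    · obtain ⟨d, rfl⟩ : ∃ d, m = k + 1 + d := ⟨m - k - 1, by omega⟩
      have h2 := Nat.choose_mul_succ_eq (k + 1 + d) (k + 1)
      rw [show k + 1 + d + 1 - (k + 1) = d + 1 by omega] at h2
      simp only [halfCount]
      rw [show k + 1 + d + 2 - (k + 1) = d + 2 by omega,
        show k + 1 + d + 1 - (k + 1) = d + 1 by omega, show k + 1 + d - (k + 1) = d by omega, a]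
      calc _ = (k + 1 + d + 1).choose (k + 1) * a (d + 1) +
            2 * ((k + 1 + d + 1).choose (k + 1) * (d + 1)) * a d := by ring
        _ = _ := by rw [← h2]; ring
    · simp [halfCount, a]
    · rw [Nat.choose_eq_zero_of_lt (by omega), halfCount_of_lt (by omega),
        halfCount_of_lt (by omega)]
      simp
  calc halfCount (m + 2) (k + 1) = (m + 1).choose (k + 1) * a (m + 2 - (k + 1)) +
        (m + 1).choose k * a (m + 2 - (k + 1)) := by
        rw [halfCount, Nat.choose_succ_succ' (m + 1) k]; ring
    _ = _ := by
        rw [h1, halfCount, halfCount, halfCount, show m + 2 - (k + 1) = m + 1 - k by omega]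

theorem succ_mul_halfCount (m k : ℕ) :
    (k + 1) * halfCount (m + 1) (k + 1) = (m + 1) * halfCount m k := by
  have := Nat.add_one_mul_choose_eq m k
  simp only [halfCount, Nat.add_sub_add_right]
  rw [← mul_assoc, ← mul_assoc, this]
  ring

/-- Diagrams on `m + l` points, sorted by the number `k` of strands that join a point among the
first `m` with a point among the last `l`. -/
theorem sum_halfCount (m : ℕ) : ∀ l N : ℕ, m < N →
    ∑ k ∈ Finset.range N, halfCount m k * halfCount l k * (k.factorial * 2 ^ k) = a (m + l) := by
  have tail : ∀ (m l N : ℕ),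
      ∑ k ∈ Finset.range N, halfCount m k * halfCount (l + 1) (k + 1) *
        ((k + 1).factorial * 2 ^ (k + 1)) =
      2 * (l + 1) * ∑ k ∈ Finset.range N, halfCount m k * halfCount l k *
        (k.factorial * 2 ^ k) := by
    intro m l N
    rw [Finset.mul_sum]
    refine Finset.sum_congr rfl fun k _ => ?_
    have := succ_mul_halfCount l k
    calc _ = halfCount m k * ((k + 1) * halfCount (l + 1) (k + 1)) *
          (2 * (k.factorial * 2 ^ k)) := by rw [Nat.factorial_succ, pow_succ]; ring
      _ = _ := by rw [this]; ring
  induction m using Nat.twoStepInduction with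
  | zero =>
    intro l N hN
    obtain ⟨N, rfl⟩ : ∃ M, N = M + 1 := ⟨N - 1, by omega⟩
    rw [Finset.sum_range_succ', Finset.sum_eq_zero fun k _ => by
      rw [halfCount_of_lt (by omega : 0 < k + 1)]; simp]
    simp [halfCount, a]
  | one =>
    intro l N hN
    obtain ⟨N, rfl⟩ : ∃ M, N = M + 2 := ⟨N - 2, by omega⟩
    rw [Finset.sum_range_succ', Finset.sum_range_succ', Finset.sum_eq_zero fun k _ => by
      rw [halfCount_of_lt (by omega : 1 < k + 1 + 1)]; simp]
    rcases l with _ | l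
    · simp [halfCount, a]
    · have := succ_mul_halfCount l 0
      simp [halfCount, a] at this ⊢
      rw [show 1 + (l + 1) = l + 2 by ring, a]
      ring
  | more m ih0 ih1 =>
    intro l N hN
    obtain ⟨N, rfl⟩ : ∃ M, N = M + 1 := ⟨N - 1, by omega⟩
    have split : ∑ k ∈ Finset.range (N + 1), halfCount (m + 2) k * halfCount l k *
        (k.factorial * 2 ^ k) =
        ∑ k ∈ Finset.range (N + 1), halfCount (m + 1) k * halfCount l k * (k.factorial * 2 ^ k) +
        2 * (m + 1) * ∑ k ∈ Finset.range (N + 1), halfCount m k * halfCount l k *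
          (k.factorial * 2 ^ k) +
        ∑ k ∈ Finset.range N, halfCount (m + 1) k * halfCount l (k + 1) *
          ((k + 1).factorial * 2 ^ (k + 1)) := by
      rw [Finset.sum_range_succ', Finset.sum_range_succ' _ N, Finset.sum_range_succ' _ N,
        halfCount_zero, mul_add (2 * (m + 1)), Finset.mul_sum]
      simp only [halfCount_succ, add_mul, Finset.sum_add_distrib]
      simp only [mul_assoc]
      ring
    rw [split, ih1 l _ (by omega), ih0 l _ (by omega)]
    rcases l with _ | l
    · rw [Finset.sum_eq_zero fun k _ => by rw [halfCount_of_lt (by omega : 0 < k + 1)]; simp]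
      simp [a]
    · rw [tail, ih1 l _ (by omega), show m + 2 + (l + 1) = m + 1 + l + 2 by ring, a]
      rw [show m + 1 + (l + 1) = m + 1 + l + 1 by ring, show m + (l + 1) = m + 1 + l by ring]
      ring

/-- The number of triples of two half diagrams with `i` cups and a signed permutation of the other
`n - i` points. -/
theorem sum_card_eq (n : ℕ) : ∑ i ∈ Finset.range (n + 1),
    (n.choose i * a i) * (2 ^ (n - i) * (n - i).factorial) * (n.choose i * a i) = a (2 * n) := by
  rw [two_mul, ← sum_halfCount n n (n + 1) (by omega), ← Finset.sum_range_reflect]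
  refine Finset.sum_congr rfl fun k hk => ?_
  have hk' : k ≤ n := by simpa [Nat.lt_succ_iff] using hk
  rw [halfCount, show n + 1 - 1 - k = n - k by omega, Nat.choose_symm hk',
    show n - (n - k) = k by omega]
  ring

/-! ### Counting half diagrams -/

/-- Products of disjoint pairs of cups at points whose absolute values lie in `I`. Points of `I`
that no pair uses carry a symmetric cup once such a product is multiplied by `b_i`. -/
inductive PairProd (n : ℕ) : Finset ℕ → Br n → Prop
  | one (I : Finset ℕ) : PairProd n I 1
  | cons (I : Finset ℕ) (x y : ℤ) (g : Br n) (hx : x.natAbs ∈ I) (hy : y.natAbs ∈ I)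
      (hxy : x.natAbs ≠ y.natAbs) (hg : PairProd n ((I.erase x.natAbs).erase y.natAbs) g) :
      PairProd n I (ePt n x y * g)

theorem PairProd.mono {I J : Finset ℕ} {g : Br n} (h : PairProd n I g) (hIJ : I ⊆ J) :
    PairProd n J g := by
  induction h generalizing J with
  | one I => exact .one J
  | cons I x y g hx hy hxy hg ih =>
    exact .cons J x y g (hIJ hx) (hIJ hy) hxy
      (ih (Finset.erase_subset_erase _ (Finset.erase_subset_erase _ hIJ)))

/-- Either the point `c` is free, or its pair of cups can be moved to the front. -/
theorem PairProd.extract {I : Finset ℕ} {g : Br n} (h : PairProd n I g)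
    (hI : ∀ j ∈ I, IsPoint n j) {c : ℕ} (hc : c ∈ I) : PairProd n (I.erase c) g ∨
      ∃ y : ℤ, y.natAbs ∈ I.erase c ∧ ∃ g', PairProd n ((I.erase c).erase y.natAbs) g' ∧
        g = ePt n c y * g' := by
  have pt : ∀ {I : Finset ℕ}, (∀ j ∈ I, IsPoint n j) → ∀ {x : ℤ}, x.natAbs ∈ I → IsPoint n x := by
    intro I hI x hx
    have := hI _ hx
    unfold IsPoint at *
    omega
  induction h with
  | one I => exact Or.inl (.one _)
  | cons I x y g hx hy hxy hg ih =>
    have hx' := pt hI hx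
    have hy' := pt hI hy
    by_cases hxc : x.natAbs = c
    · subst hxc
      right
      rcases Int.natAbs_eq x with h | h
      · exact ⟨y, Finset.mem_erase.2 ⟨hxy.symm, hy⟩, g, hg, by rw [← h]⟩
      · refine ⟨-y, by simpa using ⟨hxy.symm, hy⟩, g, by simpa using hg, ?_⟩
        rw [← ePt_neg hx' hy' hxy]
        congr 2
        omega
    by_cases hyc : y.natAbs = c
    · subst hyc
      right
      have hg' := hg
      rw [Finset.erase_right_comm] at hg'
      rcases Int.natAbs_eq y with h | h
      · exact ⟨x, Finset.mem_erase.2 ⟨hxy, hx⟩, g, hg', by rw [← h, ePt_symm hx' hy' hxy]⟩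
      · refine ⟨-x, by simpa using ⟨hxy, hx⟩, g, by simpa using hg', ?_⟩
        rw [← ePt_symm hx' hy' hxy, ← ePt_neg hy' hx' hxy.symm]
        congr 2
        omega
    have hsub : (I.erase x.natAbs).erase y.natAbs ⊆ I :=
      (Finset.erase_subset _ _).trans (Finset.erase_subset _ _)
    rcases ih (fun j hj => hI j (hsub hj))
      (Finset.mem_erase.2 ⟨fun h => hyc h.symm, Finset.mem_erase.2 ⟨fun h => hxc h.symm, hc⟩⟩)
      with h | ⟨w, hw, g', hg', rfl⟩
    · left
      refine .cons _ x y g (Finset.mem_erase.2 ⟨hxc, hx⟩) (Finset.mem_erase.2 ⟨hyc, hy⟩) hxy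
        (h.mono ?_)
      intro j hj
      simp only [Finset.mem_erase] at hj ⊢
      tauto
    · right
      have hw' := hw
      simp only [Finset.mem_erase] at hw'
      have hwp : IsPoint n w := pt hI hw'.2.2.2
      refine ⟨w, Finset.mem_erase.2 ⟨hw'.1, hw'.2.2.2⟩, ePt n x y * g', ?_, ?_⟩
      · refine .cons _ x y g' ?_ ?_ hxy (hg'.mono ?_)
        · simp only [Finset.mem_erase]; exact ⟨Ne.symm hw'.2.2.1, hxc, hx⟩
        · simp only [Finset.mem_erase]; exact ⟨Ne.symm hw'.2.1, hyc, hy⟩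
        · intro j hj
          simp only [Finset.mem_erase] at hj ⊢
          tauto
      · rw [← mul_assoc, ← mul_assoc, (ePt_commute hx' hy' (hI c hc) hwp hxy (by simpa using hxc)
          (by simpa using hyc) (Ne.symm hw'.2.2.1) (Ne.symm hw'.2.1)
          (by simpa using Ne.symm hw'.1)).eq]

/-- Removing the strand at one point gives the recursion that defines `a`. -/
theorem exists_finset_pairProd (m : ℕ) : ∀ I : Finset ℕ, I.card = m → (∀ j ∈ I, IsPoint n j) →
    ∃ F : Finset (Br n), F.card ≤ a m ∧ ∀ g, PairProd n I g → g ∈ F := by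
  classical
  have small : ∀ I : Finset ℕ, I.card ≤ 1 → ∀ g, PairProd n I g → g ∈ ({1} : Finset (Br n)) := by
    intro I hI g hg
    cases hg with
    | one => simp
    | cons _ x y g hx hy hxy hg => exact absurd (Finset.card_le_one.1 hI _ hx _ hy) hxy
  induction m using Nat.twoStepInduction with
  | zero => exact fun I hI _ => ⟨{1}, by simp [a], small I (by omega)⟩
  | one => exact fun I hI _ => ⟨{1}, by simp [a], small I (by omega)⟩
  | more m ih0 ih1 =>
    intro I hI hpt
    obtain ⟨c, hc⟩ : I.Nonempty := Finset.card_pos.1 (by omega)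
    have hcard : (I.erase c).card = m + 1 := by rw [Finset.card_erase_of_mem hc]; omega
    obtain ⟨F, hF, hF'⟩ := ih1 (I.erase c) hcard fun j hj => hpt j (Finset.mem_of_mem_erase hj)
    have H : ∀ y : ℕ, ∃ G : Finset (Br n), y ∈ I.erase c →
        G.card ≤ a m ∧ ∀ g, PairProd n ((I.erase c).erase y) g → g ∈ G := by
      intro y
      by_cases hy : y ∈ I.erase c
      · obtain ⟨G, hG⟩ := ih0 ((I.erase c).erase y)
          (by rw [Finset.card_erase_of_mem hy]; omega)
          fun j hj => hpt j (Finset.mem_of_mem_erase (Finset.mem_of_mem_erase hj))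
        exact ⟨G, fun _ => hG⟩
      · exact ⟨∅, fun h => absurd h hy⟩
    choose G hG using H
    refine ⟨F ∪ (I.erase c).biUnion fun y =>
      (G y).image (ePt n c y * ·) ∪ (G y).image (ePt n c (-y) * ·), ?_, ?_⟩
    · refine (Finset.card_union_le _ _).trans ?_
      rw [a]
      refine Nat.add_le_add hF (Finset.card_biUnion_le.trans ?_)
      have : ∀ y ∈ I.erase c, ((G y).image (ePt n c y * ·) ∪
          (G y).image (ePt n c (-y) * ·)).card ≤ 2 * a m := by
        intro y hy
        have := (hG y hy).1
        refine (Finset.card_union_le _ _).trans ?_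
        have h1 := Finset.card_image_le (s := G y) (f := (ePt n c y * ·))
        have h2 := Finset.card_image_le (s := G y) (f := (ePt n c (-y) * ·))
        omega
      refine (Finset.sum_le_card_nsmul _ _ _ this).trans (le_of_eq ?_)
      rw [hcard, smul_eq_mul]
      ring
    · intro g hg
      rw [Finset.mem_union]
      rcases hg.extract hpt hc with h | ⟨y, hy, g', hg', rfl⟩
      · exact Or.inl (hF' g h)
      · refine Or.inr (Finset.mem_biUnion.2 ⟨y.natAbs, hy, ?_⟩)
        have hm := (hG _ hy).2 g' hg'
        rw [Finset.mem_union]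
        rcases Int.natAbs_eq y with h | h
        · exact Or.inl (Finset.mem_image.2 ⟨g', hm, by rw [← h]⟩)
        · exact Or.inr (Finset.mem_image.2 ⟨g', hm, by rw [← h]⟩)

theorem pairProd_conj_cups {π : Perm ℤ} (hπ : π ∈ signedPerm 0 n) (q : ℕ) : ∀ p, p + 2 * q ≤ n →
    PairProd n ((Finset.Icc (p + 1) (p + 2 * q)).image fun j : ℕ => (π j).natAbs)
      (conj n π (cups n p q)) := by
  induction q with
  | zero => intro p _; rw [cups_zero, conj_one hπ]; exact .one _
  | succ q ih =>
    intro p hp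
    have hp1 : IsPoint n (p + 1 : ℕ) := isPoint_natCast (by omega) (by omega)
    have hp2 : IsPoint n (p + 2 : ℕ) := isPoint_natCast (by omega) (by omega)
    have hE : e n (p + 1) = ePt n (p + 1 : ℕ) (p + 2 : ℕ) := e_eq_ePt (by omega) (by omega)
    have inj : ∀ j k : ℕ, (π j).natAbs = (π k).natAbs → j = k := by
      intro j k h
      rw [signedPerm_natAbs_eq hπ] at h
      simpa using h
    rw [cups_succ', conj_mul hπ, hE, conj_ePt hπ hp1 hp2 (by omega)]
    refine .cons _ _ _ _ ?_ ?_ ?_ ((ih (p + 2) (by omega)).mono ?_)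
    · exact Finset.mem_image_of_mem (fun j : ℕ => (π j).natAbs)
        (Finset.mem_Icc.2 ⟨by omega, by omega⟩)
    · exact Finset.mem_image_of_mem (fun j : ℕ => (π j).natAbs)
        (Finset.mem_Icc.2 ⟨by omega, by omega⟩)
    · intro h
      have := inj _ _ h
      omega
    · intro j hj
      obtain ⟨k, hk, rfl⟩ := Finset.mem_image.1 hj
      rw [Finset.mem_Icc] at hk
      simp only [Finset.mem_erase]
      refine ⟨fun h => ?_, fun h => ?_, Finset.mem_image_of_mem (fun j : ℕ => (π j).natAbs)
        (Finset.mem_Icc.2 ⟨by omega, by omega⟩)⟩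
      · have := inj _ _ h
        omega
      · have := inj _ _ h
        omega

/-- There are at most `2^d d!` signed permutations of `d` points. -/
theorem exists_finset_signedPerm (lo d : ℕ) : ∃ F : Finset (Perm ℤ),
    F.card ≤ 2 ^ d * d.factorial ∧ ∀ π ∈ signedPerm lo (lo + d), π ∈ F := by
  classical
  induction d with
  | zero =>
    refine ⟨{1}, by simp, fun π hπ => ?_⟩
    have : π = 1 := by ext x; exact hπ.2 x (by omega)
    simp [this]
  | succ d ih =>
    obtain ⟨F, hF, hF'⟩ := ih
    have H : ∀ x : ℤ, ∃ g : Perm ℤ, lo < x.natAbs ∧ x.natAbs ≤ lo + (d + 1) →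
        g ∈ signedPerm lo (lo + (d + 1)) ∧ g (lo + (d + 1) : ℕ) = x := by
      intro x
      by_cases hx : lo < x.natAbs ∧ x.natAbs ≤ lo + (d + 1)
      · obtain ⟨g, h1, h2⟩ := exists_signedPerm_apply (lo := lo) (hi := lo + (d + 1))
          (lo + (d + 1) : ℕ) x (by omega) (by omega) hx.1 hx.2
        exact ⟨g, fun _ => ⟨h1, h2⟩⟩
      · exact ⟨1, fun h => absurd h hx⟩
    choose g hg using H
    set P : Finset ℤ := (Finset.Icc (lo + 1) (lo + (d + 1))).image (fun j : ℕ => (j : ℤ)) ∪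
      (Finset.Icc (lo + 1) (lo + (d + 1))).image (fun j : ℕ => -(j : ℤ)) with hP
    have hPc : P.card ≤ 2 * (d + 1) := by
      refine (Finset.card_union_le _ _).trans ?_
      have h1 := Finset.card_image_le (s := Finset.Icc (lo + 1) (lo + (d + 1)))
        (f := fun j : ℕ => (j : ℤ))
      have h2 := Finset.card_image_le (s := Finset.Icc (lo + 1) (lo + (d + 1)))
        (f := fun j : ℕ => -(j : ℤ))
      rw [Nat.card_Icc] at h1 h2
      omega
    refine ⟨(P ×ˢ F).image fun z => g z.1 * z.2, ?_, fun π hπ => ?_⟩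
    · refine Finset.card_image_le.trans ?_
      rw [Finset.card_product, Nat.factorial_succ, pow_succ]
      calc _ ≤ 2 * (d + 1) * (2 ^ d * d.factorial) := Nat.mul_le_mul hPc hF
        _ = _ := by ring
    · have hb := signedPerm_natAbs hπ (x := (lo + (d + 1) : ℕ)) (by omega) (by omega)
      obtain ⟨h1, h2⟩ := hg _ hb
      have h3 : (g (π (lo + (d + 1) : ℕ)))⁻¹ * π ∈ signedPerm lo (lo + (d + 1)) :=
        mul_mem (inv_mem h1) hπ
      have h5 : ((g (π (lo + (d + 1) : ℕ)))⁻¹ * π) (lo + (d + 1) : ℕ) = (lo + (d + 1) : ℕ) := by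
        rw [Perm.mul_apply, Perm.inv_eq_iff_eq, h2]
      have h4 : (g (π (lo + (d + 1) : ℕ)))⁻¹ * π ∈ signedPerm lo (lo + d) := by
        refine ⟨h3.1, fun x hx => ?_⟩
        by_cases hx' : x.natAbs = lo + (d + 1)
        · rcases Int.natAbs_eq x with h | h
          · rw [h, hx', h5]
          · rw [h, hx', h3.1, h5]
        · exact h3.2 x (by omega)
      refine Finset.mem_image.2 ⟨(π (lo + (d + 1) : ℕ), _), Finset.mem_product.2 ⟨?_, hF' _ h4⟩, ?_⟩
      · rw [hP, Finset.mem_union]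
        rcases Int.natAbs_eq (π (lo + (d + 1) : ℕ)) with h | h
        · exact Or.inl (Finset.mem_image.2 ⟨_, Finset.mem_Icc.2 ⟨by omega, by omega⟩, h.symm⟩)
        · exact Or.inr (Finset.mem_image.2 ⟨_, Finset.mem_Icc.2 ⟨by omega, by omega⟩, h.symm⟩)
      · exact mul_inv_cancel_left _ _

/-- A signed permutation that preserves `±1, …, ±i` is a product of one that moves only these
points and one that fixes them. -/
theorem exists_split {i : ℕ} {ρ : Perm ℤ} (hρ : ρ ∈ signedPerm 0 n) (hi : i ≤ n)
    (h : ∀ x : ℤ, x.natAbs ≤ i → (ρ x).natAbs ≤ i) :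
    ∃ σ ∈ signedPerm 0 i, ∃ τ ∈ signedPerm i n, ρ = σ * τ := by
  have hinv : ∀ x : ℤ, (ρ x).natAbs ≤ i → x.natAbs ≤ i := by
    intro x hx
    have hm : (Finset.Icc (-(i : ℤ)) i).image ρ = Finset.Icc (-(i : ℤ)) i := by
      refine Finset.eq_of_subset_of_card_le (fun y hy => ?_)
        (Finset.card_image_of_injective _ ρ.injective).ge
      obtain ⟨x, hx, rfl⟩ := Finset.mem_image.1 hy
      rw [Finset.mem_Icc] at hx ⊢
      have := h x (by omega)
      omega
    have h2 : ρ x ∈ Finset.Icc (-(i : ℤ)) i := Finset.mem_Icc.2 ⟨by omega, by omega⟩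
    rw [← hm, ρ.injective.mem_finset_image, Finset.mem_Icc] at h2
    omega
  set σ : Perm ℤ := Perm.ofSubtype (ρ.subtypePerm (p := fun x : ℤ => x.natAbs ≤ i)
    fun x => ⟨hinv x, h x⟩) with hσ
  have s1 : ∀ x : ℤ, x.natAbs ≤ i → σ x = ρ x := by
    intro x hx
    exact Perm.ofSubtype_apply_of_mem (p := fun x : ℤ => x.natAbs ≤ i) (a := x) _ hx
  have s2 : ∀ x : ℤ, ¬ x.natAbs ≤ i → σ x = x := fun x hx =>
    Perm.ofSubtype_apply_of_not_mem (p := fun x : ℤ => x.natAbs ≤ i) (a := x) _ hx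
  have hσm : σ ∈ signedPerm 0 i := by
    refine ⟨fun x => ?_, fun x hx => ?_⟩
    · by_cases hx : x.natAbs ≤ i
      · rw [s1 x hx, s1 (-x) (by omega), hρ.1]
      · rw [s2 x hx, s2 (-x) (by omega)]
    · by_cases hx0 : x.natAbs ≤ i
      · obtain rfl : x = 0 := by omega
        rw [s1 0 hx0, signedPerm_zero hρ]
      · exact s2 x hx0
  have hτ : σ⁻¹ * ρ ∈ signedPerm 0 n := mul_mem (inv_mem (signedPerm_mono le_rfl hi hσm)) hρ
  refine ⟨σ, hσm, σ⁻¹ * ρ, ⟨hτ.1, fun x hx => ?_⟩, by simp⟩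
  rcases hx with hx | hx
  · rw [Perm.mul_apply, Perm.inv_eq_iff_eq, s1 x hx]
  · exact hτ.2 x (Or.inr hx)

/-- Up to powers of `δ` and the right action of the pointwise stabilizer of `1, …, i` there are at
most `C(n, i) a_i` upper half diagrams with `i` cups. -/
theorem exists_finset_halves {i : ℕ} (hi : i ≤ n) : ∃ S : Finset (Br n),
    S.card ≤ n.choose i * a i ∧ ∀ s ∈ halves n i, ∃ k : ℤ, ∃ g ∈ S, ∃ τ ∈ signedPerm i n,
      s = (delta ^ k : (ℤ[T;T⁻¹])ˣ) • (g * ofPerm n τ) := by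
  classical
  obtain ⟨F, hF, hF'⟩ := exists_finset_pairProd (n := n) i (Finset.Icc 1 i) (by simp)
    (fun j hj => by rw [Finset.mem_Icc] at hj; exact isPoint_natCast (by omega) (by omega))
  -- a signed permutation for each possible set of cup positions
  have H : ∀ J : Finset ℕ, ∃ c ∈ signedPerm 0 n,
      (∃ π ∈ signedPerm 0 n, (Finset.Icc 1 i).image (fun j : ℕ => (π j).natAbs) = J) →
      (Finset.Icc 1 i).image (fun j : ℕ => (c j).natAbs) = J := by
    intro J
    by_cases h : ∃ π ∈ signedPerm 0 n, (Finset.Icc 1 i).image (fun j : ℕ => (π j).natAbs) = J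
    · obtain ⟨π, hπ, h'⟩ := h
      exact ⟨π, hπ, fun _ => h'⟩
    · exact ⟨1, one_mem _, fun h' => absurd h' h⟩
  choose c hc hc' using H
  refine ⟨((Finset.Icc 1 n).powersetCard i ×ˢ F).image fun z => ofPerm n (c z.1) * z.2 * b n i,
    ?_, ?_⟩
  · refine Finset.card_image_le.trans ?_
    rw [Finset.card_product, Finset.card_powersetCard, Nat.card_Icc, Nat.add_sub_cancel]
    exact Nat.mul_le_mul_left _ hF
  · rintro s ⟨k, π, p, q, hπ, hpq, rfl⟩
    set J := (Finset.Icc 1 i).image (fun j : ℕ => (π j).natAbs) with hJ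
    have hcJ := hc' J ⟨π, hπ, rfl⟩
    have inj : ∀ j k : ℕ, (π j).natAbs = (π k).natAbs → j = k := by
      intro j k h
      rw [signedPerm_natAbs_eq hπ] at h
      simpa using h
    have hJm : J ∈ (Finset.Icc 1 n).powersetCard i := by
      rw [Finset.mem_powersetCard]
      refine ⟨fun m hm => ?_, ?_⟩
      · obtain ⟨j, hj, rfl⟩ := Finset.mem_image.1 hm
        rw [Finset.mem_Icc] at hj
        have := signedPerm_natAbs hπ (x := (j : ℤ)) (by omega) (by omega)
        exact Finset.mem_Icc.2 this
      · rw [hJ, Finset.card_image_of_injective _ fun j k h => inj j k h, Nat.card_Icc,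
          Nat.add_sub_cancel]
    obtain ⟨σ, hσ, τ, hτ, hst⟩ := exists_split (i := i) (mul_mem (inv_mem (hc J)) hπ) hi (by
      intro x hx
      obtain hx0 | hx0 := Nat.eq_zero_or_pos x.natAbs
      · rw [show x = 0 by omega, signedPerm_zero (mul_mem (inv_mem (hc J)) hπ)]; simp
      have h1 : (π x.natAbs).natAbs ∈ J :=
        Finset.mem_image_of_mem (fun j : ℕ => (π j).natAbs) (Finset.mem_Icc.2 ⟨hx0, hx⟩)
      rw [← hcJ] at h1
      obtain ⟨j, hj, hj'⟩ := Finset.mem_image.1 h1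
      rw [Finset.mem_Icc] at hj
      have h2 : (π x).natAbs = (c J j).natAbs := by
        rw [hj', signedPerm_natAbs_eq hπ]; omega
      have h3 : ((c J)⁻¹ (π x)).natAbs = ((c J)⁻¹ (c J j)).natAbs :=
        (signedPerm_natAbs_eq (inv_mem (hc J))).2 h2
      rw [Perm.mul_apply, h3]
      simp
      omega)
    have hσ' := signedPerm_mono le_rfl hi hσ
    have hτ' := signedPerm_mono (Nat.zero_le i) le_rfl hτ
    have hπe : π = c J * σ * τ := by rw [mul_assoc, ← hst, mul_inv_cancel_left]
    refine ⟨k, _, Finset.mem_image.2 ⟨(J, conj n σ (cups n p q)), Finset.mem_product.2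
      ⟨hJm, hF' _ ?_⟩, rfl⟩, τ, hτ, ?_⟩
    · refine (pairProd_conj_cups hσ' q p (by omega)).mono fun m hm => ?_
      obtain ⟨j, hj, rfl⟩ := Finset.mem_image.1 hm
      rw [Finset.mem_Icc] at hj
      have := signedPerm_natAbs hσ (x := (j : ℤ)) (by omega) (by omega)
      exact Finset.mem_Icc.2 this
    · congr 1
      have hcu : Commute (ofPerm n τ) (half n p q) :=
        (cups_commute_of_fix (by omega) (by rwa [hpq])).mul_right
          (commute_b_of_fix (by omega) (by rwa [hpq]))
      rw [hπe, ofPerm_mul (mul_mem (hc J) hσ') hτ', ofPerm_mul (hc J) hσ', mul_assoc _ _ (half n p q),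
        hcu.eq]
      calc _ = ofPerm n (c J) * (ofPerm n σ * cups n p q) * b n i * ofPerm n τ := by
            rw [half, hpq]; simp only [mul_assoc]
        _ = ofPerm n (c J) * conj n σ (cups n p q) * (ofPerm n σ * b n i) * ofPerm n τ := by
            rw [ofPerm_mul_eq hσ']; simp only [mul_assoc]
        _ = _ := by rw [ofPerm_mul_b hi σ hσ]

theorem exists_finset_monomials (n : ℕ) : ∃ S : Finset (Br n), S.card ≤ a (2 * n) ∧
    ∀ x ∈ BrM n, ∃ k : ℤ, ∃ g ∈ S, x = (delta ^ k : (ℤ[T;T⁻¹])ˣ) • g := by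
  classical
  have H : ∀ i : ℕ, ∃ S : Finset (Br n), i ≤ n → S.card ≤ n.choose i * a i ∧
      ∀ s ∈ halves n i, ∃ k : ℤ, ∃ g ∈ S, ∃ τ ∈ signedPerm i n,
        s = (delta ^ k : (ℤ[T;T⁻¹])ˣ) • (g * ofPerm n τ) := by
    intro i
    by_cases hi : i ≤ n
    · obtain ⟨S, hS⟩ := exists_finset_halves hi
      exact ⟨S, fun _ => hS⟩
    · exact ⟨∅, fun h => absurd h hi⟩
  choose S hS using H
  choose F hF hF' using fun i => exists_finset_signedPerm i (n - i)
  refine ⟨(Finset.range (n + 1)).biUnion fun i => ((S i ×ˢ F i) ×ˢ S i).image fun z =>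
    z.1.1 * ofPerm n z.1.2 * opp z.2, ?_, ?_⟩
  · rw [← sum_card_eq]
    refine Finset.card_biUnion_le.trans (Finset.sum_le_sum fun i hi => ?_)
    have hi' : i ≤ n := by simpa [Nat.lt_succ_iff] using hi
    refine Finset.card_image_le.trans ?_
    rw [Finset.card_product, Finset.card_product]
    exact Nat.mul_le_mul (Nat.mul_le_mul (hS i hi').1 (hF i)) (hS i hi').1
  · intro x hx
    obtain ⟨i, hi, k, s, hs, s', hs', rfl⟩ := exists_halves hx
    obtain ⟨k₁, g, hg, τ, hτ, rfl⟩ := (hS i hi).2 s hs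
    obtain ⟨k₂, g', hg', τ', hτ', rfl⟩ := (hS i hi).2 s' hs'
    have hle : signedPerm i n ≤ signedPerm 0 n := signedPerm_mono (Nat.zero_le i) le_rfl
    refine ⟨k + k₁ + k₂, g * ofPerm n (τ * τ'⁻¹) * opp g', Finset.mem_biUnion.2
      ⟨i, Finset.mem_range.2 (by omega), Finset.mem_image.2 ⟨((g, τ * τ'⁻¹), g'),
      Finset.mem_product.2 ⟨Finset.mem_product.2 ⟨hg, hF' i _ ?_⟩, hg'⟩, rfl⟩⟩, ?_⟩
    · rw [show i + (n - i) = n by omega]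
      exact mul_mem hτ (inv_mem hτ')
    · rw [opp_units_smul, smul_mul_smul_comm, smul_smul, opp_mul, opp_ofPerm (hle hτ'),
        ofPerm_mul (hle hτ) (inv_mem (hle hτ'))]
      simp only [zpow_add, mul_assoc]

theorem span_BrM (n : ℕ) : Submodule.span ℤ[T;T⁻¹] (BrM n : Set (Br n)) = ⊤ := by
  have h1 : Algebra.adjoin ℤ[T;T⁻¹] (Set.range (gen (n := n) delta)) = ⊤ := by
    have h2 := congrArg (Subalgebra.map (RingQuot.mkAlgHom ℤ[T;T⁻¹] (Rel n ℤ[T;T⁻¹] delta)))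
      (FreeAlgebra.adjoin_range_ι (R := ℤ[T;T⁻¹]) (X := Gen n))
    rw [AlgHom.map_adjoin, ← Set.range_comp, Algebra.map_top,
      (AlgHom.range_eq_top _).2 (RingQuot.mkAlgHom_surjective _ _)] at h2
    exact h2
  have h3 := congrArg Subalgebra.toSubmodule h1
  rw [Algebra.adjoin_eq_span, Algebra.top_toSubmodule] at h3
  rw [eq_top_iff, ← h3]
  exact Submodule.span_mono (Submonoid.closure_mono Set.subset_union_right)

theorem rank_le (n : ℕ) : Module.rank ℤ[T;T⁻¹] (Br n) ≤ (a (2 * n) : Cardinal) := by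
  obtain ⟨S, hS, hS'⟩ := exists_finset_monomials n
  have h : Submodule.span ℤ[T;T⁻¹] (S : Set (Br n)) = ⊤ := by
    rw [eq_top_iff, ← span_BrM n, Submodule.span_le]
    intro x hx
    obtain ⟨k, g, hg, rfl⟩ := hS' x hx
    exact Submodule.smul_mem _ _ (Submodule.subset_span hg)
  rw [← rank_top, ← h]
  exact (rank_span_finset_le S).trans (by exact_mod_cast hS)

/-! ### A tensor representation with loop parameter `2` -/

/-- The specialization `δ = 2`. -/
noncomputable def evalTwo : ℤ[T;T⁻¹] →+* ℚ :=
  LaurentPolynomial.eval₂ (Int.castRingHom ℚ) (Units.mk0 2 two_ne_zero)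

/-- `ℚ` as a module over `ℤ[δ, δ⁻¹]` on which `δ` acts as `2`. -/
noncomputable instance : Module ℤ[T;T⁻¹] ℚ := Module.compHom ℚ evalTwo

theorem smul_rat (c : ℤ[T;T⁻¹]) (x : ℚ) : c • x = evalTwo c * x := rfl

theorem evalTwo_dl : evalTwo dl = 2 := by
  simp [evalTwo, dl, delta]

/-- The four basis vectors of a tensor factor. -/
abbrev Color : Type := Bool × Bool

/-- Tensors on infinitely many factors, as functions of the colorings of `ℕ`. -/
abbrev Tensor : Type := (ℕ → Color) → ℚ

/-- Permutation of the tensor factors. -/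
def permOp (π : Perm ℕ) : Module.End ℤ[T;T⁻¹] Tensor where
  toFun F s := F (s ∘ π)
  map_add' _ _ := rfl
  map_smul' _ _ := rfl

/-- The matrix `M`, acting on the tensor factor `i`. -/
noncomputable def locOp (i : ℕ) (M : Matrix Color Color ℚ) : Module.End ℤ[T;T⁻¹] Tensor where
  toFun F s := ∑ x, M (s i) x * F (Function.update s i x)
  map_add' F G := by ext s; simp [mul_add, Finset.sum_add_distrib]
  map_smul' c F := by
    ext s
    simp only [Pi.smul_apply, smul_rat, RingHom.id_apply, Finset.mul_sum]
    exact Finset.sum_congr rfl fun x _ => by ring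

/-- Contraction of the tensor factors `i` and `j`, followed by insertion of the invariant tensor. -/
noncomputable def cupOp (i j : ℕ) : Module.End ℤ[T;T⁻¹] Tensor where
  toFun F s := if s i = s j then ∑ x, F (Function.update (Function.update s i x) j x) else 0
  map_add' F G := by ext s; by_cases h : s i = s j <;> simp [h, Finset.sum_add_distrib]
  map_smul' c F := by
    ext s
    by_cases h : s i = s j <;> simp [h, Finset.smul_sum]

theorem permOp_apply (π : Perm ℕ) (F : Tensor) (s) : permOp π F s = F (s ∘ π) := rfl

theorem locOp_apply (i : ℕ) (M : Matrix Color Color ℚ) (F : Tensor) (s) :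
    locOp i M F s = ∑ x, M (s i) x * F (Function.update s i x) := rfl

theorem cupOp_apply (i j : ℕ) (F : Tensor) (s) : cupOp i j F s =
    if s i = s j then ∑ x, F (Function.update (Function.update s i x) j x) else 0 := rfl

theorem permOp_mul (π ρ : Perm ℕ) : permOp (π * ρ) = permOp π * permOp ρ := rfl

theorem permOp_one : permOp 1 = 1 := rfl

theorem permOp_mul_locOp (π : Perm ℕ) (i : ℕ) (M : Matrix Color Color ℚ) :
    permOp π * locOp i M = locOp (π i) M * permOp π := by
  ext F s
  simp [Module.End.mul_apply, permOp_apply, locOp_apply, Function.update_comp_equiv]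

theorem permOp_mul_cupOp (π : Perm ℕ) (i j : ℕ) :
    permOp π * cupOp i j = cupOp (π i) (π j) * permOp π := by
  ext F s
  simp [Module.End.mul_apply, permOp_apply, cupOp_apply, Function.update_comp_equiv]

theorem locOp_mul (i : ℕ) (M N : Matrix Color Color ℚ) :
    locOp i M * locOp i N = locOp i (M * N) := by
  ext F s
  simp only [Module.End.mul_apply, locOp_apply, Matrix.mul_apply, Finset.sum_mul,
    Function.update_idem, Function.update_self, Finset.mul_sum]
  rw [Finset.sum_comm]
  exact Finset.sum_congr rfl fun x _ => Finset.sum_congr rfl fun y _ => by ring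

theorem locOp_one (i : ℕ) : locOp i 1 = 1 := by
  ext F s
  simp [locOp_apply, Matrix.one_apply]

theorem locOp_smul (i : ℕ) (c : ℤ[T;T⁻¹]) (M : Matrix Color Color ℚ) :
    locOp i (evalTwo c • M) = c • locOp i M := by
  ext F s
  simp [locOp_apply, smul_rat, Finset.mul_sum, mul_assoc]

theorem locOp_commute {i j : ℕ} (h : i ≠ j) (M N : Matrix Color Color ℚ) :
    Commute (locOp i M) (locOp j N) := by
  ext F s
  simp only [Module.End.mul_apply, locOp_apply, Finset.mul_sum, Function.update_of_ne h,
    Function.update_of_ne h.symm]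
  rw [Finset.sum_comm]
  refine Finset.sum_congr rfl fun x _ => Finset.sum_congr rfl fun y _ => ?_
  rw [Function.update_comm h]
  ring

theorem locOp_commute_cupOp {i j k : ℕ} (hj : i ≠ j) (hk : i ≠ k) (M : Matrix Color Color ℚ) :
    Commute (locOp i M) (cupOp j k) := by
  ext F s
  by_cases h : s j = s k
  · simp only [Module.End.mul_apply, locOp_apply, cupOp_apply, Finset.mul_sum,
      Function.update_of_ne hj, Function.update_of_ne hk, Function.update_of_ne hj.symm,
      Function.update_of_ne hk.symm, h, if_true]
    rw [Finset.sum_comm]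
    refine Finset.sum_congr rfl fun x _ => Finset.sum_congr rfl fun y _ => ?_
    rw [Function.update_comm hj, Function.update_comm hk]
  · simp [Module.End.mul_apply, locOp_apply, cupOp_apply, Function.update_of_ne hj.symm,
      Function.update_of_ne hk.symm, h]

theorem cupOp_commute {i j k l : ℕ} (hik : i ≠ k) (hil : i ≠ l) (hjk : j ≠ k) (hjl : j ≠ l) :
    Commute (cupOp i j) (cupOp k l) := by
  ext F s
  simp only [Module.End.mul_apply, cupOp_apply, Function.update_of_ne hik, Function.update_of_ne hil,
    Function.update_of_ne hjk, Function.update_of_ne hjl, Function.update_of_ne hik.symm,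
    Function.update_of_ne hil.symm, Function.update_of_ne hjk.symm, Function.update_of_ne hjl.symm]
  by_cases h : s i = s j
  · by_cases h' : s k = s l
    · simp only [h, h', if_true]
      rw [Finset.sum_comm]
      refine Finset.sum_congr rfl fun x _ => Finset.sum_congr rfl fun y _ => ?_
      rw [Function.update_comm hjk, Function.update_comm hjl, Function.update_comm hik,
        Function.update_comm hil]
    · simp [h, h']
  · simp [h]

theorem cupOp_comm (i j : ℕ) : cupOp i j = cupOp j i := by
  rcases eq_or_ne i j with rfl | h
  · rfl
  ext F s
  simp only [cupOp_apply, eq_comm (a := s i), Function.update_comm h]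

theorem permOp_swap_mul_cupOp (i j : ℕ) : permOp (swap i j) * cupOp i j = cupOp i j := by
  rcases eq_or_ne i j with rfl | h
  · rw [swap_self]; rfl
  ext F s
  simp only [Module.End.mul_apply, permOp_apply, cupOp_apply, Function.comp_apply, swap_apply_left,
    swap_apply_right, eq_comm (a := s j)]
  refine if_congr Iff.rfl (Finset.sum_congr rfl fun x _ => congrArg F (funext fun k => ?_)) rfl
  by_cases hj : k = j
  · simp [hj]
  by_cases hi : k = i
  · simp [hi, Function.update_of_ne h]
  simp [hi, hj, swap_apply_of_ne_of_ne]

theorem cupOp_mul_permOp_swap (i j : ℕ) : cupOp i j * permOp (swap i j) = cupOp i j := by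
  conv_rhs => rw [← permOp_swap_mul_cupOp, permOp_mul_cupOp, swap_apply_left, swap_apply_right,
    cupOp_comm]

/-- A closed loop labelled by a matrix contributes its trace. -/
theorem cupOp_mul_locOp_mul_cupOp {i j : ℕ} (h : i ≠ j) (M : Matrix Color Color ℚ)
    {c : ℤ[T;T⁻¹]} (hc : M.trace = evalTwo c) :
    cupOp i j * locOp i M * cupOp i j = c • cupOp i j := by
  ext F s
  simp only [LinearMap.smul_apply, Pi.smul_apply, smul_rat, ← hc, Matrix.trace, Matrix.diag]
  by_cases hs : s i = s j
  · simp only [Module.End.mul_apply, locOp_apply, cupOp_apply, Function.update_of_ne h, hs,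
      Function.update_comm h.symm, Function.update_self, Function.update_idem, if_true,
      mul_ite, mul_zero, Finset.sum_mul]
    exact Finset.sum_congr rfl fun x _ => by simp
  · simp [Module.End.mul_apply, cupOp_apply, hs]

theorem cupOp_mul_cupOp {i j k : ℕ} (hij : i ≠ j) (hik : i ≠ k) (hjk : j ≠ k) :
    cupOp i j * cupOp j k = permOp (swap i k) * cupOp j k := by
  ext F s
  simp only [Module.End.mul_apply, permOp_apply, cupOp_apply, Function.comp_apply, swap_apply_right,
    swap_apply_of_ne_of_ne hij.symm hjk, Function.update_self, Function.update_of_ne hjk.symm,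
    Function.update_of_ne hik.symm, eq_comm (a := s j)]
  refine if_congr Iff.rfl ?_ rfl
  rw [Finset.sum_ite_eq' Finset.univ (s k)]
  simp only [Finset.mem_univ, if_true]
  refine Finset.sum_congr rfl fun x _ => congrArg F (funext fun l => ?_)
  by_cases hk : l = k
  · simp [hk]
  by_cases hj : l = j
  · simp [hj, Function.update_of_ne hjk]
  by_cases hi : l = i
  · subst hi; simp [hj, hk]
  simp [hi, hj, hk, swap_apply_of_ne_of_ne]

theorem locOp_mul_cupOp {i j : ℕ} (h : i ≠ j) {M : Matrix Color Color ℚ} (hM : M.IsSymm) :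
    locOp i M * cupOp i j = locOp j M * cupOp i j := by
  ext F s
  simp [Module.End.mul_apply, locOp_apply, cupOp_apply, Function.update_of_ne h,
    Function.update_of_ne h.symm, Function.update_comm h.symm, hM.apply (s i) (s j)]

theorem cupOp_mul_locOp {i j : ℕ} (h : i ≠ j) {M : Matrix Color Color ℚ} (hM : M.IsSymm) :
    cupOp i j * locOp i M = cupOp i j * locOp j M := by
  ext F s
  simp only [Module.End.mul_apply, locOp_apply, cupOp_apply, Function.update_of_ne h,
    Function.update_self, Function.update_comm h.symm, Function.update_idem]
  refine if_congr Iff.rfl ?_ rfl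
  rw [Finset.sum_comm]
  refine Finset.sum_congr rfl fun x _ => Finset.sum_congr rfl fun y _ => ?_
  rw [hM.apply x y, Function.update_comm h]

/-- The matrix of the involution that exchanges the two components of a color. -/
def swapMatrix : Matrix Color Color ℚ := fun x y => if x.swap = y then 1 else 0

/-- The vector that is the sum of the colors with equal components. -/
def diagVec : Color → ℚ := fun x => if x.1 = x.2 then 1 else 0

/-- The rank one matrix `v vᵀ`, where `v` is the sum of the colors with equal components. -/
def diagMatrix : Matrix Color Color ℚ := fun x y => diagVec x * diagVec y

theorem locOp_mul_cupOp_mul_locOp {i j : ℕ} (h : i ≠ j) :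
    locOp i diagMatrix * cupOp i j * locOp i diagMatrix =
      locOp j diagMatrix * locOp i diagMatrix := by
  ext F s
  simp only [Module.End.mul_apply, locOp_apply, cupOp_apply, Function.update_of_ne h,
    Function.update_of_ne h.symm,
    Function.update_self, Function.update_comm h.symm, Function.update_idem, diagMatrix]
  simp only [mul_ite, mul_zero, Finset.sum_ite_eq', Finset.mem_univ, if_true, Finset.mul_sum]
  refine Finset.sum_congr rfl fun x _ => Finset.sum_congr rfl fun y _ => ?_
  rw [Function.update_comm h]
  ring

theorem swapMatrix_isSymm : swapMatrix.IsSymm := by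
  ext x y
  simp only [swapMatrix, Matrix.transpose_apply]
  congr 1
  grind

theorem diagMatrix_isSymm : diagMatrix.IsSymm := by
  ext x y
  simp [diagMatrix, mul_comm]

theorem swapMatrix_mul_self : swapMatrix * swapMatrix = 1 := by
  ext x y
  simp only [swapMatrix, Matrix.mul_apply, ite_mul, one_mul, zero_mul, Finset.sum_ite_eq,
    Finset.mem_univ, if_true, Prod.swap_swap, Matrix.one_apply]

theorem swapMatrix_mul_diagMatrix : swapMatrix * diagMatrix = diagMatrix := by
  ext x y
  simp only [swapMatrix, Matrix.mul_apply, ite_mul, one_mul, zero_mul, Finset.sum_ite_eq,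
    Finset.mem_univ, if_true, diagMatrix, diagVec, Prod.fst_swap, Prod.snd_swap,
    eq_comm (a := x.2)]

theorem diagMatrix_mul_swapMatrix : diagMatrix * swapMatrix = diagMatrix := by
  rw [← diagMatrix_isSymm.eq, ← swapMatrix_isSymm.eq, ← Matrix.transpose_mul,
    swapMatrix_mul_diagMatrix]

theorem diagMatrix_mul_self : diagMatrix * diagMatrix = (2 : ℚ) • diagMatrix := by
  ext x y
  simp [Matrix.mul_apply, diagMatrix, diagVec, Fintype.sum_prod_type]

theorem swapMatrix_trace : swapMatrix.trace = 2 := by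
  rw [Matrix.trace, Fintype.sum_prod_type]
  simp only [Matrix.diag, Fintype.sum_bool]
  norm_num [swapMatrix]

theorem diagMatrix_trace : diagMatrix.trace = 2 := by
  simp [Matrix.trace, diagMatrix, diagVec, Fintype.sum_prod_type]

/-- The operators that represent the generators: the type `A` Brauer algebra with loop parameter
`4`, the number of colors, acts by permutations and cups, and `r_0` and `e_0` act on the first
factor by matrices of trace `2`. -/
noncomputable def genOp : Gen n → Module.End ℤ[T;T⁻¹] Tensor
  | .r i => if (i : ℕ) = 0 then locOp 0 swapMatrix else permOp (swap ((i : ℕ) - 1) i)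
  | .e i => if (i : ℕ) = 0 then locOp 0 diagMatrix else cupOp ((i : ℕ) - 1) i

theorem genOp_r_pos {i : Fin n} {k : ℕ} (h : (i : ℕ) = k + 1) :
    genOp (.r i) = permOp (swap k (k + 1)) := by simp [genOp, h]

theorem genOp_e_pos {i : Fin n} {k : ℕ} (h : (i : ℕ) = k + 1) :
    genOp (.e i) = cupOp k (k + 1) := by simp [genOp, h]

theorem genOp_r_zero {i : Fin n} (h : (i : ℕ) = 0) :
    genOp (.r i) = locOp 0 swapMatrix := by simp [genOp, h]

theorem genOp_e_zero {i : Fin n} (h : (i : ℕ) = 0) :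
    genOp (.e i) = locOp 0 diagMatrix := by simp [genOp, h]

theorem permOp_swap_mul_self (i j : ℕ) : permOp (swap i j) * permOp (swap i j) = 1 := by
  rw [← permOp_mul, swap_mul_self, permOp_one]

theorem permOp_commute_locOp {π : Perm ℕ} {i : ℕ} (h : π i = i) (M : Matrix Color Color ℚ) :
    Commute (permOp π) (locOp i M) := by
  rw [Commute, SemiconjBy, permOp_mul_locOp, h]

theorem permOp_commute_cupOp {π : Perm ℕ} {i j : ℕ} (hi : π i = i) (hj : π j = j) :
    Commute (permOp π) (cupOp i j) := by
  rw [Commute, SemiconjBy, permOp_mul_cupOp, hi, hj]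

theorem genOp_cases (i : Fin n) : (i : ℕ) = 0 ∨ ∃ k, (i : ℕ) = k + 1 := by
  cases h : (i : ℕ) <;> simp

theorem genOp_rel ⦃x y : FreeAlgebra ℤ[T;T⁻¹] (Gen n)⦄ (h : Rel n ℤ[T;T⁻¹] delta x y) :
    FreeAlgebra.lift ℤ[T;T⁻¹] genOp x = FreeAlgebra.lift ℤ[T;T⁻¹] genOp y := by
  have h01 : (0 : ℕ) ≠ 1 := zero_ne_one
  have hconj : ∀ M, permOp (swap 0 1) * locOp 0 M * permOp (swap 0 1) = locOp 1 M := fun M => by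
    rw [permOp_mul_locOp, mul_assoc, permOp_swap_mul_self, swap_apply_left, mul_one]
  have hcomm : ∀ M N, Commute (locOp 0 M) (locOp 1 N) := fun M N => locOp_commute h01 M N
  have habs : ∀ {M : Matrix Color Color ℚ}, M.IsSymm →
      cupOp 0 1 * locOp 0 M * permOp (swap 0 1) = cupOp 0 1 * locOp 0 M := fun {M} hM => by
    have := permOp_mul_locOp (swap 0 1) 1 M
    rw [swap_apply_right] at this
    rw [mul_assoc, ← this, ← mul_assoc, cupOp_mul_permOp_swap, ← cupOp_mul_locOp h01 hM]
  cases h <;> simp only [fr, fe, map_mul, map_one, map_smul, FreeAlgebra.lift_ι_apply]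
  case r_sq i =>
    rcases genOp_cases i with h | ⟨k, h⟩
    · rw [genOp_r_zero h, locOp_mul, swapMatrix_mul_self, locOp_one]
    · rw [genOp_r_pos h, permOp_swap_mul_self]
  case r_e i =>
    rcases genOp_cases i with h | ⟨k, h⟩
    · rw [genOp_r_zero h, genOp_e_zero h, locOp_mul, swapMatrix_mul_diagMatrix]
    · rw [genOp_r_pos h, genOp_e_pos h, permOp_swap_mul_cupOp]
  case e_r i =>
    rcases genOp_cases i with h | ⟨k, h⟩
    · rw [genOp_r_zero h, genOp_e_zero h, locOp_mul, diagMatrix_mul_swapMatrix]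
    · rw [genOp_r_pos h, genOp_e_pos h, cupOp_mul_permOp_swap]
  case e_sq i hi =>
    obtain ⟨k, h⟩ : ∃ k, (i : ℕ) = k + 1 := ⟨i - 1, by omega⟩
    rw [genOp_e_pos h]
    have := cupOp_mul_locOp_mul_cupOp (show k ≠ k + 1 by omega) 1 (c := dl ^ 2) (by
      rw [Matrix.trace_one, map_pow, evalTwo_dl]; simp [Color]; norm_num)
    rwa [locOp_one, mul_one] at this
  case e_sq_zero i hi =>
    rw [genOp_e_zero hi, locOp_mul, diagMatrix_mul_self, ← locOp_smul, evalTwo_dl]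
  case rr_comm i j hij =>
    simp only [Adj] at hij
    rcases genOp_cases i with hi | ⟨k, hi⟩ <;> rcases genOp_cases j with hj | ⟨l, hj⟩
    · rw [genOp_r_zero hi, genOp_r_zero hj]
    · rw [genOp_r_zero hi, genOp_r_pos hj]
      exact (permOp_commute_locOp (swap_apply_of_ne_of_ne (by omega) (by omega)) _).symm.eq
    · rw [genOp_r_zero hj, genOp_r_pos hi]
      exact (permOp_commute_locOp (swap_apply_of_ne_of_ne (by omega) (by omega)) _).eq
    · rcases eq_or_ne k l with rfl | hkl
      · rw [genOp_r_pos hi, genOp_r_pos hj]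
      rw [genOp_r_pos hi, genOp_r_pos hj, ← permOp_mul, ← permOp_mul]
      congr 1
      rw [mul_swap_eq_swap_mul, swap_apply_of_ne_of_ne (by omega) (by omega),
        swap_apply_of_ne_of_ne (by omega) (by omega)]
  case er_comm i j hij =>
    simp only [Adj] at hij
    rcases genOp_cases i with hi | ⟨k, hi⟩ <;> rcases genOp_cases j with hj | ⟨l, hj⟩
    · rw [genOp_e_zero hi, genOp_r_zero hj, locOp_mul, locOp_mul, diagMatrix_mul_swapMatrix,
        swapMatrix_mul_diagMatrix]
    · rw [genOp_e_zero hi, genOp_r_pos hj]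
      exact (permOp_commute_locOp (swap_apply_of_ne_of_ne (by omega) (by omega)) _).symm.eq
    · rw [genOp_r_zero hj, genOp_e_pos hi]
      exact (locOp_commute_cupOp (by omega) (by omega) _).symm.eq
    · rw [genOp_e_pos hi, genOp_r_pos hj]
      rcases eq_or_ne k l with rfl | hkl
      · rw [permOp_swap_mul_cupOp, cupOp_mul_permOp_swap]
      exact (permOp_commute_cupOp (swap_apply_of_ne_of_ne (by omega) (by omega))
        (swap_apply_of_ne_of_ne (by omega) (by omega))).symm.eq
  case ee_comm i j hij =>
    simp only [Adj] at hij
    rcases genOp_cases i with hi | ⟨k, hi⟩ <;> rcases genOp_cases j with hj | ⟨l, hj⟩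
    · rw [genOp_e_zero hi, genOp_e_zero hj]
    · rw [genOp_e_zero hi, genOp_e_pos hj]
      exact (locOp_commute_cupOp (by omega) (by omega) _).eq
    · rw [genOp_e_zero hj, genOp_e_pos hi]
      exact (locOp_commute_cupOp (by omega) (by omega) _).symm.eq
    · rw [genOp_e_pos hi, genOp_e_pos hj]
      rcases eq_or_ne k l with rfl | hkl
      · rfl
      exact (cupOp_commute (by omega) (by omega) (by omega) (by omega)).eq
  case rrr i j hij hi hj =>
    obtain ⟨k, hi⟩ : ∃ k, (i : ℕ) = k + 1 := ⟨i - 1, by omega⟩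
    obtain ⟨l, hj⟩ : ∃ k, (j : ℕ) = k + 1 := ⟨j - 1, by omega⟩
    simp only [genOp_r_pos hi, genOp_r_pos hj, ← permOp_mul]
    congr 1
    have key : ∀ k : ℕ, swap k (k + 1) * swap (k + 1) (k + 1 + 1) * swap k (k + 1) =
        swap (k + 1) (k + 1 + 1) * swap k (k + 1) * swap (k + 1) (k + 1 + 1) := fun k => by
      rw [swap_mul_swap_mul_swap (by omega) (by omega), swap_comm k (k + 1),
        swap_comm (k + 1) (k + 1 + 1), swap_mul_swap_mul_swap (by omega) (by omega), swap_comm]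
    rcases hij with h | h
    · obtain rfl : l = k + 1 := by omega
      exact key k
    · obtain rfl : k = l + 1 := by omega
      exact (key l).symm
  case rre i j hij hi hj =>
    obtain ⟨k, hi⟩ : ∃ k, (i : ℕ) = k + 1 := ⟨i - 1, by omega⟩
    obtain ⟨l, hj⟩ : ∃ k, (j : ℕ) = k + 1 := ⟨j - 1, by omega⟩
    simp only [genOp_r_pos hi, genOp_r_pos hj, genOp_e_pos hi, genOp_e_pos hj]
    have key : ∀ a b c : ℕ, a ≠ b → a ≠ c → b ≠ c → permOp (swap b c) * permOp (swap a b) *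
        cupOp b c = cupOp a b * cupOp b c := fun a b c hab hac hbc => by
      rw [cupOp_mul_cupOp hab hac hbc]
      nth_rewrite 1 [← permOp_swap_mul_cupOp b c]
      rw [← mul_assoc, ← permOp_mul, ← permOp_mul]
      congr 2
      rw [swap_mul_swap_mul_swap (by omega) (by omega), swap_comm]
    rcases hij with h | h
    · obtain rfl : l = k + 1 := by omega
      exact key _ _ _ (by omega) (by omega) (by omega)
    · obtain rfl : k = l + 1 := by omega
      have := key (l + 1 + 1) (l + 1) l (by omega) (by omega) (by omega)
      rwa [swap_comm (l + 1) l, swap_comm (l + 1 + 1), cupOp_comm (l + 1) l,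
        cupOp_comm (l + 1 + 1)] at this
  case rer i j hij hi hj =>
    obtain ⟨k, hi⟩ : ∃ k, (i : ℕ) = k + 1 := ⟨i - 1, by omega⟩
    obtain ⟨l, hj⟩ : ∃ k, (j : ℕ) = k + 1 := ⟨j - 1, by omega⟩
    simp only [genOp_r_pos hi, genOp_r_pos hj, genOp_e_pos hi, genOp_e_pos hj]
    have key : ∀ k : ℕ, permOp (swap k (k + 1)) * cupOp (k + 1) (k + 1 + 1) *
        permOp (swap k (k + 1)) = permOp (swap (k + 1) (k + 1 + 1)) * cupOp k (k + 1) *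
        permOp (swap (k + 1) (k + 1 + 1)) := fun k => by
      rw [permOp_mul_cupOp, mul_assoc, permOp_swap_mul_self, permOp_mul_cupOp, mul_assoc,
        permOp_swap_mul_self, swap_apply_right, swap_apply_left,
        swap_apply_of_ne_of_ne (by omega) (by omega), swap_apply_of_ne_of_ne (by omega) (by omega)]
    rcases hij with h | h
    · obtain rfl : l = k + 1 := by omega
      exact key k
    · obtain rfl : k = l + 1 := by omega
      exact (key l).symm
  all_goals
    rename_i l o hl ho
    simp only [genOp_r_pos (k := 0) hl, genOp_e_pos (k := 0) hl, genOp_r_zero ho, genOp_e_zero ho,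
      zero_add]
  case lolo => rw [hconj, mul_assoc, mul_assoc, ← mul_assoc (permOp _), hconj, (hcomm _ _).eq]
  case r_r_e => rw [permOp_mul_locOp, mul_assoc, permOp_swap_mul_cupOp, swap_apply_left,
    locOp_mul_cupOp h01 swapMatrix_isSymm]
  case r_e_r_e => rw [hconj, locOp_mul_cupOp_mul_locOp h01]
  case rrr_e => rw [hconj, (hcomm _ _).eq]
  case e_r_e => exact cupOp_mul_locOp_mul_cupOp h01 _ (by rw [swapMatrix_trace, evalTwo_dl])
  case e_e_e => exact cupOp_mul_locOp_mul_cupOp h01 _ (by rw [diagMatrix_trace, evalTwo_dl])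
  case e_r_r => exact habs swapMatrix_isSymm
  case e_e_r => exact habs diagMatrix_isSymm

/-- The representation of the Brauer algebra on tensors. -/
noncomputable def tensorRep (n : ℕ) : Br n →ₐ[ℤ[T;T⁻¹]] Module.End ℤ[T;T⁻¹] Tensor :=
  RingQuot.liftAlgHom ℤ[T;T⁻¹] ⟨FreeAlgebra.lift _ genOp, genOp_rel⟩

theorem tensorRep_gen (g : Gen n) : tensorRep n (gen delta g) = genOp g := by
  simp [tensorRep, gen]

/-- Monomials preserve the nonnegative tensors whose entry at the constant coloring `(true, true)` is
positive. -/
theorem tensorRep_mem {F : Tensor} {x : Br n} (hx : x ∈ BrM n)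
    (hF : (∀ s, 0 ≤ F s) ∧ 0 < F fun _ => (true, true)) :
    (∀ s, 0 ≤ tensorRep n x F s) ∧ 0 < tensorRep n x F fun _ => (true, true) := by
  induction hx using Submonoid.closure_induction generalizing F with
  | one => simpa using hF
  | mul x y _ _ hx hy => rw [map_mul]; exact hx (hy hF)
  | mem x hx =>
    have hupd : ∀ i : ℕ, Function.update (fun _ => (true, true)) i ((true, true) : Color) =
        fun _ : ℕ => (true, true) := fun i => Function.update_eq_self _ _
    have hloc : ∀ (i : ℕ) (M : Matrix Color Color ℚ), (∀ x y, 0 ≤ M x y) →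
        0 < M (true, true) (true, true) → (∀ s, 0 ≤ locOp i M F s) ∧
          0 < locOp i M F fun _ => (true, true) := fun i M hM hM1 => by
      refine ⟨fun s => Finset.sum_nonneg fun x _ => mul_nonneg (hM _ _) (hF.1 _), ?_⟩
      refine Finset.sum_pos' (fun x _ => mul_nonneg (hM _ _) (hF.1 _))
        ⟨(true, true), Finset.mem_univ _, ?_⟩
      rw [hupd]
      exact mul_pos hM1 hF.2
    rcases hx with hx | ⟨g, rfl⟩
    · have h2 : evalTwo ((delta⁻¹ : (ℤ[T;T⁻¹])ˣ) : ℤ[T;T⁻¹]) = 2⁻¹ := by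
        have : evalTwo ((delta⁻¹ : (ℤ[T;T⁻¹])ˣ) : ℤ[T;T⁻¹]) * evalTwo dl = 1 := by
          rw [← map_mul, Units.inv_mul, map_one]
        rw [evalTwo_dl] at this
        linarith
      rcases hx with rfl | rfl <;>
        simp only [AlgHom.commutes, Module.algebraMap_end_apply, Pi.smul_apply, smul_rat,
          evalTwo_dl, h2]
      · exact ⟨fun s => mul_nonneg zero_le_two (hF.1 s), mul_pos zero_lt_two hF.2⟩
      · exact ⟨fun s => mul_nonneg (by norm_num) (hF.1 s), mul_pos (by norm_num) hF.2⟩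
    · rw [tensorRep_gen]
      cases g with
      | r i =>
        rcases genOp_cases i with h | ⟨k, h⟩
        · rw [genOp_r_zero h]
          refine hloc 0 _ (fun x y => ?_) (by simp [swapMatrix])
          rw [swapMatrix]
          split_ifs <;> simp
        · rw [genOp_r_pos h]
          exact ⟨fun s => hF.1 _, hF.2⟩
      | e i =>
        rcases genOp_cases i with h | ⟨k, h⟩
        · rw [genOp_e_zero h]
          refine hloc 0 _ (fun x y => ?_) (by simp [diagMatrix, diagVec])
          rw [diagMatrix, diagVec, diagVec]
          split_ifs <;> simp
        · rw [genOp_e_pos h]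
          refine ⟨fun s => ?_, ?_⟩
          · rw [cupOp_apply]
            split_ifs
            · exact Finset.sum_nonneg fun x _ => hF.1 _
            · rfl
          · rw [cupOp_apply, if_pos rfl]
            refine Finset.sum_pos' (fun x _ => hF.1 _) ⟨(true, true), Finset.mem_univ _, ?_⟩
            rw [hupd, hupd]
            exact hF.2

theorem delta_zpow (k : ℤ) :
    ((delta ^ k : (ℤ[T;T⁻¹])ˣ) : ℤ[T;T⁻¹]) = LaurentPolynomial.T k := by
  obtain ⟨m, rfl | rfl⟩ := k.eq_nat_or_neg
  · simp [delta, LaurentPolynomial.T_pow]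
  · simp [zpow_neg, ← inv_pow, delta, LaurentPolynomial.T_pow]

theorem evalTwo_delta_zpow (k : ℤ) :
    evalTwo ((delta ^ k : (ℤ[T;T⁻¹])ˣ) : ℤ[T;T⁻¹]) = 2 ^ k := by
  simp [delta_zpow, evalTwo]

/-- The powers of `δ` act freely on the Brauer monoid: in the tensor representation `δ` acts as `2`,
and a monomial does not vanish since it preserves nonnegativity of tensors and positivity of one of
their entries. -/
theorem eq_zero_of_delta_zpow_smul_eq {x : Br n} (hx : x ∈ BrM n) {k : ℤ}
    (h : ((delta ^ k : (ℤ[T;T⁻¹])ˣ) : ℤ[T;T⁻¹]) • x = x) : k = 0 := by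
  have hpos := (tensorRep_mem (F := fun _ => 1) hx ⟨fun _ => zero_le_one, zero_lt_one⟩).2
  have h1 := congrArg (fun x => tensorRep n x (fun _ => 1) fun _ => (true, true)) h
  simp only [map_smul, LinearMap.smul_apply, Pi.smul_apply, smul_rat, evalTwo_delta_zpow] at h1
  have h2 : (2 : ℚ) ^ k = 1 := by
    apply mul_right_cancel₀ hpos.ne'
    rw [h1, one_mul]
  exact (zpow_eq_one_iff_right₀ zero_le_two (by norm_num)).1 h2

/-! ### Linear independence of monomials -/

theorem T_smul_mem {x : Br n} (hx : x ∈ BrM n) (k : ℤ) :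
    (LaurentPolynomial.T k : ℤ[T;T⁻¹]) • x ∈ BrM n := by
  rw [← delta_zpow]
  exact delta_zpow_smul_mem hx k

/-- The powers of `δ` as elements of the Brauer monoid. -/
noncomputable def deltaPow (n : ℕ) : Multiplicative ℤ →* BrM n where
  toFun k := ⟨(LaurentPolynomial.T k.toAdd : ℤ[T;T⁻¹]) • 1, T_smul_mem (one_mem _) _⟩
  map_one' := Subtype.ext (by simp)
  map_mul' k l := Subtype.ext (by
    simp only [Submonoid.coe_mul, smul_mul_smul_comm, ← LaurentPolynomial.T_add, toAdd_mul, mul_one])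

theorem coe_deltaPow_mul (k : ℤ) (m : BrM n) : ((deltaPow n (.ofAdd k) * m : BrM n) : Br n) =
    (LaurentPolynomial.T k : ℤ[T;T⁻¹]) • (m : Br n) := by
  simp [deltaPow]

theorem deltaPow_mul_injective (m : BrM n) :
    Function.Injective fun k : ℤ => deltaPow n (.ofAdd k) * m := fun k l h => by
  have h1 := congrArg (fun x : BrM n => (LaurentPolynomial.T (-l) : ℤ[T;T⁻¹]) • (x : Br n)) h
  simp only [coe_deltaPow_mul, smul_smul, ← LaurentPolynomial.T_add, neg_add_cancel,
    LaurentPolynomial.T_zero, one_smul] at h1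
  rw [← delta_zpow] at h1
  have := eq_zero_of_delta_zpow_smul_eq m.2 h1
  omega

/-- The ring homomorphism from the ground ring to the monoid ring of the Brauer monoid that maps
the scalar `δ` to the monoid element `δ`. -/
noncomputable def scalarHom (n : ℕ) : ℤ[T;T⁻¹] →+* MonoidAlgebra ℤ (BrM n) :=
  (AddMonoidAlgebra.lift ℤ (MonoidAlgebra ℤ (BrM n)) ℤ
    ((MonoidAlgebra.of ℤ (BrM n)).comp (deltaPow n))).toRingHom

theorem scalarHom_single (k a : ℤ) : scalarHom n (.single k a) =
    MonoidAlgebra.single (deltaPow n (.ofAdd k)) a := by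
  simp [scalarHom, -LaurentPolynomial.single_eq_C_mul_T]

/-- The monoid ring of the Brauer monoid, as an algebra over `ℤ[δ, δ⁻¹]` in which the scalar `δ` is
the monoid element `δ`. -/
noncomputable instance : Algebra ℤ[T;T⁻¹] (MonoidAlgebra ℤ (BrM n)) :=
  (scalarHom n).toAlgebra' fun c x => by
    induction c using AddMonoidAlgebra.induction_linear with
    | zero => simp
    | add f g hf hg => rw [map_add, add_mul, mul_add, hf, hg]
    | single k a =>
      induction x using MonoidAlgebra.induction_linear with
      | zero => simp
      | add f g hf hg => rw [add_mul, mul_add, hf, hg]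
      | single m b =>
        rw [scalarHom_single, MonoidAlgebra.single_mul_single, MonoidAlgebra.single_mul_single,
          mul_comm a]
        congr 1
        exact Subtype.ext (by simp [deltaPow])

theorem smul_of (c : ℤ[T;T⁻¹]) (m : BrM n) : c • MonoidAlgebra.of ℤ (BrM n) m =
    scalarHom n c * MonoidAlgebra.of ℤ (BrM n) m := rfl

open scoped Classical in
theorem coeff_smul_of (c : ℤ[T;T⁻¹]) (m : BrM n) (l : ℤ) :
    (c • MonoidAlgebra.of ℤ (BrM n) m).coeff (deltaPow n (.ofAdd l) * m) = c.coeff l := by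
  induction c using AddMonoidAlgebra.induction_linear with
  | zero => simp
  | add f g hf hg => rw [add_smul, MonoidAlgebra.coeff_add, Finsupp.add_apply, hf, hg]; rfl
  | single k a =>
    rw [smul_of, scalarHom_single, MonoidAlgebra.of_apply, MonoidAlgebra.single_mul_single, mul_one,
      MonoidAlgebra.coeff_single, AddMonoidAlgebra.coeff_single, Finsupp.single_apply,
      Finsupp.single_apply]
    exact if_congr (deltaPow_mul_injective m).eq_iff rfl rfl

open scoped Classical in
theorem coeff_smul_of_eq_zero (c : ℤ[T;T⁻¹]) {m x : BrM n}
    (h : ∀ k, deltaPow n (.ofAdd k) * m ≠ x) :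
    (c • MonoidAlgebra.of ℤ (BrM n) m).coeff x = 0 := by
  induction c using AddMonoidAlgebra.induction_linear with
  | zero => simp
  | add f g hf hg => rw [add_smul, MonoidAlgebra.coeff_add, Finsupp.add_apply, hf, hg, add_zero]
  | single k a =>
    rw [smul_of, scalarHom_single, MonoidAlgebra.of_apply, MonoidAlgebra.single_mul_single, mul_one,
      MonoidAlgebra.coeff_single, Finsupp.single_apply, if_neg (h k)]

theorem T_smul_of (k : ℤ) (m : BrM n) :
    (LaurentPolynomial.T k : ℤ[T;T⁻¹]) • MonoidAlgebra.of ℤ (BrM n) m =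
      MonoidAlgebra.of ℤ (BrM n) ⟨_, T_smul_mem m.2 k⟩ := by
  have h : scalarHom n (LaurentPolynomial.T k) = _ := scalarHom_single k 1
  rw [smul_of, h, MonoidAlgebra.of_apply, MonoidAlgebra.single_mul_single, mul_one, MonoidAlgebra.of_apply]
  congr 1
  exact Subtype.ext (coe_deltaPow_mul k m)

/-- The assignment of generators that underlies `toMonoidAlgebra`. -/
noncomputable def freeToMonoidAlgebra (n : ℕ) :
    FreeAlgebra ℤ[T;T⁻¹] (Gen n) →ₐ[ℤ[T;T⁻¹]] MonoidAlgebra ℤ (BrM n) :=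
  FreeAlgebra.lift ℤ[T;T⁻¹] fun g => MonoidAlgebra.of ℤ (BrM n) ⟨gen delta g, gen_mem g⟩

/-- The images of `x` in the Brauer algebra and in the monoid ring are one and the same element of
the Brauer monoid. -/
def IsMonomial (x : FreeAlgebra ℤ[T;T⁻¹] (Gen n)) : Prop :=
  ∃ m : BrM n, RingQuot.mkAlgHom ℤ[T;T⁻¹] (Rel n ℤ[T;T⁻¹] delta) x = m ∧
    freeToMonoidAlgebra n x = MonoidAlgebra.of ℤ (BrM n) m

theorem isMonomial_fr (i : Fin n) : IsMonomial (fr ℤ[T;T⁻¹] i) :=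
  ⟨⟨gen delta (.r i), gen_mem _⟩, rfl, by simp [freeToMonoidAlgebra, fr]⟩

theorem isMonomial_fe (i : Fin n) : IsMonomial (fe ℤ[T;T⁻¹] i) :=
  ⟨⟨gen delta (.e i), gen_mem _⟩, rfl, by simp [freeToMonoidAlgebra, fe]⟩

theorem isMonomial_one : IsMonomial (1 : FreeAlgebra ℤ[T;T⁻¹] (Gen n)) :=
  ⟨1, by simp, by rw [map_one, map_one]⟩

theorem IsMonomial.mul {x y : FreeAlgebra ℤ[T;T⁻¹] (Gen n)} (hx : IsMonomial x)
    (hy : IsMonomial y) : IsMonomial (x * y) := by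
  obtain ⟨m, h1, h2⟩ := hx
  obtain ⟨m', h3, h4⟩ := hy
  exact ⟨m * m', by simp [h1, h3], by rw [map_mul, map_mul, h2, h4]⟩

theorem IsMonomial.dl_smul {x : FreeAlgebra ℤ[T;T⁻¹] (Gen n)} (hx : IsMonomial x) :
    IsMonomial (dl • x) := by
  obtain ⟨m, h1, h2⟩ := hx
  exact ⟨⟨_, T_smul_mem m.2 1⟩, by rw [map_smul, h1]; rfl, by rw [map_smul, h2, ← T_smul_of]; rfl⟩

theorem IsMonomial.dl_sq_smul {x : FreeAlgebra ℤ[T;T⁻¹] (Gen n)} (hx : IsMonomial x) :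
    IsMonomial ((dl ^ 2) • x) := by
  rw [pow_two, mul_smul]
  exact hx.dl_smul.dl_smul

/-- Both sides of each defining relation are monomials, so that it holds in the monoid ring because
it holds in the Brauer monoid. -/
theorem freeToMonoidAlgebra_rel ⦃x y : FreeAlgebra ℤ[T;T⁻¹] (Gen n)⦄
    (h : Rel n ℤ[T;T⁻¹] delta x y) : freeToMonoidAlgebra n x = freeToMonoidAlgebra n y := by
  have key : IsMonomial x ∧ IsMonomial y := by
    cases h <;> constructor <;>
      repeat' first
        | exact isMonomial_fr _
        | exact isMonomial_fe _
        | exact isMonomial_one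
        | apply IsMonomial.dl_sq_smul
        | apply IsMonomial.dl_smul
        | apply IsMonomial.mul
  obtain ⟨⟨m, h1, h2⟩, ⟨m', h3, h4⟩⟩ := key
  rw [h2, h4, show m = m' from Subtype.ext (by rw [← h1, ← h3, rel_eq h])]

/-- The homomorphism from the Brauer algebra to the monoid ring of the Brauer monoid. -/
noncomputable def toMonoidAlgebra (n : ℕ) : Br n →ₐ[ℤ[T;T⁻¹]] MonoidAlgebra ℤ (BrM n) :=
  RingQuot.liftAlgHom ℤ[T;T⁻¹] ⟨freeToMonoidAlgebra n, freeToMonoidAlgebra_rel⟩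

/-- On the Brauer monoid the homomorphism is the canonical inclusion. -/
theorem toMonoidAlgebra_coe (m : BrM n) :
    toMonoidAlgebra n m = MonoidAlgebra.of ℤ (BrM n) m := by
  obtain ⟨x, hx⟩ := m
  have hT : ∀ k : ℤ, ∀ h, toMonoidAlgebra n (algebraMap ℤ[T;T⁻¹] (Br n) (LaurentPolynomial.T k)) =
      MonoidAlgebra.of ℤ (BrM n) ⟨algebraMap ℤ[T;T⁻¹] (Br n) (LaurentPolynomial.T k), h⟩ := by
    intro k h
    rw [AlgHom.commutes, Algebra.algebraMap_eq_smul_one, ← map_one (MonoidAlgebra.of ℤ (BrM n)),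
      T_smul_of]
    congr 1
    exact Subtype.ext (Algebra.algebraMap_eq_smul_one _).symm
  induction hx using Submonoid.closure_induction with
  | one => exact map_one _
  | mul x y hx hy h1 h2 =>
    rw [show (⟨x * y, _⟩ : BrM n) = ⟨x, hx⟩ * ⟨y, hy⟩ from rfl, map_mul, ← h1, ← h2]
    exact map_mul _ _ _
  | mem x hx =>
    rcases hx with (rfl | rfl) | ⟨g, rfl⟩
    · exact hT 1 _
    · exact hT (-1) _
    · simp [toMonoidAlgebra, gen, freeToMonoidAlgebra]

/-- Equality of elements of the Brauer monoid up to a power of `δ`. -/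
def deltaSetoid (n : ℕ) : Setoid (BrM n) where
  r x y := ∃ k : ℤ, deltaPow n (.ofAdd k) * x = y
  iseqv :=
    { refl := fun x => ⟨0, by simp⟩
      symm := fun {x y} ⟨k, h⟩ => ⟨-k, by
        rw [← h, ← mul_assoc, ← map_mul, ← ofAdd_add, neg_add_cancel, ofAdd_zero, map_one, one_mul]⟩
      trans := fun {x y z} ⟨k, h⟩ ⟨l, h'⟩ => ⟨l + k, by
        rw [ofAdd_add, map_mul, mul_assoc, h, h']⟩ }

/-- The elements of the Brauer monoid, taken up to powers of `δ`, form a basis. -/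
theorem free (n : ℕ) : Module.Free ℤ[T;T⁻¹] (Br n) := by
  let v : Quotient (deltaSetoid n) → Br n := fun q => (q.out : BrM n)
  have hli : LinearIndependent ℤ[T;T⁻¹] v := by
    rw [linearIndependent_iff']
    intro s g h0 q hq
    have h1 := congrArg (toMonoidAlgebra n) h0
    simp only [map_sum, map_smul, v, toMonoidAlgebra_coe, map_zero] at h1
    refine LaurentPolynomial.ext fun l => ?_
    have h2 := congrArg (fun f => f.coeff (deltaPow n (.ofAdd l) * q.out)) h1
    simp only [MonoidAlgebra.coeff_sum, MonoidAlgebra.coeff_zero, Finsupp.coe_zero, Pi.zero_apply,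
      Finsupp.finsetSum_apply] at h2
    rw [Finset.sum_eq_single q, coeff_smul_of] at h2
    · exact h2
    · intro i _ hi
      refine coeff_smul_of_eq_zero _ fun k hk => hi ?_
      rw [← i.out_eq, ← q.out_eq]
      refine Quotient.sound ⟨k - l, ?_⟩
      rw [sub_eq_neg_add, ofAdd_add, map_mul, mul_assoc, hk, ← mul_assoc, ← map_mul, ← ofAdd_add,
        neg_add_cancel, ofAdd_zero, map_one, one_mul]
    · exact fun h => absurd hq h
  refine Module.Free.of_basis (Module.Basis.mk hli ?_)
  rw [← span_BrM n, Submodule.span_le]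
  intro x hx
  obtain ⟨k, hk⟩ := Quotient.exact (Quotient.out_eq (Quotient.mk (deltaSetoid n) ⟨x, hx⟩))
  have : _ = x := congrArg Subtype.val hk
  rw [coe_deltaPow_mul] at this
  rw [SetLike.mem_coe, ← this]
  exact Submodule.smul_mem _ _ (Submodule.subset_span ⟨_, rfl⟩)

end BrauerC

theorem mainTheorem3 (n : ℕ) (D : ℕ → ℕ → Set (BrauerC.W n))
    (hD : ∀ i p : ℕ, i ≤ n → p ≤ i → Even (i - p) →
      Subgroup.IsComplement (D i p) (BrauerC.N n i p : Set (BrauerC.W n))) :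
    (∀ x ∈ BrauerC.BrM n, ∃ (k : ℤ) (i p p' : ℕ),
        i ≤ n ∧ p ≤ i ∧ p' ≤ i ∧ Even (i - p) ∧ Even (i - p') ∧
        ∃ u ∈ D i p, ∃ v ∈ BrauerC.L n i, ∃ w ∈ D i p',
          x = ((BrauerC.delta ^ k : (LaurentPolynomial ℤ)ˣ) : LaurentPolynomial ℤ) •
            (u.toBr * BrauerC.bTriple n p i p' * v.toBr * BrauerC.opp w.toBr)) ∧
      Module.Free (LaurentPolynomial ℤ) (BrauerC.Br n) ∧
      Module.rank (LaurentPolynomial ℤ) (BrauerC.Br n) ≤ (BrauerC.a (2 * n) : Cardinal) := by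
  exact ⟨fun x hx => BrauerC.exists_normalForm D hD hx, BrauerC.free n, BrauerC.rank_le n⟩
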